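/- Let $\mathbb K\in\{\mathbb R,\mathbb C\}$, let $N\ge 1$ and $1\le k\le\left[\frac{N-1}{2}\right]$ be integers, and let $p>1$, $\alpha\neq 0$ and $\omega>\frac{\alpha^2}{(N-2k)^2}$ be real numbers. Let $\mathcal G$ be the star graph of $N$ half-lines $(0,\infty)$ joined at the vertex $0$, let $L^2(\mathcal G)=\bigoplus_{j=1}^N L^2(0,\infty)$ ($\mathbb K$-valued functions, inner product $(\cdot,\cdot)_2$ linear in the first argument), and let $$\mathcal E=\Big\{\mathbf V=(v_j)_{j=1}^N\in \bigoplus_{j=1}^N H^1(0,\infty):\ v_1(0)=\dots=v_N(0)\Big\}.$$ Let $\mathbf\Phi_k=(\varphi_{k,j})_{j=1}^N$ be the profile $$\varphi_{k,j}(x)=\Big[\tfrac{(p+1)\omega}{2}\operatorname{sech}^2\Big(\tfrac{(p-1)\sqrt\omega}{2}x\mp a_k\Big)\Big]^{\frac1{p-1}},\qquad a_k=\tanh^{-1}\Big(\tfrac{\alpha}{(2k-N)\sqrt\omega}\Big),$$ with the sign $-$ for $1\le j\le k$ and the sign $+$ for $k+1\le j\le N$. For $\mathbf F=(f_j)_{j=1}^N$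 and $\mathbf G=(g_j)_{j=1}^N$ in $\mathcal E$ put $$B_{1,k}^\alpha(\mathbf F,\mathbf G)=\sum_{j=1}^N\int_0^\infty\big(f_j'\overline{g_j'}+\omega f_j\overline{g_j}-p\,\varphi_{k,j}^{p-1}f_j\overline{g_j}\big)\,dx+\alpha f_1(0)\overline{g_1(0)},$$ $$B_{2,k}^\alpha(\mathbf F,\mathbf G)=\sum_{j=1}^N\int_0^\infty\big(f_j'\overline{g_j'}+\omega f_j\overline{g_j}-\varphi_{k,j}^{p-1}f_j\overline{g_j}\big)\,dx+\alpha f_1(0)\overline{g_1(0)},$$ and let $\mathbf L_{1,k}^\alpha$, $\mathbf L_{2,k}^\alpha$ be the self-adjoint operators on $L^2(\mathcal G)$ associated with these forms: $\mathbf V\in\mathrm{dom}(\mathbf L_{i,k}^\alpha)$ and $\mathbf L_{i,k}^\alpha\mathbf V=\mathbf W$ mean that $\mathbf V\in\mathcal E$, $\mathbf W\in L^2(\mathcal G)$ and $B_{i,k}^\alpha(\mathbf V,\mathbf Z)=(\mathbf W,\mathbf Z)_2$ for all $\mathbf Z\in\mathcal E$. Then the following assertions hold. (i) $\mathbf\Phi_k\in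 L^2(\mathcal G)$, $\ker(\mathbf L_{2,k}^\alpha)=\operatorname{span}\{\mathbf\Phi_k\}$, and $\mathbf L_{2,k}^\alpha\ge 0$. (ii) $\ker(\mathbf L_{1,k}^\alpha)=\{\mathbf 0\}$. (iii) The positive part of the spectrum of $\mathbf L_{1,k}^\alpha$ and of $\mathbf L_{2,k}^\alpha$ is bounded away from zero, i.e. for $i=1,2$ there is $\delta>0$ with $\sigma(\mathbf L_{i,k}^\alpha)\cap(0,\delta)=\varnothing$; and $\sigma_{\mathrm{ess}}(\mathbf L_{1,k}^\alpha)=\sigma_{\mathrm{ess}}(\mathbf L_{2,k}^\alpha)=[\omega,\infty)$. Here $\sigma_{\mathrm{ess}}$ is the spectrum without its isolated points that are eigenvalues of finite multiplicity. -/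

import Mathlib

open MeasureTheory Set Filter
open scoped ENNReal Topology BoundedContinuousFunction

noncomputable section

/-! ### Unbounded operators: kernel, spectrum, discrete and essential spectrum -/

namespace UnboundedOp

variable {𝕜 H : Type*} [RCLike 𝕜] [NormedAddCommGroup H] [InnerProductSpace 𝕜 H]

/-- The eigenspace `ker (A - l)` of a partially defined operator, as a subspace of `H`. -/
def eigenspace (A : H →ₗ.[𝕜] H) (l : 𝕜) : Submodule 𝕜 H :=
  (LinearMap.eqLocus A.toFun (l • A.domain.subtype)).map A.domain.subtype

/-- The kernel of a partially defined operator, as a subspace of `H`. -/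
def kernel (A : H →ₗ.[𝕜] H) : Submodule 𝕜 H := eigenspace A 0

/-- `A ≥ 0` in the sense of quadratic forms. -/
def Nonneg (A : H →ₗ.[𝕜] H) : Prop :=
  ∀ v : A.domain, 0 ≤ RCLike.re (inner 𝕜 (v : H) (A v))

/-- `l` is in the resolvent set iff `A - l : dom A → H` has a bounded two-sided inverse. -/
def resolventSet (A : H →ₗ.[𝕜] H) : Set 𝕜 :=
  {l | ∃ R : H →L[𝕜] H,
    (∀ u : H, ∃ h : R u ∈ A.domain, A ⟨R u, h⟩ - l • R u = u) ∧
    ∀ v : A.domain, R (A v - l • (v : H)) = v}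

/-- The spectrum of a partially defined operator. -/
def spectrum (A : H →ₗ.[𝕜] H) : Set 𝕜 := (resolventSet A)ᶜ

/-- The discrete spectrum: isolated points of the spectrum which are eigenvalues of finite
multiplicity. -/
def discreteSpectrum (A : H →ₗ.[𝕜] H) : Set 𝕜 :=
  {l | l ∈ spectrum A ∧ (∃ ε > 0, ∀ m ∈ spectrum A, dist m l < ε → m = l) ∧
    eigenspace A l ≠ ⊥ ∧ FiniteDimensional 𝕜 (eigenspace A l)}

/-- The essential spectrum (of a self-adjoint operator): what remains of the spectrum when the
discrete spectrum is removed. -/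
def essentialSpectrum (A : H →ₗ.[𝕜] H) : Set 𝕜 := spectrum A \ discreteSpectrum A

end UnboundedOp

/-! ### Function spaces on the half-line and on the star graph -/

namespace StarGraph

/-- Lebesgue measure on the half-line `(0, ∞)`. -/
abbrev halfLine : Measure ℝ := volume.restrict (Ioi 0)

/-- `L²(0, ∞)`. -/
abbrev L2Half (𝕜 : Type*) [RCLike 𝕜] := Lp 𝕜 2 halfLine

/-- `L²` of the star graph with `N` half-lines: the Hilbert sum of `N` copies of `L²(0, ∞)`. -/
abbrev L2Graph (𝕜 : Type*) [RCLike 𝕜] (N : ℕ) := PiLp 2 (fun _ : Fin N => L2Half 𝕜)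

variable {𝕜 : Type*} [RCLike 𝕜]

/-- Test functions on the open half-line: smooth, with compact support inside `(0, ∞)`. -/
def IsTest (ψ : ℝ → ℝ) : Prop :=
  ContDiff ℝ (⊤ : ℕ∞) ψ ∧ HasCompactSupport ψ ∧ tsupport ψ ⊆ Ioi 0

/-- `g` is the weak (distributional) derivative of `f` on `(0, ∞)`. -/
def HasWeakDeriv (f g : L2Half 𝕜) : Prop :=
  ∀ ψ : ℝ → ℝ, IsTest ψ →
    ∫ x in Ioi (0 : ℝ), deriv ψ x • f x = - ∫ x in Ioi (0 : ℝ), ψ x • g x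

/-- `c` is the boundary value `f(0)` of (the continuous representative on `[0, ∞)` of) `f`. -/
def HasBoundaryValue (f : L2Half 𝕜) (c : 𝕜) : Prop :=
  ∃ F : ℝ → 𝕜, ContinuousOn F (Ici 0) ∧ f =ᵐ[halfLine] F ∧ F 0 = c

lemma integrable_test_smul {ψ : ℝ → ℝ} (hc : Continuous ψ) (hs : HasCompactSupport ψ)
    (f : L2Half 𝕜) : Integrable (fun x => ψ x • f x) halfLine := by
  have h1 : MemLp ψ 2 halfLine := (hc.memLp_of_hasCompactSupport hs).restrict _
  exact memLp_one_iff_integrable.1 ((Lp.memLp f).smul h1)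

lemma IsTest.continuous_deriv {ψ : ℝ → ℝ} (h : IsTest ψ) : Continuous (deriv ψ) :=
  h.1.continuous_deriv (by simp)

lemma HasWeakDeriv.add {f g f' g' : L2Half 𝕜} (hf : HasWeakDeriv f f')
    (hg : HasWeakDeriv g g') : HasWeakDeriv (f + g) (f' + g') := by
  intro ψ hψ
  have i1 := integrable_test_smul hψ.continuous_deriv hψ.2.1.deriv f
  have i2 := integrable_test_smul hψ.continuous_deriv hψ.2.1.deriv g
  have i3 := integrable_test_smul hψ.1.continuous hψ.2.1 f'
  have i4 := integrable_test_smul hψ.1.continuous hψ.2.1 g'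
  have e1 : ∫ x in Ioi (0 : ℝ), deriv ψ x • (f + g) x
      = ∫ x in Ioi (0 : ℝ), (deriv ψ x • f x + deriv ψ x • g x) := by
    refine integral_congr_ae ?_
    filter_upwards [Lp.coeFn_add f g] with x hx
    rw [hx, Pi.add_apply, smul_add]
  have e2 : ∫ x in Ioi (0 : ℝ), ψ x • (f' + g') x
      = ∫ x in Ioi (0 : ℝ), (ψ x • f' x + ψ x • g' x) := by
    refine integral_congr_ae ?_
    filter_upwards [Lp.coeFn_add f' g'] with x hx
    rw [hx, Pi.add_apply, smul_add]
  rw [e1, e2, integral_add i1 i2, integral_add i3 i4, hf ψ hψ, hg ψ hψ, neg_add]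

lemma HasWeakDeriv.smul {f f' : L2Half 𝕜} (c : 𝕜) (hf : HasWeakDeriv f f') :
    HasWeakDeriv (c • f) (c • f') := by
  intro ψ hψ
  have e1 : ∫ x in Ioi (0 : ℝ), deriv ψ x • (c • f) x
      = ∫ x in Ioi (0 : ℝ), c • (deriv ψ x • f x) := by
    refine integral_congr_ae ?_
    filter_upwards [Lp.coeFn_smul c f] with x hx
    rw [hx, Pi.smul_apply, smul_comm]
  have e2 : ∫ x in Ioi (0 : ℝ), ψ x • (c • f') x
      = ∫ x in Ioi (0 : ℝ), c • (ψ x • f' x) := by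
    refine integral_congr_ae ?_
    filter_upwards [Lp.coeFn_smul c f'] with x hx
    rw [hx, Pi.smul_apply, smul_comm]
  rw [e1, e2, integral_smul, integral_smul, hf ψ hψ, smul_neg]

lemma hasWeakDeriv_zero : HasWeakDeriv (0 : L2Half 𝕜) 0 := by
  intro ψ hψ
  have e (φ : ℝ → ℝ) : ∫ x in Ioi (0 : ℝ), φ x • (0 : L2Half 𝕜) x = 0 := by
    rw [integral_congr_ae (g := fun _ => (0 : 𝕜)), integral_zero]
    filter_upwards [Lp.coeFn_zero 𝕜 2 halfLine] with x hx
    rw [hx, Pi.zero_apply, smul_zero]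
  rw [e, e, neg_zero]

/-- An `L²` function orthogonal to all test functions vanishes. -/
lemma eq_zero_of_test {f : L2Half 𝕜}
    (h : ∀ ψ : ℝ → ℝ, IsTest ψ → ∫ x in Ioi (0 : ℝ), ψ x • f x = 0) : f = 0 := by
  have hl : LocallyIntegrable (f : ℝ → 𝕜) halfLine :=
    (Lp.memLp f).locallyIntegrable (by norm_num)
  have := isOpen_Ioi.ae_eq_zero_of_integral_contDiff_smul_eq_zero (U := Ioi (0 : ℝ))
    (μ := halfLine) (hl.locallyIntegrableOn _) (fun g h1 h2 h3 => h g ⟨h1, h2, h3⟩)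
  rw [Lp.eq_zero_iff_ae_eq_zero]
  filter_upwards [this, ae_restrict_mem measurableSet_Ioi] with x hx hx0 using hx hx0

lemma HasWeakDeriv.unique {f g g' : L2Half 𝕜} (h : HasWeakDeriv f g)
    (h' : HasWeakDeriv f g') : g = g' := by
  have h0 : HasWeakDeriv (0 : L2Half 𝕜) (g - g') := by
    have := h.add (h'.smul (-1))
    simpa [sub_eq_add_neg] using this
  refine sub_eq_zero.1 (eq_zero_of_test fun ψ hψ => ?_)
  have h1 := h0 ψ hψ
  have h2 := hasWeakDeriv_zero (𝕜 := 𝕜) ψ hψ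
  rw [h2] at h1
  have e : ∫ x in Ioi (0 : ℝ), ψ x • (0 : L2Half 𝕜) x = 0 := by
    rw [integral_congr_ae (g := fun _ => (0 : 𝕜)), integral_zero]
    filter_upwards [Lp.coeFn_zero 𝕜 2 halfLine] with x hx
    rw [hx, Pi.zero_apply, smul_zero]
  rw [e] at h1
  simpa using h1.symm

/-- The Sobolev space `H¹(0, ∞)`. -/
def H1 (𝕜 : Type*) [RCLike 𝕜] : Submodule 𝕜 (L2Half 𝕜) where
  carrier := {f | ∃ g, HasWeakDeriv f g}
  add_mem' := fun ⟨_, h⟩ ⟨_, h'⟩ => ⟨_, h.add h'⟩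
  zero_mem' := ⟨0, hasWeakDeriv_zero⟩
  smul_mem' := fun c _ ⟨_, h⟩ => ⟨_, h.smul c⟩

/-- The weak derivative `H¹(0, ∞) → L²(0, ∞)`. -/
def weakDeriv : H1 𝕜 →ₗ[𝕜] L2Half 𝕜 where
  toFun f := f.2.choose
  map_add' f g :=
    (f + g).2.choose_spec.unique (f.2.choose_spec.add g.2.choose_spec)
  map_smul' c f := (c • f).2.choose_spec.unique (f.2.choose_spec.smul c)

lemma HasBoundaryValue.add {f g : L2Half 𝕜} {c d : 𝕜} (hf : HasBoundaryValue f c)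
    (hg : HasBoundaryValue g d) : HasBoundaryValue (f + g) (c + d) := by
  obtain ⟨F, hF, hfF, rfl⟩ := hf
  obtain ⟨G, hG, hgG, rfl⟩ := hg
  exact ⟨F + G, hF.add hG, (Lp.coeFn_add f g).trans (hfF.add hgG), rfl⟩

lemma HasBoundaryValue.smul {f : L2Half 𝕜} {c : 𝕜} (a : 𝕜) (hf : HasBoundaryValue f c) :
    HasBoundaryValue (a • f) (a • c) := by
  obtain ⟨F, hF, hfF, rfl⟩ := hf
  exact ⟨a • F, hF.const_smul a, (Lp.coeFn_smul a f).trans (hfF.const_smul a), rfl⟩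

lemma hasBoundaryValue_zero : HasBoundaryValue (0 : L2Half 𝕜) 0 :=
  ⟨0, continuousOn_const, Lp.coeFn_zero _ _ _, rfl⟩

lemma HasBoundaryValue.unique {f : L2Half 𝕜} {c d : 𝕜} (hf : HasBoundaryValue f c)
    (hg : HasBoundaryValue f d) : c = d := by
  obtain ⟨F, hF, hfF, rfl⟩ := hf
  obtain ⟨G, hG, hgG, rfl⟩ := hg
  have hae : F =ᵐ[volume.restrict (Ioi 0)] G := hfF.symm.trans hgG
  have heq : EqOn F G (Ioi 0) :=
    Measure.eqOn_open_of_ae_eq hae isOpen_Ioi (hF.mono Ioi_subset_Ici_self)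
      (hG.mono Ioi_subset_Ici_self)
  have h1 : Tendsto F (𝓝[>] 0) (𝓝 (F 0)) :=
    (hF 0 self_mem_Ici).mono_left (nhdsWithin_mono _ Ioi_subset_Ici_self)
  have h2 : Tendsto G (𝓝[>] 0) (𝓝 (G 0)) :=
    (hG 0 self_mem_Ici).mono_left (nhdsWithin_mono _ Ioi_subset_Ici_self)
  refine tendsto_nhds_unique h1 (h2.congr' ?_)
  filter_upwards [self_mem_nhdsWithin] with x hx using (heq hx).symm

/-- The form domain `ℰ`: vector functions in `H¹` of the graph that are continuous at the
vertex, `v₁(0) = ⋯ = v_N(0)`. -/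
def formDomain (𝕜 : Type*) [RCLike 𝕜] (N : ℕ) : Submodule 𝕜 (L2Graph 𝕜 N) where
  carrier := {V | (∀ j, V j ∈ H1 𝕜) ∧ ∃ c : 𝕜, ∀ j, HasBoundaryValue (V j) c}
  add_mem' := fun ⟨h, c, hc⟩ ⟨h', d, hd⟩ =>
    ⟨fun j => (H1 𝕜).add_mem (h j) (h' j), c + d, fun j => (hc j).add (hd j)⟩
  zero_mem' := ⟨fun _ => (H1 𝕜).zero_mem, 0, fun _ => hasBoundaryValue_zero⟩
  smul_mem' := fun a _ ⟨h, c, hc⟩ =>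
    ⟨fun j => (H1 𝕜).smul_mem a (h j), a • c, fun j => (hc j).smul a⟩

variable {N : ℕ}

/-- The weak derivative on the `j`-th edge. -/
def edgeDeriv (j : Fin N) : formDomain 𝕜 N →ₗ[𝕜] L2Half 𝕜 where
  toFun V := weakDeriv ⟨(V : L2Graph 𝕜 N) j, V.2.1 j⟩
  map_add' V W := weakDeriv.map_add ⟨_, V.2.1 j⟩ ⟨_, W.2.1 j⟩
  map_smul' c V := weakDeriv.map_smul c ⟨_, V.2.1 j⟩

/-- The common value `v₁(0) = ⋯ = v_N(0)` at the vertex. -/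
def vertexValue [NeZero N] : formDomain 𝕜 N →ₗ[𝕜] 𝕜 where
  toFun V := V.2.2.choose
  map_add' V W := ((V + W).2.2.choose_spec 0).unique
    ((V.2.2.choose_spec 0).add (W.2.2.choose_spec 0))
  map_smul' c V := ((c • V).2.2.choose_spec 0).unique ((V.2.2.choose_spec 0).smul c)

/-! ### The quadratic form and the operator it represents -/

/-- The form `∑ⱼ ∫₀^∞ (fⱼ' gⱼ' + qⱼ fⱼ gⱼ) dx + α f₁(0) g₁(0)` on `ℰ`, with complex conjugates on
the second argument (no effect for real scalars). -/
def form [NeZero N] (α : ℝ) (q : Fin N → ℝ →ᵇ ℝ) (F G : formDomain 𝕜 N) : 𝕜 :=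
  (∑ j, ∫ x in Ioi (0 : ℝ),
      (edgeDeriv j F x * star (edgeDeriv j G x)
        + (q j x : 𝕜) * ((F : L2Graph 𝕜 N) j x * star ((G : L2Graph 𝕜 N) j x))))
    + (α : 𝕜) * (vertexValue F * star (vertexValue G))

lemma integrable_mul_star (f g : L2Half 𝕜) :
    Integrable (fun x => f x * star (g x)) halfLine := by
  have h := L2.integrable_inner (𝕜 := 𝕜) g f
  simpa [RCLike.inner_apply] using h

lemma integrable_form_term (q : ℝ →ᵇ ℝ) (f g f' g' : L2Half 𝕜) :
    Integrable (fun x => f' x * star (g' x) + (q x : 𝕜) * (f x * star (g x))) halfLine := by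
  refine (integrable_mul_star f' g').add ?_
  refine (integrable_mul_star f g).bdd_mul (c := ‖q‖) ?_ ?_
  · exact (RCLike.continuous_ofReal.comp q.continuous).aestronglyMeasurable
  · refine Eventually.of_forall fun x => ?_
    rw [RCLike.norm_ofReal]
    exact q.norm_coe_le_norm x

lemma form_add_left [NeZero N] (α : ℝ) (q : Fin N → ℝ →ᵇ ℝ) (F F' G : formDomain 𝕜 N) :
    form α q (F + F') G = form α q F G + form α q F' G := by
  have key : ∀ j, ∫ x in Ioi (0 : ℝ),
      (edgeDeriv j (F + F') x * star (edgeDeriv j G x)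
        + (q j x : 𝕜) * (((F + F' : formDomain 𝕜 N) : L2Graph 𝕜 N) j x
            * star ((G : L2Graph 𝕜 N) j x)))
      = (∫ x in Ioi (0 : ℝ), (edgeDeriv j F x * star (edgeDeriv j G x)
        + (q j x : 𝕜) * ((F : L2Graph 𝕜 N) j x * star ((G : L2Graph 𝕜 N) j x))))
      + ∫ x in Ioi (0 : ℝ), (edgeDeriv j F' x * star (edgeDeriv j G x)
        + (q j x : 𝕜) * ((F' : L2Graph 𝕜 N) j x * star ((G : L2Graph 𝕜 N) j x))) := by
    intro j
    rw [← integral_add (integrable_form_term _ _ _ _ _) (integrable_form_term _ _ _ _ _)]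
    refine integral_congr_ae ?_
    have h1 := Lp.coeFn_add (edgeDeriv j F) (edgeDeriv j F')
    have h2 := Lp.coeFn_add ((F : L2Graph 𝕜 N) j) ((F' : L2Graph 𝕜 N) j)
    filter_upwards [h1, h2] with x hx1 hx2
    rw [map_add, hx1, Submodule.coe_add, PiLp.add_apply, hx2, Pi.add_apply, Pi.add_apply]
    ring
  unfold form
  rw [Finset.sum_congr rfl fun j _ => key j, Finset.sum_add_distrib, map_add]
  ring

lemma form_smul_left [NeZero N] (α : ℝ) (q : Fin N → ℝ →ᵇ ℝ) (c : 𝕜) (F G : formDomain 𝕜 N) :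
    form α q (c • F) G = c * form α q F G := by
  have key : ∀ j, ∫ x in Ioi (0 : ℝ),
      (edgeDeriv j (c • F) x * star (edgeDeriv j G x)
        + (q j x : 𝕜) * (((c • F : formDomain 𝕜 N) : L2Graph 𝕜 N) j x
            * star ((G : L2Graph 𝕜 N) j x)))
      = c * ∫ x in Ioi (0 : ℝ), (edgeDeriv j F x * star (edgeDeriv j G x)
        + (q j x : 𝕜) * ((F : L2Graph 𝕜 N) j x * star ((G : L2Graph 𝕜 N) j x))) := by
    intro j
    rw [← integral_const_mul]
    refine integral_congr_ae ?_
    have h1 := Lp.coeFn_smul c (edgeDeriv j F)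
    have h2 := Lp.coeFn_smul c ((F : L2Graph 𝕜 N) j)
    filter_upwards [h1, h2] with x hx1 hx2
    rw [map_smul, hx1, Submodule.coe_smul, PiLp.smul_apply, hx2, Pi.smul_apply, Pi.smul_apply,
      smul_eq_mul, smul_eq_mul]
    ring
  unfold form
  rw [Finset.sum_congr rfl fun j _ => key j, ← Finset.mul_sum, map_smul, smul_eq_mul]
  ring

lemma isTest_hasBoundaryValue {ψ : ℝ → ℝ} (h : IsTest ψ) {f : L2Half 𝕜}
    (hf : f =ᵐ[halfLine] fun x => (ψ x : 𝕜)) : HasBoundaryValue f 0 := by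
  refine ⟨fun x => (ψ x : 𝕜),
    (RCLike.continuous_ofReal.comp h.1.continuous).continuousOn, hf, ?_⟩
  have : (0 : ℝ) ∉ tsupport ψ := fun h0 => lt_irrefl (0 : ℝ) (h.2.2 h0)
  simp [image_eq_zero_of_notMem_tsupport this]

lemma IsTest.memLp {ψ : ℝ → ℝ} (hc : Continuous ψ) (hs : HasCompactSupport ψ) :
    MemLp (fun x => (ψ x : 𝕜)) 2 halfLine :=
  ((hc.memLp_of_hasCompactSupport hs).restrict _).ofReal

lemma isTest_mem_H1 {ψ : ℝ → ℝ} (h : IsTest ψ) {f : L2Half 𝕜}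
    (hf : f =ᵐ[halfLine] fun x => (ψ x : 𝕜)) : f ∈ H1 𝕜 := by
  have hm := IsTest.memLp (𝕜 := 𝕜) h.continuous_deriv h.2.1.deriv
  refine ⟨hm.toLp _, fun φ hφ => ?_⟩
  have e1 : ∫ x in Ioi (0 : ℝ), deriv φ x • f x
      = ∫ x in Ioi (0 : ℝ), ((deriv φ x * ψ x : ℝ) : 𝕜) := by
    refine integral_congr_ae ?_
    filter_upwards [hf] with x hx
    rw [hx, RCLike.real_smul_eq_coe_mul, RCLike.ofReal_mul]
  have e2 : ∫ x in Ioi (0 : ℝ), φ x • (hm.toLp _ : L2Half 𝕜) x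
      = ∫ x in Ioi (0 : ℝ), ((φ x * deriv ψ x : ℝ) : 𝕜) := by
    refine integral_congr_ae ?_
    filter_upwards [hm.coeFn_toLp] with x hx
    rw [hx, RCLike.real_smul_eq_coe_mul, RCLike.ofReal_mul]
  have hz : ∀ x, x ∉ Ioi (0 : ℝ) → φ x = 0 := fun x hx =>
    image_eq_zero_of_notMem_tsupport fun h' => hx (hφ.2.2 h')
  have hz' : ∀ x, x ∉ Ioi (0 : ℝ) → ψ x = 0 := fun x hx =>
    image_eq_zero_of_notMem_tsupport fun h' => hx (h.2.2 h')
  rw [e1, e2, integral_ofReal, integral_ofReal,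
    setIntegral_eq_integral_of_forall_compl_eq_zero (fun x hx => by rw [hz' x hx, mul_zero]),
    setIntegral_eq_integral_of_forall_compl_eq_zero (fun x hx => by rw [hz x hx, zero_mul])]
  have cφ := hφ.1.continuous
  have cψ := h.1.continuous
  have i1 : Integrable (φ * deriv ψ) :=
    (cφ.mul h.continuous_deriv).integrable_of_hasCompactSupport hφ.2.1.mul_right
  have i2 : Integrable (deriv φ * ψ) :=
    (hφ.continuous_deriv.mul cψ).integrable_of_hasCompactSupport h.2.1.mul_left
  have i3 : Integrable (φ * ψ) :=
    (cφ.mul cψ).integrable_of_hasCompactSupport h.2.1.mul_left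
  have := integral_mul_deriv_eq_deriv_mul_of_integrable
    (u := φ) (v := ψ) (u' := deriv φ) (v' := deriv ψ)
    (fun x _ => (hφ.1.differentiable (by simp) x).hasDerivAt)
    (fun x _ => (h.1.differentiable (by simp) x).hasDerivAt) i1 i2 i3
  rw [this, RCLike.ofReal_neg, neg_neg]

/-- The form domain is dense: only `0` is orthogonal to it. -/
lemma eq_zero_of_inner_formDomain {W : L2Graph 𝕜 N}
    (h : ∀ Z : formDomain 𝕜 N, inner 𝕜 (Z : L2Graph 𝕜 N) W = 0) : W = 0 := by
  ext1 j
  refine eq_zero_of_test fun ψ hψ => ?_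
  have hm := IsTest.memLp (𝕜 := 𝕜) hψ.1.continuous hψ.2.1
  have hmem : (PiLp.single 2 j (hm.toLp _) : L2Graph 𝕜 N) ∈ formDomain 𝕜 N := by
    refine ⟨fun i => ?_, 0, fun i => ?_⟩
    · by_cases hi : i = j
      · subst hi
        simpa using isTest_mem_H1 hψ hm.coeFn_toLp
      · simp [hi]
    · by_cases hi : i = j
      · subst hi
        simpa using isTest_hasBoundaryValue hψ hm.coeFn_toLp
      · simpa [hi] using hasBoundaryValue_zero
  have h1 := h ⟨_, hmem⟩
  simp only [PiLp.inner_apply] at h1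
  rw [Finset.sum_eq_single j (fun i _ hi => by simp [hi]) (by simp)] at h1
  rw [L2.inner_def] at h1
  rw [← h1]
  refine integral_congr_ae ?_
  filter_upwards [hm.coeFn_toLp] with x hx
  simp only [PiLp.single_apply, if_true]
  rw [hx, RCLike.inner_apply, RCLike.conj_ofReal, RCLike.real_smul_eq_coe_mul, mul_comm]

/-- `W` represents the functional `form α q V ·`: for all `Z ∈ ℰ`, `B(V, Z) = (W, Z)`. (Mathlib's
inner product is conjugate-linear in the first slot, so `(W, Z)` reads `inner 𝕜 Z W`.) -/
def Represents [NeZero N] (α : ℝ) (q : Fin N → ℝ →ᵇ ℝ) (V : formDomain 𝕜 N)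
    (W : L2Graph 𝕜 N) : Prop :=
  ∀ Z : formDomain 𝕜 N, form α q V Z = inner 𝕜 (Z : L2Graph 𝕜 N) W

lemma Represents.unique [NeZero N] {α : ℝ} {q : Fin N → ℝ →ᵇ ℝ} {V : formDomain 𝕜 N}
    {W W' : L2Graph 𝕜 N} (h : Represents α q V W) (h' : Represents α q V W') : W = W' := by
  refine sub_eq_zero.1 (eq_zero_of_inner_formDomain fun Z => ?_)
  rw [inner_sub_right, ← h Z, ← h' Z, sub_self]

lemma Represents.add [NeZero N] {α : ℝ} {q : Fin N → ℝ →ᵇ ℝ} {V V' : formDomain 𝕜 N}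
    {W W' : L2Graph 𝕜 N} (h : Represents α q V W) (h' : Represents α q V' W') :
    Represents α q (V + V') (W + W') := fun Z => by
  rw [form_add_left, h Z, h' Z, inner_add_right]

lemma Represents.smul [NeZero N] {α : ℝ} {q : Fin N → ℝ →ᵇ ℝ} {V : formDomain 𝕜 N}
    {W : L2Graph 𝕜 N} (c : 𝕜) (h : Represents α q V W) :
    Represents α q (c • V) (c • W) := fun Z => by
  rw [form_smul_left, h Z, inner_smul_right]

lemma represents_zero [NeZero N] (α : ℝ) (q : Fin N → ℝ →ᵇ ℝ) :
    Represents α q (0 : formDomain 𝕜 N) 0 := fun Z => by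
  have := form_smul_left α q (0 : 𝕜) 0 Z
  rw [zero_smul, zero_mul] at this
  rw [this, inner_zero_right]

/-- The domain of the operator associated with the form: all `V ∈ ℰ` for which there is
`W ∈ L²` with `B(V, Z) = (W, Z)` for every `Z ∈ ℰ`. -/
def opDomain (𝕜 : Type*) [RCLike 𝕜] [NeZero N] (α : ℝ) (q : Fin N → ℝ →ᵇ ℝ) :
    Submodule 𝕜 (L2Graph 𝕜 N) where
  carrier := {V | ∃ V' : formDomain 𝕜 N, (V' : L2Graph 𝕜 N) = V ∧
    ∃ W : L2Graph 𝕜 N, Represents α q V' W}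
  add_mem' := by
    rintro _ _ ⟨V, rfl, W, h⟩ ⟨V', rfl, W', h'⟩
    exact ⟨V + V', rfl, W + W', h.add h'⟩
  zero_mem' := ⟨0, rfl, 0, represents_zero α q⟩
  smul_mem' := by
    rintro c _ ⟨V, rfl, W, h⟩
    exact ⟨c • V, rfl, c • W, h.smul c⟩

lemma exists_represents [NeZero N] {α : ℝ} {q : Fin N → ℝ →ᵇ ℝ} (V : opDomain 𝕜 α q) :
    ∃ W : L2Graph 𝕜 N, ∀ V' : formDomain 𝕜 N,
      (V' : L2Graph 𝕜 N) = V → Represents α q V' W := by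
  obtain ⟨V', h, W, hW⟩ := V.2
  exact ⟨W, fun V'' h'' => by rwa [Subtype.ext (h''.trans h.symm)]⟩

/-- The operator associated with the form (first representation theorem): `V ↦ W`. -/
def formOperator (𝕜 : Type*) [RCLike 𝕜] [NeZero N] (α : ℝ) (q : Fin N → ℝ →ᵇ ℝ) :
    L2Graph 𝕜 N →ₗ.[𝕜] L2Graph 𝕜 N where
  domain := opDomain 𝕜 α q
  toFun :=
    { toFun := fun V => (exists_represents V).choose
      map_add' := fun V V' => by
        obtain ⟨F, hF, -⟩ := V.2
        obtain ⟨F', hF', -⟩ := V'.2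
        refine ((exists_represents (V + V')).choose_spec (F + F') ?_).unique
          (((exists_represents V).choose_spec F hF).add
            ((exists_represents V').choose_spec F' hF'))
        rw [Submodule.coe_add, Submodule.coe_add, hF, hF']
      map_smul' := fun c V => by
        obtain ⟨F, hF, -⟩ := V.2
        refine ((exists_represents (c • V)).choose_spec (c • F) ?_).unique
          (((exists_represents V).choose_spec F hF).smul c)
        rw [Submodule.coe_smul, Submodule.coe_smul, hF] }

lemma formOperator_represents [NeZero N] (α : ℝ) (q : Fin N → ℝ →ᵇ ℝ)
    (V : (formOperator 𝕜 α q).domain) (V' : formDomain 𝕜 N) (h : (V' : L2Graph 𝕜 N) = V) :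
    Represents α q V' (formOperator 𝕜 α q V) :=
  (exists_represents V).choose_spec V' h

/-! ### The standing-wave profiles and the linearized operators -/

/-- The shift `a_k = artanh (α / ((2k - N) √ω))`. -/
def shift (N k : ℕ) (α ω : ℝ) : ℝ :=
  Real.artanh (α / ((2 * (k : ℝ) - N) * √ω))

/-- The `j`-th component of the profile `Φ_k`:
`[(p+1)ω/2 · sech² ((p-1)√ω x / 2 ∓ a_k)]^{1/(p-1)}`, with `-` on the first `k` edges and `+` on
the remaining ones (edges are numbered from `0`). -/
def profile {N : ℕ} (k : ℕ) (p α ω : ℝ) (j : Fin N) (x : ℝ) : ℝ :=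
  ((p + 1) * ω / 2 *
    (1 / Real.cosh ((p - 1) * √ω / 2 * x
      + if (j : ℕ) < k then - shift N k α ω else shift N k α ω)) ^ 2) ^ (1 / (p - 1))

lemma profile_rpow {k : ℕ} {p ω : ℝ} (hp : 1 < p) (hω : 0 < ω) (α : ℝ) (j : Fin N) (x : ℝ) :
    profile k p α ω j x ^ (p - 1) = (p + 1) * ω / 2 *
      (1 / Real.cosh ((p - 1) * √ω / 2 * x
        + if (j : ℕ) < k then - shift N k α ω else shift N k α ω)) ^ 2 := by
  have h0 : 0 ≤ (p + 1) * ω / 2 := by nlinarith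
  unfold profile
  rw [← Real.rpow_mul (mul_nonneg h0 (sq_nonneg _)), one_div_mul_cancel (by linarith),
    Real.rpow_one]

/-- The bounded continuous function `x ↦ ω - c φ_{k,j}(x)^{p-1}`. -/
def potential (k : ℕ) {p ω : ℝ} (hp : 1 < p) (hω : 0 < ω) (α c : ℝ) (j : Fin N) : ℝ →ᵇ ℝ :=
  BoundedContinuousFunction.ofNormedAddCommGroup
    (fun x => ω - c * profile k p α ω j x ^ (p - 1))
    (by
      simp only [profile_rpow hp hω]
      have (x : ℝ) := (Real.cosh_pos x).ne'
      fun_prop (disch := simp [this]))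
    (|ω| + |c| * ((p + 1) * ω / 2))
    (fun x => by
      rw [profile_rpow hp hω]
      have h0 : 0 ≤ (p + 1) * ω / 2 := by nlinarith
      set y := (p - 1) * √ω / 2 * x
        + if (j : ℕ) < k then - shift N k α ω else shift N k α ω
      have h1 : (1 / Real.cosh y) ^ 2 ≤ 1 := by
        have := Real.one_le_cosh y
        have h2 : 1 / Real.cosh y ≤ 1 := by
          rw [div_le_one (by linarith)]; exact this
        have h3 : 0 ≤ 1 / Real.cosh y := by positivity
        exact pow_le_one₀ h3 h2
      have h2 : |(p + 1) * ω / 2 * (1 / Real.cosh y) ^ 2| ≤ (p + 1) * ω / 2 := by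
        rw [abs_of_nonneg (by positivity)]
        nlinarith
      calc ‖ω - c * ((p + 1) * ω / 2 * (1 / Real.cosh y) ^ 2)‖
          ≤ |ω| + |c * ((p + 1) * ω / 2 * (1 / Real.cosh y) ^ 2)| := norm_sub_le _ _
        _ ≤ _ := by
          rw [abs_mul]
          gcongr)

/-- The operator `L_{1,k}`, associated with the form with potential `ω - p φ_{k,j}^{p-1}`. -/
def linOp₁ (𝕜 : Type*) [RCLike 𝕜] (N : ℕ) [NeZero N] (k : ℕ) (α : ℝ) {p ω : ℝ} (hp : 1 < p)
    (hω : 0 < ω) : L2Graph 𝕜 N →ₗ.[𝕜] L2Graph 𝕜 N :=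
  formOperator 𝕜 α (potential k hp hω α p)

/-- The operator `L_{2,k}`, associated with the form with potential `ω - φ_{k,j}^{p-1}`. -/
def linOp₂ (𝕜 : Type*) [RCLike 𝕜] (N : ℕ) [NeZero N] (k : ℕ) (α : ℝ) {p ω : ℝ} (hp : 1 < p)
    (hω : 0 < ω) : L2Graph 𝕜 N →ₗ.[𝕜] L2Graph 𝕜 N :=
  formOperator 𝕜 α (potential k hp hω α 1)

/-- `Φ` is the profile `Φ_k`, as an element of `L²` of the graph. -/
def IsProfile (k : ℕ) (p α ω : ℝ) (Φ : L2Graph 𝕜 N) : Prop :=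
  ∀ j, Φ j =ᵐ[halfLine] fun x => (profile k p α ω j x : 𝕜)

end StarGraph

end

open MeasureTheory Set Filter
open scoped ENNReal Topology BoundedContinuousFunction

noncomputable section

/-! ### Absolutely continuous primitives and weak derivatives on the half-line -/

namespace StarGraph

variable {𝕜 : Type*} [RCLike 𝕜]

/-! Write `h_j = φ_j' / φ_j` for the logarithmic derivative of the profile. Since `φ'' = (ω -
φ^(p-1)) φ`, it solves the Riccati equation `h' = ω - φ^(p-1) - h²` (`hasDerivAt_slope`). The shift
`a_k` is chosen so that `h_j(0) = m` on the first `k` edges and `-m` on the others, with `m = α /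
(2k - N)`; hence `∑ h_j(0) = α` (`sum_slope_zero`). The lower bound on `ω` is what puts the argument
of `artanh` in `(-1, 1)`.

Assertion (i). Expanding `∑ ∫ |v_j' - h_j v_j|²` and integrating the cross term by parts turns the
Riccati equation into the potential of the second form and the values `h_j(0)` into its vertex term
(`form_eq_of_riccati`). That form is therefore a sum of squares, so its operator is nonnegative, and
the kernel consists of the solutions of `v_j' = h_j v_j`, that is of multiples of `φ_j`; continuity
at the vertex makes the factor common to all edges (`kernel_linOp₂`).

Assertion (ii). A kernel element of the first operator solves `v_j'' = (ω - p φ_j^(p-1)) v_j` on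
each edge, and so does `φ_j'`. Both are square integrable together with their derivatives, so their
Wronskian vanishes at infinity, hence at `0` (`boundaryValue_wronskian`). This determines `v_j'(0)`
from the vertex value `τ`, because `φ_j'(0)` is nonzero for `α ≠ 0`. Inserted in the vertex
condition `∑ v_j'(0) = α τ`, a nonzero `τ` would force `m² = ω - φ(0)^(p-1)`, which contradicts `p >
1` and `m² < ω`. So `τ` and all `v_j'(0)` vanish, and uniqueness for the initial value problem
finishes (`kernel_linOp₁`).

Assertion (iii) uses only that the potentials tend to `ω` at infinity. The form is closed and
bounded below, so Lax–Milgram provides a real resolvent point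
(`exists_mem_resolventSet_formOperator`), and with symmetry the spectrum is real. For `l < ω` the
norm of `v` is controlled by `(A - l) v` and finitely many point values (`exists_peetre_estimate`).
This estimate gives a finite-dimensional eigenspace and a lower bound for `A - l` on its orthogonal
complement, so `l` is isolated, and discrete if it is spectral (`IsSymm.isolated_and_discrete`). At
`l = 0` this is the gap. Every `r ≥ ω` is in the spectrum by Weyl sequences, cut-off trigonometric
functions moved to infinity (`mem_spectrum_of_le`); a half-line has no isolated points, so all of it
is essential. -/

lemma hasDerivAt_ofReal_comp {f : ℝ → ℝ} {f' x : ℝ} (h : HasDerivAt f f' x) :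
    HasDerivAt (fun y => (f y : 𝕜)) (f' : 𝕜) x :=
  (RCLike.ofRealCLM (K := 𝕜)).hasFDerivAt.comp_hasDerivAt x h

/-- `P` is, on `[0, ∞)`, a primitive of the locally integrable function `p`. -/
def IsPrim (P p : ℝ → 𝕜) : Prop :=
  ∀ b : ℝ, 0 ≤ b → IntervalIntegrable p volume 0 b ∧ P b = P 0 + ∫ x in (0 : ℝ)..b, p x

/-- Real and imaginary parts are primitives of real integrable functions; they are recombined as
scalar multiples of `1` and `RCLike.I`. -/
lemma absolutelyContinuousOnInterval_primitive {p : ℝ → 𝕜} {b : ℝ}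
    (h : IntervalIntegrable p volume 0 b) (c : 𝕜) :
    AbsolutelyContinuousOnInterval (fun x => c + ∫ t in (0 : ℝ)..x, p t) 0 b := by
  have hre : IntervalIntegrable (fun x => RCLike.re (p x)) volume 0 b := ⟨h.1.re, h.2.re⟩
  have him : IntervalIntegrable (fun x => RCLike.im (p x)) volume 0 b := ⟨h.1.im, h.2.im⟩
  have hcst (a : 𝕜) : AbsolutelyContinuousOnInterval (fun _ : ℝ => a) 0 b :=
    (contDiff_const.contDiffOn).absolutelyContinuousOnInterval
  have h1 := ((hre.absolutelyContinuousOnInterval_intervalIntegral left_mem_uIcc).fun_smul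
    (hcst 1)).fun_add ((him.absolutelyContinuousOnInterval_intervalIntegral
      left_mem_uIcc).fun_smul (hcst RCLike.I))
  have h2 := (hcst c).fun_add h1
  have key : ∀ x ∈ uIcc 0 b, c + ((∫ t in (0 : ℝ)..x, RCLike.re (p t)) • (1 : 𝕜)
      + (∫ t in (0 : ℝ)..x, RCLike.im (p t)) • RCLike.I) = c + ∫ t in (0 : ℝ)..x, p t := by
    intro x hx
    have hs : uIcc 0 x ⊆ uIcc 0 b := uIcc_subset_uIcc_left hx
    have hp : IntervalIntegrable p volume 0 x := h.mono_set hs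
    have e : ∫ t in (0 : ℝ)..x, p t
        = ∫ t in (0 : ℝ)..x, ((RCLike.re (p t)) • (1 : 𝕜) + (RCLike.im (p t)) • RCLike.I) := by
      refine intervalIntegral.integral_congr fun t _ => ?_
      simp only [RCLike.real_smul_eq_coe_mul, mul_one]
      exact (RCLike.re_add_im (p t)).symm
    rw [e, intervalIntegral.integral_add, intervalIntegral.integral_smul_const,
      intervalIntegral.integral_smul_const]
    · exact ⟨((hre.mono_set hs).1).smul_const _, ((hre.mono_set hs).2).smul_const _⟩
    · exact ⟨((him.mono_set hs).1).smul_const _, ((him.mono_set hs).2).smul_const _⟩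
  refine h2.congr' ?_
  -- Absolute continuity only involves families of subintervals with endpoints in `uIcc 0 b`, so
  -- agreement on that interval is enough.
  refine eventually_inf_principal.2 (Eventually.of_forall ?_)
  rintro ⟨n, I⟩ hI
  refine Finset.sum_congr rfl fun i hi => ?_
  have := hI.1 i hi
  simp only
  rw [key _ this.1, key _ this.2]

namespace IsPrim

variable {P p Q q : ℝ → 𝕜}

lemma intervalIntegrable (h : IsPrim P p) {a b : ℝ} (ha : 0 ≤ a) (hb : 0 ≤ b) :
    IntervalIntegrable p volume a b :=
  (h a ha).1.symm.trans (h b hb).1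

lemma sub_eq (h : IsPrim P p) {a b : ℝ} (ha : 0 ≤ a) (hb : 0 ≤ b) :
    P b - P a = ∫ x in a..b, p x := by
  rw [(h a ha).2, (h b hb).2, ← intervalIntegral.integral_interval_sub_left (h b hb).1 (h a ha).1]
  ring

lemma continuousOn (h : IsPrim P p) : ContinuousOn P (Ici 0) := by
  intro x hx
  have hx0 : (0 : ℝ) ≤ x := hx
  have h1 : ContinuousOn (fun y => P 0 + ∫ t in (0 : ℝ)..y, p t) (uIcc 0 (x + 1)) :=
    (absolutelyContinuousOnInterval_primitive (h (x + 1) (by linarith)).1 _).continuousOn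
  rw [uIcc_of_le (by linarith)] at h1
  have h2 : ContinuousWithinAt P (Icc 0 (x + 1)) x :=
    (h1 x ⟨hx0, by linarith⟩).congr (fun y hy => (h y hy.1).2) (h x hx0).2
  refine h2.mono_of_mem_nhdsWithin ?_
  rw [← Ici_inter_Iic]
  exact inter_mem self_mem_nhdsWithin (mem_nhdsWithin_of_mem_nhds (Iic_mem_nhds (by linarith)))

lemma of_hasDerivAt {P p : ℝ → 𝕜} (h : ∀ x, HasDerivAt P (p x) x) (hp : Continuous p) :
    IsPrim P p := fun b _ => by
  have hi := hp.intervalIntegrable (μ := volume) 0 b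
  refine ⟨hi, ?_⟩
  rw [intervalIntegral.integral_eq_sub_of_hasDerivAt (fun x _ => h x) hi]
  ring

lemma congr_right (h : IsPrim P p) (hq : p =ᵐ[halfLine] q) : IsPrim P q := fun b hb => by
  have hab : ∀ᵐ x, x ∈ uIoc 0 b → p x = q x := by
    rw [uIoc_of_le hb]
    filter_upwards [(ae_restrict_iff' measurableSet_Ioi).1 hq] with x hx hx' using hx hx'.1
  refine ⟨(h b hb).1.congr_ae ((ae_restrict_iff' measurableSet_uIoc).2 hab), ?_⟩
  rw [(h b hb).2, intervalIntegral.integral_congr_ae hab]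

lemma star (h : IsPrim P p) : IsPrim (fun x => star (P x)) (fun x => star (p x)) := fun b hb => by
  refine ⟨?_, ?_⟩
  · exact ⟨(RCLike.conjCLE (K := 𝕜)).toContinuousLinearMap.integrable_comp (h b hb).1.1,
      (RCLike.conjCLE (K := 𝕜)).toContinuousLinearMap.integrable_comp (h b hb).1.2⟩
  · change Star.star (P b) = Star.star (P 0) + _
    rw [(h b hb).2, star_add]
    congr 1
    exact ((RCLike.conjCLE (K := 𝕜)).toContinuousLinearMap.intervalIntegral_comp_comm
      (h b hb).1).symm

/-- Neither factor need be differentiable everywhere. The difference between the product and the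
primitive of the expected derivative is absolutely continuous with derivative zero almost
everywhere, hence constant. -/
lemma mul (hP : IsPrim P p) (hQ : IsPrim Q q) :
    IsPrim (fun x => P x * Q x) (fun x => p x * Q x + P x * q x) := fun b hb => by
  set P' : ℝ → 𝕜 := fun x => P 0 + ∫ t in (0 : ℝ)..x, p t with hP'
  set Q' : ℝ → 𝕜 := fun x => Q 0 + ∫ t in (0 : ℝ)..x, q t with hQ'
  have acP := absolutelyContinuousOnInterval_primitive (hP b hb).1 (P 0)
  have acQ := absolutelyContinuousOnInterval_primitive (hQ b hb).1 (Q 0)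
  have hcI : ∀ {F f : ℝ → 𝕜}, IsPrim F f → ContinuousOn F (uIcc 0 b) := fun h => by
    rw [uIcc_of_le hb]
    exact h.continuousOn.mono Icc_subset_Ici_self
  have ii : IntervalIntegrable (fun x => p x * Q x + P x * q x) volume 0 b :=
    ((hP b hb).1.mul_continuousOn (hcI hQ)).add ((hQ b hb).1.continuousOn_mul (hcI hP))
  refine ⟨ii, ?_⟩
  have acR := absolutelyContinuousOnInterval_primitive ii 0
  have acD := (acP.fun_smul acQ).fun_sub acR
  obtain ⟨C, hC⟩ := acD.const_of_ae_hasDerivAt_zero (by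
    filter_upwards [(hP b hb).1.ae_hasDerivAt_integral, (hQ b hb).1.ae_hasDerivAt_integral,
      ii.ae_hasDerivAt_integral] with x h1 h2 h3 hx
    have h0 : (0 : ℝ) ∈ uIcc 0 b := left_mem_uIcc
    have d1 := (h1 hx 0 h0).const_add (P 0)
    have d2 := (h2 hx 0 h0).const_add (Q 0)
    have d3 := (h3 hx 0 h0).const_add 0
    have := (d1.mul d2).sub d3
    rw [uIcc_of_le hb] at hx
    refine this.congr_deriv ?_
    rw [← (hP x hx.1).2, ← (hQ x hx.1).2]
    ring)
  have e0 := hC 0 left_mem_uIcc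
  have eb := hC b right_mem_uIcc
  simp only [intervalIntegral.integral_same, add_zero, smul_eq_mul, sub_zero, zero_add] at e0 eb
  rw [← (hP b hb).2, ← (hQ b hb).2, ← e0] at eb
  change P b * Q b = P 0 * Q 0 + _
  rw [← eb]; ring

end IsPrim

lemma intervalIntegrable_L2 (g : L2Half 𝕜) {b : ℝ} (hb : 0 ≤ b) :
    IntervalIntegrable g volume 0 b := by
  rw [intervalIntegrable_iff_integrableOn_Ioc_of_le hb]
  have h1 : MemLp g 2 (halfLine.restrict (Ioc 0 b)) := (Lp.memLp g).restrict _
  rw [Measure.restrict_restrict_of_subset Ioc_subset_Ioi_self] at h1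
  exact h1.integrable (by norm_num)

/-- The function `x ↦ c + ∫₀ˣ g`. -/
def primitive (c : 𝕜) (g : L2Half 𝕜) (x : ℝ) : 𝕜 := c + ∫ t in (0 : ℝ)..x, g t

@[simp] lemma primitive_zero (c : 𝕜) (g : L2Half 𝕜) : primitive c g 0 = c := by simp [primitive]

lemma isPrim_primitive (c : 𝕜) (g : L2Half 𝕜) : IsPrim (primitive c g) g := fun b hb =>
  ⟨intervalIntegrable_L2 g hb, by simp [primitive]⟩

lemma exists_Icc_of_isCompact {K : Set ℝ} (hK : IsCompact K) (h : K ⊆ Ioi 0) :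
    ∃ a b, 0 < a ∧ a ≤ b ∧ K ⊆ Icc a b := by
  rcases K.eq_empty_or_nonempty with rfl | hne
  · exact ⟨1, 1, one_pos, le_rfl, empty_subset _⟩
  · obtain ⟨a, ha, ha'⟩ := hK.exists_isLeast hne
    obtain ⟨b, hb, hb'⟩ := hK.exists_isGreatest hne
    exact ⟨a, b, h ha, ha' hb, fun x hx => ⟨ha' hx, hb' hx⟩⟩

lemma IsTest.eq_zero {ψ : ℝ → ℝ} (h : IsTest ψ) {x : ℝ} (hx : x ≤ 0) : ψ x = 0 :=
  image_eq_zero_of_notMem_tsupport fun h' => absurd (h.2.2 h') (not_lt.2 hx)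

lemma IsTest.deriv {ψ : ℝ → ℝ} (h : IsTest ψ) : IsTest (deriv ψ) :=
  ⟨((contDiff_infty_iff_deriv (𝕜 := ℝ)).1 h.1).2, h.2.1.deriv,
    (tsupport_deriv_subset).trans h.2.2⟩

lemma IsTest.hasDerivAt {ψ : ℝ → ℝ} (h : IsTest ψ) (x : ℝ) : HasDerivAt ψ (_root_.deriv ψ x) x :=
  (h.1.differentiable (by simp) x).hasDerivAt

/-- Integration by parts of a primitive against a test function. -/
lemma IsPrim.integral_test {P p : ℝ → 𝕜} (h : IsPrim P p) {ψ : ℝ → ℝ} (hψ : IsTest ψ) :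
    ∫ x in Ioi (0 : ℝ), deriv ψ x • P x = - ∫ x in Ioi (0 : ℝ), ψ x • p x := by
  obtain ⟨a, b, ha, hab, hK⟩ := exists_Icc_of_isCompact hψ.2.1 hψ.2.2
  -- The endpoint `b + 1` lies strictly to the right of the support, so no boundary term survives on
  -- `[0, b + 1]`.
  have hb : 0 ≤ b + 1 := by linarith
  have hz : ∀ x, x ∉ Ioc 0 (b + 1) → ψ x = 0 := fun x hx =>
    image_eq_zero_of_notMem_tsupport fun h' => hx ⟨ha.trans_le (hK h').1, by linarith [(hK h').2]⟩
  have hz' : ∀ x, x ∉ Ioc 0 (b + 1) → deriv ψ x = 0 := fun x hx =>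
    image_eq_zero_of_notMem_tsupport fun h' => by
      have := hK (tsupport_deriv_subset h')
      exact hx ⟨ha.trans_le this.1, by linarith [this.2]⟩
  have red : ∀ (φ : ℝ → ℝ) (f : ℝ → 𝕜), (∀ x, x ∉ Ioc 0 (b + 1) → φ x = 0) →
      ∫ x in Ioi (0 : ℝ), φ x • f x = ∫ x in (0 : ℝ)..(b + 1), φ x • f x := by
    intro φ f hφ
    rw [intervalIntegral.integral_of_le hb,
      setIntegral_eq_integral_of_forall_compl_eq_zero (fun x hx => by
        rw [hφ x (fun h => hx h.1), zero_smul]),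
      setIntegral_eq_integral_of_forall_compl_eq_zero (fun x hx => by rw [hφ x hx, zero_smul])]
  rw [red _ _ hz, red _ _ hz']
  have hP : IsPrim (fun x => (ψ x : 𝕜)) (fun x => ((deriv ψ x : ℝ) : 𝕜)) :=
    IsPrim.of_hasDerivAt (fun x => hasDerivAt_ofReal_comp (hψ.hasDerivAt x))
      (RCLike.continuous_ofReal.comp hψ.continuous_deriv)
  have key := ((hP.mul h) (b + 1) hb).2
  have i1 : IntervalIntegrable (fun x => ((deriv ψ x : ℝ) : 𝕜) * P x) volume 0 (b + 1) := by
    refine ContinuousOn.intervalIntegrable_of_Icc hb ?_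
    exact (RCLike.continuous_ofReal.comp hψ.continuous_deriv).continuousOn.mul
      (h.continuousOn.mono Icc_subset_Ici_self)
  have i2 : IntervalIntegrable (fun x => (ψ x : 𝕜) * p x) volume 0 (b + 1) :=
    (h _ hb).1.continuousOn_mul
      (RCLike.continuous_ofReal.comp hψ.1.continuous).continuousOn
  simp only at key
  rw [intervalIntegral.integral_add i1 i2, hψ.eq_zero le_rfl] at key
  have hb0 : ψ (b + 1) = 0 := image_eq_zero_of_notMem_tsupport fun h' => by
    linarith [(hK h').2]
  rw [hb0] at key
  simp only [RCLike.ofReal_zero, zero_mul, zero_add] at key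
  simp only [RCLike.real_smul_eq_coe_mul]
  exact eq_neg_of_add_eq_zero_left key.symm

lemma hasWeakDeriv_of_isPrim {f g : L2Half 𝕜} {F : ℝ → 𝕜} (hF : IsPrim F g)
    (hf : f =ᵐ[halfLine] F) : HasWeakDeriv f g := fun ψ hψ => by
  rw [← hF.integral_test hψ]
  refine integral_congr_ae ?_
  filter_upwards [hf] with x hx
  rw [hx]

/-- A test function with vanishing integral is the derivative of a test function. -/
lemma IsTest.exists_deriv_eq {φ : ℝ → ℝ} (h : IsTest φ) (h0 : ∫ x, φ x = 0) :
    ∃ ψ, IsTest ψ ∧ _root_.deriv ψ = φ := by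
  obtain ⟨a, b, ha, hab, hK⟩ := exists_Icc_of_isCompact h.2.1 h.2.2
  have hz : ∀ x, x ∉ Icc a b → φ x = 0 := fun x hx =>
    image_eq_zero_of_notMem_tsupport fun h' => hx (hK h')
  have hc := h.1.continuous
  have hd : ∀ x, HasDerivAt (fun x => ∫ t in (0 : ℝ)..x, φ t) (φ x) x := fun x =>
    hc.integral_hasStrictDerivAt 0 x |>.hasDerivAt
  have hderiv : _root_.deriv (fun x => ∫ t in (0 : ℝ)..x, φ t) = φ :=
    funext fun x => (hd x).deriv
  have hsupp : ∀ x, x ∉ Icc a b → ∫ t in (0 : ℝ)..x, φ t = 0 := by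
    intro x hx
    rcases lt_or_ge x a with hxa | hxa
    · refine intervalIntegral.integral_zero_ae (Eventually.of_forall fun t ht => hz t ?_)
      rcases le_total 0 x with h0 | h0
      · rw [uIoc_of_le h0] at ht
        exact fun h' => absurd h'.1 (by linarith [ht.2])
      · rw [uIoc_of_ge h0] at ht
        exact fun h' => absurd h'.1 (by linarith [ht.2])
    · have hxb : b < x := not_le.1 fun h' => hx ⟨hxa, h'⟩
      rw [intervalIntegral.integral_of_le (by linarith),
        setIntegral_eq_integral_of_forall_compl_eq_zero, h0]
      intro t ht
      refine hz t fun h' => ht ⟨by linarith [h'.1], by linarith [h'.2]⟩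
  have hsub : tsupport (fun x => ∫ t in (0 : ℝ)..x, φ t) ⊆ Icc a b := by
    refine closure_minimal (fun x hx => ?_) isClosed_Icc
    by_contra hn
    exact hx (hsupp x hn)
  refine ⟨_, ⟨?_, ?_, ?_⟩, hderiv⟩
  · rw [contDiff_infty_iff_deriv]
    refine ⟨fun x => (hd x).differentiableAt, ?_⟩
    rw [hderiv]
    exact h.1
  · exact HasCompactSupport.intro' isCompact_Icc isClosed_Icc hsupp
  · exact hsub.trans fun _ hx => ha.trans_le hx.1

lemma exists_test_integral_eq_one : ∃ η, IsTest η ∧ ∫ x, η x = 1 := by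
  let b : ContDiffBump (2 : ℝ) := ⟨1 / 2, 1, by norm_num, by norm_num⟩
  refine ⟨b.normed volume, ⟨b.contDiff_normed, b.hasCompactSupport_normed, ?_⟩,
    b.integral_normed⟩
  rw [b.tsupport_normed_eq, Real.closedBall_eq_Icc]
  intro x hx
  have : (2 : ℝ) - 1 ≤ x := hx.1
  exact lt_of_lt_of_le (by norm_num) this

lemma IsTest.integral_Ioi {φ : ℝ → ℝ} (h : IsTest φ) :
    ∫ x in Ioi (0 : ℝ), φ x = ∫ x, φ x :=
  setIntegral_eq_integral_of_forall_compl_eq_zero fun _ hx => h.eq_zero (not_lt.1 hx)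

lemma IsTest.add_smul {φ ψ : ℝ → ℝ} (h : IsTest φ) (h' : IsTest ψ) (c : ℝ) :
    IsTest (fun x => φ x - c * ψ x) := by
  have e : (fun x => φ x - c * ψ x) = φ - (fun _ => c) * ψ := rfl
  refine ⟨h.1.sub (contDiff_const.mul h'.1), ?_, ?_⟩
  · rw [e]; exact h.2.1.sub h'.2.1.mul_left
  · rw [e]
    refine (tsupport_sub _ _).trans (union_subset h.2.2 (Subset.trans ?_ h'.2.2))
    exact tsupport_mul_subset_right

/-- A locally integrable function on the half-line with vanishing weak derivative is constant. -/
lemma ae_eq_const_of_test {w : ℝ → 𝕜} (hw : LocallyIntegrableOn w (Ioi 0) halfLine)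
    (hi : ∀ ψ, IsTest ψ → Integrable (fun x => ψ x • w x) halfLine)
    (h : ∀ ψ, IsTest ψ → ∫ x in Ioi (0 : ℝ), deriv ψ x • w x = 0) :
    ∃ c, w =ᵐ[halfLine] fun _ => c := by
  obtain ⟨η, hη, hη1⟩ := exists_test_integral_eq_one
  refine ⟨∫ x in Ioi (0 : ℝ), η x • w x, ?_⟩
  set c := ∫ x in Ioi (0 : ℝ), η x • w x with hc
  have hconst : LocallyIntegrable (fun _ : ℝ => c) halfLine := locallyIntegrable_const c
  have key := isOpen_Ioi.ae_eq_zero_of_integral_contDiff_smul_eq_zero (U := Ioi (0 : ℝ))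
    (μ := halfLine) (f := fun x => w x - c) (hw.sub (hconst.locallyIntegrableOn _)) (by
      intro φ h1 h2 h3
      have hφ : IsTest φ := ⟨h1, h2, h3⟩
      have hφi : Integrable φ := h1.continuous.integrable_of_hasCompactSupport h2
      have hηi : Integrable η := hη.1.continuous.integrable_of_hasCompactSupport hη.2.1
      -- Subtracting the right multiple of `η` makes the integral zero, so the result is the
      -- derivative of a test function, against which `w` integrates to zero.
      obtain ⟨ψ, hψ, hd⟩ := (hφ.add_smul hη (∫ x, φ x)).exists_deriv_eq (by
        rw [integral_sub hφi (hηi.const_mul _), integral_const_mul, hη1, mul_one, sub_self])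
      have h0 := h ψ hψ
      rw [hd] at h0
      have e : ∀ x, (φ x - (∫ y, φ y) * η x) • w x
          = φ x • w x - (∫ y, φ y) • (η x • w x) := fun x => by
        rw [sub_smul, mul_smul]
      simp only [e] at h0
      rw [integral_sub (hi φ hφ) (by exact (hi η hη).smul (∫ y, φ y)), integral_smul, ← hc] at h0
      simp only [smul_sub]
      rw [integral_sub (hi φ hφ) (hφi.restrict.smul_const c), integral_smul_const,
        hφ.integral_Ioi]
      exact h0)
  filter_upwards [key, ae_restrict_mem measurableSet_Ioi] with x hx hx0
  exact sub_eq_zero.1 (hx hx0)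

lemma integrable_test_smul_continuousOn {ψ : ℝ → ℝ} (hψ : IsTest ψ) {F : ℝ → 𝕜}
    (hF : ContinuousOn F (Ici 0)) : Integrable (fun x => ψ x • F x) halfLine := by
  obtain ⟨a, b, ha, hab, hK⟩ := exists_Icc_of_isCompact hψ.2.1 hψ.2.2
  have h1 : IntegrableOn (fun x => ψ x • F x) (Icc a b) :=
    (hψ.1.continuous.continuousOn.smul
      (hF.mono fun x hx => (ha.le.trans hx.1 : (0 : ℝ) ≤ x))).integrableOn_Icc
  refine (h1.integrable_of_forall_notMem_eq_zero fun x hx => ?_).restrict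
  rw [image_eq_zero_of_notMem_tsupport fun h' => hx (hK h'), zero_smul]

/-- A function with a weak derivative has an absolutely continuous representative. -/
lemma HasWeakDeriv.exists_primitive {f g : L2Half 𝕜} (h : HasWeakDeriv f g) :
    ∃ c, f =ᵐ[halfLine] primitive c g := by
  have hG := isPrim_primitive 0 g
  have hfl : LocallyIntegrable (f : ℝ → 𝕜) halfLine :=
    (Lp.memLp f).locallyIntegrable (by norm_num)
  have hGl : LocallyIntegrableOn (primitive 0 g) (Ioi 0) halfLine := by
    have h1 : ContinuousOn (primitive 0 g) (Ioi 0) := hG.continuousOn.mono Ioi_subset_Ici_self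
    exact h1.locallyIntegrableOn measurableSet_Ioi
  have if' : ∀ ψ, IsTest ψ → Integrable (fun x => ψ x • f x) halfLine := fun ψ hψ =>
    integrable_test_smul hψ.1.continuous hψ.2.1 f
  have iG : ∀ ψ, IsTest ψ → Integrable (fun x => ψ x • primitive 0 g x) halfLine := fun ψ hψ =>
    integrable_test_smul_continuousOn hψ hG.continuousOn
  -- The difference between `f` and a primitive of its weak derivative has vanishing weak
  -- derivative.
  obtain ⟨c, hc⟩ := ae_eq_const_of_test (w := fun x => f x - primitive 0 g x)
    ((hfl.locallyIntegrableOn _).sub hGl)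
    (fun ψ hψ => by simpa only [smul_sub] using! (if' ψ hψ).sub (iG ψ hψ))
    (fun ψ hψ => by
      simp only [smul_sub]
      rw [integral_sub (if' _ hψ.deriv) (iG _ hψ.deriv), h ψ hψ, hG.integral_test hψ, sub_self])
  refine ⟨c, ?_⟩
  filter_upwards [hc] with x hx
  simp only [primitive, zero_add] at hx ⊢
  rw [← hx]; ring

lemma hasBoundaryValue_of_isPrim {f : L2Half 𝕜} {F p : ℝ → 𝕜} (hF : IsPrim F p)
    (hf : f =ᵐ[halfLine] F) : HasBoundaryValue f (F 0) :=
  ⟨F, hF.continuousOn, hf, rfl⟩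

lemma HasWeakDeriv.ae_eq_primitive {f g : L2Half 𝕜} (h : HasWeakDeriv f g) {c : 𝕜}
    (hc : HasBoundaryValue f c) : f =ᵐ[halfLine] primitive c g := by
  obtain ⟨d, hd⟩ := h.exists_primitive
  have h1 := hasBoundaryValue_of_isPrim (isPrim_primitive d g) hd
  rw [primitive_zero] at h1
  rwa [hc.unique h1]

end StarGraph

/-! ### Symmetric operators with a real resolvent point -/

namespace UnboundedOp

variable {𝕜 H : Type*} [RCLike 𝕜] [NormedAddCommGroup H] [InnerProductSpace 𝕜 H]

/-- A partially defined operator which is symmetric. -/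
def IsSymm (A : H →ₗ.[𝕜] H) : Prop :=
  ∀ v w : A.domain, inner 𝕜 (A v) (w : H) = inner 𝕜 (v : H) (A w)

lemma mem_eigenspace {A : H →ₗ.[𝕜] H} {l : 𝕜} {u : H} :
    u ∈ eigenspace A l ↔ ∃ h : u ∈ A.domain, A ⟨u, h⟩ = l • u := by
  constructor
  · rintro ⟨v, hv, rfl⟩
    exact ⟨v.2, hv⟩
  · rintro ⟨h, hu⟩
    exact ⟨⟨u, h⟩, hu, rfl⟩

/-- By symmetry `(v, A v)` is real, so the imaginary part of `(v, (A - l) v)` is `-Im l ‖v‖²`;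
Cauchy–Schwarz bounds it. -/
lemma IsSymm.im_bound {A : H →ₗ.[𝕜] H} (hA : IsSymm A) (l : 𝕜) (v : A.domain) :
    |RCLike.im l| * ‖(v : H)‖ ≤ ‖A v - l • (v : H)‖ := by
  have h1 : RCLike.im (inner 𝕜 (v : H) (A v)) = 0 := by
    have h := congrArg RCLike.im (hA v v)
    rw [← inner_conj_symm, RCLike.conj_im] at h
    linarith
  have h2 : RCLike.im (inner 𝕜 (v : H) (A v - l • (v : H))) = -(RCLike.im l * ‖(v : H)‖ ^ 2) := by
    rw [inner_sub_right, map_sub, h1, inner_smul_right, inner_self_eq_norm_sq_to_K,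
      ← RCLike.ofReal_pow, mul_comm l, RCLike.im_ofReal_mul]
    ring
  have h3 : |RCLike.im l| * ‖(v : H)‖ ^ 2 ≤ ‖(v : H)‖ * ‖A v - l • (v : H)‖ := by
    calc |RCLike.im l| * ‖(v : H)‖ ^ 2 = |RCLike.im (inner 𝕜 (v : H) (A v - l • (v : H)))| := by
          rw [h2, abs_neg, abs_mul, abs_of_nonneg (sq_nonneg ‖(v : H)‖)]
      _ ≤ ‖inner 𝕜 (v : H) (A v - l • (v : H))‖ := RCLike.abs_im_le_norm _
      _ ≤ _ := norm_inner_le_norm _ _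
  rcases (norm_nonneg (v : H)).eq_or_lt with h | h
  · rw [← h, mul_zero]; exact norm_nonneg _
  · refine le_of_mul_le_mul_left ?_ h
    nlinarith

lemma IsSymm.resolvent_symm {A : H →ₗ.[𝕜] H} (hA : IsSymm A) {m : ℝ} {R : H →L[𝕜] H}
    (h1 : ∀ u : H, ∃ h : R u ∈ A.domain, A ⟨R u, h⟩ - (m : 𝕜) • R u = u) (u w : H) :
    inner 𝕜 (R u) w = inner 𝕜 u (R w) := by
  obtain ⟨hu, eu⟩ := h1 u
  obtain ⟨hw, ew⟩ := h1 w
  have h := hA ⟨R u, hu⟩ ⟨R w, hw⟩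
  simp only at h
  calc inner 𝕜 (R u) w = inner 𝕜 (R u) (A ⟨R w, hw⟩ - (m : 𝕜) • R w) := by rw [ew]
    _ = inner 𝕜 (A ⟨R u, hu⟩ - (m : 𝕜) • R u) (R w) := by
      rw [inner_sub_right, inner_sub_left, h, inner_smul_left, inner_smul_right,
        RCLike.conj_ofReal]
    _ = _ := by rw [eu]

/-- A point at which `A - l` is bounded below, and which is not conjugate to an eigenvalue,
is a resolvent point of the self-adjoint operator `A`. -/
lemma IsSymm.mem_resolventSet [CompleteSpace H] {A : H →ₗ.[𝕜] H} (hA : IsSymm A) {m : ℝ}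
    (hm : (m : 𝕜) ∈ resolventSet A) {l : 𝕜} {c : ℝ} (hc : 0 < c)
    (hb : ∀ v : A.domain, c * ‖(v : H)‖ ≤ ‖A v - l • (v : H)‖)
    (hk : ∀ v : A.domain, A v = star l • (v : H) → (v : H) = 0) : l ∈ resolventSet A := by
  obtain ⟨R, h1, h2⟩ := hm
  -- On the range of `R`, which is the whole domain, `(A - l) R = 1 - (l - m) R`. Inverting `A - l`
  -- therefore amounts to inverting the bounded operator `S`.
  set S : H →L[𝕜] H := ContinuousLinearMap.id 𝕜 H - (l - m) • R with hS
  have hSR : ∀ u (h : R u ∈ A.domain), A ⟨R u, h⟩ - l • R u = S u := by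
    intro u h
    obtain ⟨h', e⟩ := h1 u
    simp only [hS, sub_apply, ContinuousLinearMap.id_apply,
      smul_apply]
    nth_rw 3 [← e]
    rw [sub_smul]; abel
  have hanti : ∀ u, ‖u‖ ≤ (1 + ‖l - m‖ / c) * ‖S u‖ := by
    intro u
    obtain ⟨h, -⟩ := h1 u
    have e1 := hb ⟨R u, h⟩
    rw [hSR u h] at e1
    have e2 : u = S u + (l - m) • R u := by simp [hS]
    have e3 : ‖u‖ ≤ ‖S u‖ + ‖l - m‖ * ‖R u‖ := by
      calc ‖u‖ = ‖S u + (l - m) • R u‖ := by rw [← e2]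
        _ ≤ _ := (norm_add_le _ _).trans_eq (by rw [norm_smul])
    have e4 : ‖R u‖ ≤ ‖S u‖ / c := by rw [le_div_iff₀ hc]; linarith
    calc ‖u‖ ≤ ‖S u‖ + ‖l - m‖ * (‖S u‖ / c) :=
          e3.trans (by gcongr)
      _ = _ := by ring
  have hbij : Function.Bijective S := by
    rw [ContinuousLinearMap.bijective_iff_dense_range_and_antilipschitz]
    refine ⟨?_, ⟨1 + ‖l - m‖ / c, by positivity⟩, ?_⟩
    · rw [Submodule.topologicalClosure_eq_top_iff, Submodule.eq_bot_iff]
      intro w hw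
      -- A vector orthogonal to the range of `S` is in the kernel of its adjoint. Since `R` is
      -- symmetric, it is a multiple of `R w`, hence lies in the domain, and there it satisfies `A w
      -- = star l • w`, which `hk` excludes unless `w = 0`.
      have e : w = star (l - m) • R w := by
        refine ext_inner_right 𝕜 fun u => ?_
        have h0 : inner 𝕜 (S u) w = 0 := hw (S u) ⟨u, rfl⟩
        have h0' : inner 𝕜 w (S u) = 0 := by rw [← inner_conj_symm, h0, map_zero]
        simp only [hS, sub_apply, ContinuousLinearMap.id_apply,
          smul_apply, inner_sub_right, inner_smul_right] at h0'
        rw [inner_smul_left, hA.resolvent_symm h1]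
        simpa using sub_eq_zero.1 h0'
      obtain ⟨h, ew⟩ := h1 w
      have hwd : w ∈ A.domain := by rw [e]; exact A.domain.smul_mem _ h
      refine hk ⟨w, hwd⟩ ?_
      have hw' : (⟨w, hwd⟩ : A.domain) = star (l - m) • ⟨R w, h⟩ := Subtype.ext e
      rw [hw', A.map_smul]
      have ew' : A ⟨R w, h⟩ = w + (m : 𝕜) • R w := sub_eq_iff_eq_add.1 ew
      rw [ew']
      simp only [Submodule.coe_smul, smul_add]
      nth_rw 1 [e]
      simp only [smul_smul, ← add_smul]
      congr 1
      simp only [star_sub, RCLike.star_def, RCLike.conj_ofReal]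
      ring
    · exact AntilipschitzWith.of_le_mul_dist fun x y => by
        rw [dist_eq_norm, dist_eq_norm, ← map_sub]
        exact hanti _
  let e := ContinuousLinearEquiv.ofBijective S (LinearMap.ker_eq_bot.2 hbij.1)
    (LinearMap.range_eq_top.2 hbij.2)
  have he : ∀ u, e u = S u := fun u => rfl
  refine ⟨R ∘L (e.symm : H →L[𝕜] H), fun u => ?_, fun v => ?_⟩
  · obtain ⟨h, -⟩ := h1 (e.symm u)
    refine ⟨h, ?_⟩
    have := hSR (e.symm u) h
    rw [← he, e.apply_symm_apply] at this
    exact this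
  · have e1 : e (A v - (m : 𝕜) • (v : H)) = A v - l • (v : H) := by
      rw [he]
      have hv := h2 v
      simp only [hS, sub_apply, ContinuousLinearMap.id_apply,
        smul_apply] at hv ⊢
      rw [hv, sub_smul]
      abel
    rw [← e1]
    simp [h2 v]

/-- The bound by the imaginary part holds at `l` and at its conjugate, giving both the lower bound
and the absence of an eigenvalue at `star l`. -/
lemma IsSymm.mem_resolventSet_of_im_ne_zero [CompleteSpace H] {A : H →ₗ.[𝕜] H} (hA : IsSymm A) {m : ℝ}
    (hm : (m : 𝕜) ∈ resolventSet A) {l : 𝕜} (hl : RCLike.im l ≠ 0) : l ∈ resolventSet A := by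
  refine hA.mem_resolventSet hm (abs_pos.2 hl) (hA.im_bound l) fun v hv => ?_
  have h := hA.im_bound (star l) v
  rw [hv, sub_self, norm_zero] at h
  have h' : 0 < |RCLike.im (star l)| := by
    rw [RCLike.star_def, RCLike.conj_im, abs_neg]; exact abs_pos.2 hl
  have : ‖(v : H)‖ ≤ 0 := by
    by_contra hn
    push Not at hn
    nlinarith
  simpa using this

/-- If `A - l` is bounded below up to finitely many functionals which are bounded in the graph
norm, then it is bounded below on the orthogonal complement of its kernel. -/
lemma exists_bound_on_orthogonal [CompleteSpace H] {A : H →ₗ.[𝕜] H} {m : ℝ}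
    (hm : (m : 𝕜) ∈ resolventSet A) {l : 𝕜} {ι : Type*} [Fintype ι]
    (ell : A.domain →ₗ[𝕜] (ι → 𝕜)) {C : ℝ}
    (h1 : ∀ v : A.domain, ‖(v : H)‖ ≤ C * (‖A v - l • (v : H)‖ + ‖ell v‖))
    (h2 : ∀ v : A.domain, ‖ell v‖ ≤ C * (‖(v : H)‖ + ‖A v‖)) :
    ∃ c > 0, ∀ v : A.domain, (v : H) ∈ (eigenspace A l)ᗮ →
      c * ‖(v : H)‖ ≤ ‖A v - l • (v : H)‖ := by
  -- Otherwise there are unit vectors orthogonal to the eigenspace with `(A - l) v n → 0`.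
  -- Compactness in the finite-dimensional target of `ell` extracts a limit, which is an eigenvector
  -- orthogonal to all eigenvectors and yet of norm one.
  by_contra! hcon
  have hseq : ∀ n : ℕ, ∃ v : A.domain, (v : H) ∈ (eigenspace A l)ᗮ ∧ ‖(v : H)‖ = 1 ∧
      ‖A v - l • (v : H)‖ < 1 / ((n : ℝ) + 1) := by
    intro n
    obtain ⟨v, hv, hlt⟩ := hcon (1 / ((n : ℝ) + 1)) (by positivity)
    have hpos : 0 < ‖(v : H)‖ := by
      by_contra hn
      have h0 : ‖(v : H)‖ = 0 := le_antisymm (not_lt.1 hn) (norm_nonneg _)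
      rw [h0, mul_zero] at hlt
      exact absurd hlt (not_lt.2 (norm_nonneg _))
    have hnorm : ‖((‖(v : H)‖⁻¹ : ℝ) : 𝕜)‖ = ‖(v : H)‖⁻¹ := by
      rw [RCLike.norm_ofReal, abs_of_pos (by positivity)]
    refine ⟨((‖(v : H)‖⁻¹ : ℝ) : 𝕜) • v, Submodule.smul_mem _ _ hv, ?_, ?_⟩
    · rw [Submodule.coe_smul, norm_smul, hnorm, inv_mul_cancel₀ hpos.ne']
    · rw [A.map_smul, Submodule.coe_smul, smul_comm l, ← smul_sub, norm_smul, hnorm]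
      rw [inv_mul_lt_iff₀ hpos]
      linarith
  choose v hvE hv1 hvA using hseq
  have hC : 0 ≤ C := by
    have h := h2 (v 0)
    by_contra hn
    push Not at hn
    have h' : 0 < ‖(v 0 : H)‖ + ‖A (v 0)‖ := by rw [hv1]; positivity
    nlinarith [norm_nonneg (ell (v 0))]
  have hlb : ∀ n, ell (v n) ∈ Metric.closedBall (0 : ι → 𝕜) (C * (2 + ‖l‖)) := by
    intro n
    rw [mem_closedBall_zero_iff]
    refine (h2 _).trans (mul_le_mul_of_nonneg_left ?_ hC)
    have e : ‖A (v n)‖ ≤ ‖A (v n) - l • (v n : H)‖ + ‖l • (v n : H)‖ := by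
      simpa using norm_add_le (A (v n) - l • (v n : H)) (l • (v n : H))
    rw [norm_smul, hv1, mul_one] at e
    have e2 : 1 / ((n : ℝ) + 1) ≤ 1 := by
      rw [div_le_one (by positivity)]; linarith [(Nat.cast_nonneg n : (0 : ℝ) ≤ n)]
    rw [hv1]
    linarith [hvA n]
  obtain ⟨y, -, φ, hφ, hy⟩ := tendsto_subseq_of_bounded Metric.isBounded_closedBall hlb
  have hA0 : Tendsto (fun n => A (v n) - l • (v n : H)) atTop (𝓝 0) :=
    squeeze_zero_norm (fun n => (hvA n).le) tendsto_one_div_add_atTop_nhds_zero_nat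
  have hA0' := hA0.comp hφ.tendsto_atTop
  -- The estimate `h1` for differences: both terms on its right-hand side are Cauchy along the
  -- subsequence.
  have hcau : CauchySeq fun n => (v (φ n) : H) := by
    have c1 := Metric.cauchySeq_iff.1 hA0'.cauchySeq
    have c2 := Metric.cauchySeq_iff.1 hy.cauchySeq
    rw [Metric.cauchySeq_iff]
    intro ε hε
    have hδ : 0 < ε / (2 * (C + 1)) := by positivity
    obtain ⟨N1, hN1⟩ := c1 _ hδ
    obtain ⟨N2, hN2⟩ := c2 _ hδ
    refine ⟨max N1 N2, fun a ha b hb => ?_⟩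
    have d1 := hN1 a (le_of_max_le_left ha) b (le_of_max_le_left hb)
    have d2 := hN2 a (le_of_max_le_right ha) b (le_of_max_le_right hb)
    have d3 := h1 (v (φ a) - v (φ b))
    rw [A.map_sub, map_sub, Submodule.coe_sub, smul_sub, sub_sub_sub_comm] at d3
    rw [dist_eq_norm] at d1 d2 ⊢
    simp only [Function.comp_apply] at d1 d2
    have d4 : C * (‖A (v (φ a)) - l • (v (φ a) : H) - (A (v (φ b)) - l • (v (φ b) : H))‖
        + ‖ell (v (φ a)) - ell (v (φ b))‖) ≤ C * (ε / (2 * (C + 1)) + ε / (2 * (C + 1))) := by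
      gcongr
    have d5 : C * (ε / (2 * (C + 1)) + ε / (2 * (C + 1))) < ε := by
      have : ε / (2 * (C + 1)) + ε / (2 * (C + 1)) = ε / (C + 1) := by field_simp; ring
      rw [this, ← mul_div_assoc, div_lt_iff₀ (by positivity)]
      nlinarith
    linarith
  obtain ⟨w, hw⟩ := cauchySeq_tendsto_of_complete hcau
  obtain ⟨R, r1, r2⟩ := hm
  -- Writing `v n` through the bounded operator `R` replaces closedness of `A` in the passage to the
  -- limit.
  have hRv : ∀ n, R (A (v n) - l • (v n : H)) + R ((l - m) • (v n : H)) = v n := by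
    intro n
    nth_rw 3 [← r2 (v n)]
    rw [← map_add, sub_smul]
    congr 1; abel
  have lim1 : Tendsto (fun n => R (A (v (φ n)) - l • (v (φ n) : H))
      + R ((l - m) • (v (φ n) : H))) atTop (𝓝 (R 0 + R ((l - m) • w))) :=
    ((R.continuous.tendsto _).comp hA0').add ((R.continuous.tendsto _).comp (hw.const_smul _))
  simp only [hRv] at lim1
  have hweq : w = R ((l - m) • w) := by
    have := tendsto_nhds_unique hw lim1
    rwa [map_zero, zero_add] at this
  have hwE : w ∈ eigenspace A l := by
    obtain ⟨h, e⟩ := r1 ((l - m) • w)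
    rw [mem_eigenspace]
    have hwd : w ∈ A.domain := by rw [hweq]; exact h
    refine ⟨hwd, ?_⟩
    have hs : (⟨w, hwd⟩ : A.domain) = ⟨R ((l - m) • w), h⟩ := Subtype.ext hweq
    rw [hs, sub_eq_iff_eq_add.1 e, ← hweq, ← add_smul]
    congr 1; ring
  have hwO : w ∈ (eigenspace A l)ᗮ :=
    (Submodule.isClosed_orthogonal _).mem_of_tendsto hw (Eventually.of_forall fun n => hvE _)
  have hw0 : w = 0 := by
    have := hwO w hwE
    rwa [inner_self_eq_zero] at this
  have hw1 : ‖w‖ = 1 := by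
    refine tendsto_nhds_unique hw.norm ?_
    simp only [hv1]
    exact tendsto_const_nhds
  rw [hw0, norm_zero] at hw1
  exact zero_ne_one hw1

/-- On the eigenspace the term `A v - l • v` is zero, so the estimate makes `ell` injective there,
with values in a finite-dimensional space. -/
lemma finiteDimensional_eigenspace {A : H →ₗ.[𝕜] H} {l : 𝕜} {ι : Type*} [Fintype ι]
    (ell : A.domain →ₗ[𝕜] (ι → 𝕜)) {C : ℝ}
    (h1 : ∀ v : A.domain, ‖(v : H)‖ ≤ C * (‖A v - l • (v : H)‖ + ‖ell v‖)) :
    FiniteDimensional 𝕜 (eigenspace A l) := by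
  set E := LinearMap.eqLocus A.toFun (l • A.domain.subtype) with hE
  have hinj : Function.Injective (ell.domRestrict E) := by
    rw [← LinearMap.ker_eq_bot, LinearMap.ker_eq_bot']
    rintro ⟨v, hv⟩ h0
    have hv' : A v = l • (v : H) := hv
    have := h1 v
    rw [LinearMap.domRestrict_apply] at h0
    simp only at h0
    rw [hv', sub_self, h0] at this
    simp only [norm_zero, add_zero, mul_zero, norm_le_zero_iff, Submodule.coe_eq_zero] at this
    exact Subtype.ext this
  have : FiniteDimensional 𝕜 E := FiniteDimensional.of_injective _ hinj
  exact inferInstanceAs (FiniteDimensional 𝕜 (E.map A.domain.subtype))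

/-- Under the hypotheses of `exists_bound_on_orthogonal`, the real point `l` is isolated in the
spectrum, and belongs to the discrete spectrum if it is in the spectrum at all. -/
lemma IsSymm.isolated_and_discrete [CompleteSpace H] {A : H →ₗ.[𝕜] H} (hA : IsSymm A) {m : ℝ}
    (hm : (m : 𝕜) ∈ resolventSet A) {l : ℝ} {ι : Type*} [Fintype ι]
    (ell : A.domain →ₗ[𝕜] (ι → 𝕜)) {C : ℝ}
    (h1 : ∀ v : A.domain, ‖(v : H)‖ ≤ C * (‖A v - (l : 𝕜) • (v : H)‖ + ‖ell v‖))
    (h2 : ∀ v : A.domain, ‖ell v‖ ≤ C * (‖(v : H)‖ + ‖A v‖)) :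
    (∃ ε > 0, ∀ z ∈ spectrum A, dist z (l : 𝕜) < ε → z = l) ∧
      ((l : 𝕜) ∈ spectrum A → (l : 𝕜) ∈ discreteSpectrum A) := by
  have hfin := finiteDimensional_eigenspace ell h1
  obtain ⟨c, hc, hbd⟩ := exists_bound_on_orthogonal hm ell h1 h2
  set E := eigenspace A (l : 𝕜) with hE
  -- The vector is split along the eigenspace and its complement. On the first part `A - z` is
  -- multiplication by `l - z`; on the second it is bounded below by `c - dist z l`, which exceeds
  -- `dist z l` when `dist z l < c / 2`. By symmetry the two images are orthogonal, and Pythagoras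
  -- combines the bounds.
  have low : ∀ z : 𝕜, dist z (l : 𝕜) < c / 2 → ∀ v : A.domain,
      dist z (l : 𝕜) * ‖(v : H)‖ ≤ ‖A v - z • (v : H)‖ := by
    intro z hz v
    set e : H := E.starProjection (v : H) with he
    have heE : e ∈ E := E.starProjection_apply_mem _
    obtain ⟨hed, hAe⟩ := mem_eigenspace.1 heE
    set w : A.domain := v - ⟨e, hed⟩ with hw
    have hwO : (w : H) ∈ Eᗮ := by
      rw [hw, Submodule.coe_sub]
      exact E.sub_starProjection_mem_orthogonal _
    have hvw : v = ⟨e, hed⟩ + w := by rw [hw]; abel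
    have h3 := hbd w hwO
    have h4 : dist z (l : 𝕜) * ‖(w : H)‖ ≤ ‖A w - z • (w : H)‖ := by
      have e1 : A w - (l : 𝕜) • (w : H) = (A w - z • (w : H)) + (z - l) • (w : H) := by
        rw [sub_smul]; abel
      have e2 := norm_add_le (A w - z • (w : H)) ((z - l) • (w : H))
      rw [← e1, norm_smul, ← dist_eq_norm z] at e2
      nlinarith [norm_nonneg (w : H)]
    have horth : inner 𝕜 e (A w - z • (w : H)) = 0 := by
      have e1 := hA ⟨e, hed⟩ w
      simp only [hAe] at e1
      rw [inner_smul_left, hwO e heE, mul_zero] at e1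
      rw [inner_sub_right, ← e1, inner_smul_right, hwO e heE, mul_zero, sub_zero]
    have hdec : A v - z • (v : H) = ((l : 𝕜) - z) • e + (A w - z • (w : H)) := by
      rw [hvw, A.map_add, Submodule.coe_add, hAe, smul_add, sub_smul]
      abel
    have n1 : ‖A v - z • (v : H)‖ ^ 2
        = (dist z (l : 𝕜) * ‖e‖) ^ 2 + ‖A w - z • (w : H)‖ ^ 2 := by
      have := norm_add_sq_eq_norm_sq_add_norm_sq_of_inner_eq_zero (𝕜 := 𝕜) (((l : 𝕜) - z) • e)
        (A w - z • (w : H)) (by rw [inner_smul_left, horth, mul_zero])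
      rw [← hdec, norm_smul, ← dist_eq_norm (l : 𝕜) z, dist_comm] at this
      nlinarith
    have n2 : ‖(v : H)‖ ^ 2 = ‖e‖ ^ 2 + ‖(w : H)‖ ^ 2 := by
      have := norm_add_sq_eq_norm_sq_add_norm_sq_of_inner_eq_zero (𝕜 := 𝕜) e (w : H) (hwO e heE)
      have e3 : e + (w : H) = v := by rw [hw]; simp
      rw [e3] at this
      nlinarith
    refine abs_le_of_sq_le_sq' ?_ (norm_nonneg _) |>.2
    rw [n1, mul_pow, n2, mul_pow]
    have := pow_le_pow_left₀ (mul_nonneg dist_nonneg (norm_nonneg _)) h4 2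
    rw [mul_pow] at this
    linarith
  have hiso : ∀ z ∈ spectrum A, dist z (l : 𝕜) < c / 2 → z = l := by
    intro z hz hd
    by_contra hne
    have hpos : 0 < dist z (l : 𝕜) := dist_pos.2 hne
    refine hz (hA.mem_resolventSet hm hpos (low z hd) fun v hv => ?_)
    have hds : dist (star z) (l : 𝕜) = dist z (l : 𝕜) := by
      rw [dist_eq_norm, dist_eq_norm, ← norm_star (z - (l : 𝕜)), star_sub]
      simp
    have := low (star z) (by rwa [hds]) v
    rw [hv, sub_self, norm_zero, hds] at this
    have h0 : ‖(v : H)‖ ≤ 0 := by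
      by_contra hn
      push Not at hn
      nlinarith
    simpa using h0
  refine ⟨⟨c / 2, by positivity, hiso⟩, fun hl => ⟨hl, ⟨c / 2, by positivity, hiso⟩, ?_, hfin⟩⟩
  intro hbot
  have hO : ∀ v : A.domain, (v : H) ∈ Eᗮ := fun v => by
    rw [hE, hbot, Submodule.bot_orthogonal_eq_top]; trivial
  refine hl (hA.mem_resolventSet hm hc (fun v => hbd v (hO v)) fun v hv => ?_)
  have : (v : H) ∈ eigenspace A (l : 𝕜) := mem_eigenspace.2 ⟨v.2, by simpa using hv⟩
  rw [hbot] at this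
  simpa using this

end UnboundedOp

/-! ### Integration by parts, trace inequality and bounds on the form -/

namespace StarGraph

variable {𝕜 : Type*} [RCLike 𝕜]

/-- Integrability of the derivative gives `P` a limit at infinity, and integrability of `P` itself
forces that limit to be zero. -/
lemma IsPrim.integral_Ioi {P p : ℝ → 𝕜} (h : IsPrim P p) (hP : Integrable P halfLine)
    (hp : Integrable p halfLine) : ∫ x in Ioi (0 : ℝ), p x = - P 0 := by
  have h1 : Tendsto (fun b => P 0 + ∫ x in (0 : ℝ)..b, p x) atTop
      (𝓝 (P 0 + ∫ x in Ioi (0 : ℝ), p x)) :=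
    (intervalIntegral_tendsto_integral_Ioi 0 hp tendsto_id).const_add _
  have h2 : Tendsto P atTop (𝓝 (P 0 + ∫ x in Ioi (0 : ℝ), p x)) := by
    refine h1.congr' ?_
    filter_upwards [eventually_ge_atTop 0] with b hb using (h b hb).2.symm
  have h3 : IntegrableAtFilter P atTop volume := ⟨Ioi 0, Ioi_mem_atTop 0, hP⟩
  have := h3.eq_zero_of_tendsto (fun s hs => by
    obtain ⟨a, ha⟩ := mem_atTop_sets.1 hs
    exact measure_mono_top (fun x hx => ha x hx : Ici a ⊆ s) Real.volume_Ici) h2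
  exact eq_neg_of_add_eq_zero_right this

/-- Integration by parts on the half-line with a bounded weight `u`. -/
lemma integral_by_parts {f g f' g' : L2Half 𝕜} {c d : 𝕜} (hf : HasWeakDeriv f f')
    (bf : HasBoundaryValue f c) (hg : HasWeakDeriv g g') (bg : HasBoundaryValue g d)
    {u u' : ℝ → ℝ} (hu : ∀ x, HasDerivAt u (u' x) x) (hu' : Continuous u') {C : ℝ}
    (bu : ∀ x, |u x| ≤ C) (bu' : ∀ x, |u' x| ≤ C) :
    ∫ x in Ioi (0 : ℝ), ((u' x : 𝕜) * (f x * star (g x))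
      + (u x : 𝕜) * (f' x * star (g x) + f x * star (g' x))) = -((u 0 : 𝕜) * (c * star d)) := by
  have ef := hf.ae_eq_primitive bf
  have eg := hg.ae_eq_primitive bg
  have huc : Continuous u := continuous_iff_continuousAt.2 fun x => (hu x).continuousAt
  have pu : IsPrim (fun x => (u x : 𝕜)) (fun x => (u' x : 𝕜)) :=
    IsPrim.of_hasDerivAt (fun x => hasDerivAt_ofReal_comp (hu x))
      (RCLike.continuous_ofReal.comp hu')
  have p := pu.mul ((isPrim_primitive c f').mul (isPrim_primitive d g').star)
  have bdd : ∀ {w : ℝ → ℝ}, Continuous w → (∀ x, |w x| ≤ C) → ∀ {k : ℝ → 𝕜},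
      Integrable k halfLine → Integrable (fun x => (w x : 𝕜) * k x) halfLine :=
    fun hw hb k hk => hk.bdd_mul (c := C)
      (RCLike.continuous_ofReal.comp hw).aestronglyMeasurable
      (Eventually.of_forall fun x => by rw [RCLike.norm_ofReal]; exact hb x)
  have e1 : (fun x => (u x : 𝕜) * (f x * star (g x))) =ᵐ[halfLine]
      fun x => (u x : 𝕜) * (primitive c f' x * star (primitive d g' x)) := by
    filter_upwards [ef, eg] with x h1 h2
    rw [h1, h2]
  have e2 : (fun x => (u' x : 𝕜) * (f x * star (g x))
      + (u x : 𝕜) * (f' x * star (g x) + f x * star (g' x))) =ᵐ[halfLine]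
      fun x => (u' x : 𝕜) * (primitive c f' x * star (primitive d g' x))
      + (u x : 𝕜) * (f' x * star (primitive d g' x) + primitive c f' x * star (g' x)) := by
    filter_upwards [ef, eg] with x h1 h2
    rw [h1, h2]
  have i1 := (bdd huc bu (integrable_mul_star f g)).congr e1
  have i2 := ((bdd hu' bu' (integrable_mul_star f g)).add
    (bdd huc bu ((integrable_mul_star f' g).add (integrable_mul_star f g')))).congr e2
  have := p.integral_Ioi i1 i2
  rw [integral_congr_ae e2, this]
  simp

lemma inner_eq_integral (f g : L2Half 𝕜) :
    inner 𝕜 g f = ∫ x in Ioi (0 : ℝ), f x * star (g x) := by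
  rw [L2.inner_def]
  rfl

/-- The trace inequality: integrate the derivative of `|f|²` over the half-line and apply
Cauchy–Schwarz. -/
lemma norm_sq_boundaryValue_le {f f' : L2Half 𝕜} {c : 𝕜} (hf : HasWeakDeriv f f')
    (bf : HasBoundaryValue f c) : ‖c‖ ^ 2 ≤ 2 * (‖f‖ * ‖f'‖) := by
  have h := integral_by_parts hf bf hf bf (u := fun _ => 1) (u' := fun _ => 0)
    (fun x => hasDerivAt_const x 1) continuous_const (C := 1) (by simp) (by simp)
  simp only [RCLike.ofReal_zero, zero_mul, zero_add, RCLike.ofReal_one, one_mul] at h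
  rw [integral_add (integrable_mul_star f' f) (integrable_mul_star f f'), ← inner_eq_integral,
    ← inner_eq_integral] at h
  have h1 : ‖c‖ ^ 2 = ‖-(c * star c)‖ := by rw [norm_neg, norm_mul, norm_star, sq]
  rw [h1, ← h]
  have h2 := norm_inner_le_norm (𝕜 := 𝕜) f f'
  have h3 := norm_inner_le_norm (𝕜 := 𝕜) f' f
  refine (norm_add_le _ _).trans ?_
  linarith

/-- Cauchy–Schwarz against the indicator of the interval; it yields Hölder continuity of exponent
1/2 for primitives. -/
lemma norm_integral_le_sqrt (g : L2Half 𝕜) {a b : ℝ} (ha : 0 ≤ a) (hab : a ≤ b) :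
    ‖∫ t in a..b, g t‖ ≤ √(b - a) * ‖g‖ := by
  have hμ : halfLine (Ioc a b) ≠ ∞ :=
    ((Measure.restrict_apply_le _ _).trans_lt measure_Ioc_lt_top).ne
  have h1 := L2.inner_indicatorConstLp_one (𝕜 := 𝕜) (μ := halfLine) measurableSet_Ioc hμ g
  have hsub : Ioc a b ⊆ Ioi 0 := fun x hx => ha.trans_lt hx.1
  rw [Measure.restrict_restrict_of_subset hsub] at h1
  rw [intervalIntegral.integral_of_le hab, ← h1]
  refine (norm_inner_le_norm _ _).trans (le_of_eq ?_)
  congr 1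
  rw [norm_indicatorConstLp (by norm_num) (by norm_num), norm_one, one_mul, measureReal_def,
    Measure.restrict_apply measurableSet_Ioc, inter_eq_left.2 hsub, Real.volume_Ioc,
    ENNReal.toReal_ofReal (by linarith), Real.sqrt_eq_rpow]
  norm_num

lemma norm_mul_integral_le (q : ℝ →ᵇ ℝ) (f g : L2Half 𝕜) :
    ‖∫ x in Ioi (0 : ℝ), (q x : 𝕜) * (f x * star (g x))‖ ≤ ‖q‖ * (‖f‖ * ‖g‖) := by
  have hq : MemLp (fun x => (q x : 𝕜) * f x) 2 halfLine := by
    refine (Lp.memLp f).of_le_mul (c := ‖q‖) ?_ (Eventually.of_forall fun x => ?_)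
    · exact (RCLike.continuous_ofReal.comp q.continuous).aestronglyMeasurable.mul
        (Lp.aestronglyMeasurable f)
    · rw [norm_mul, RCLike.norm_ofReal]
      exact mul_le_mul_of_nonneg_right (q.norm_coe_le_norm x) (norm_nonneg _)
  have e : ∫ x in Ioi (0 : ℝ), (q x : 𝕜) * (f x * star (g x)) = inner 𝕜 g (hq.toLp _) := by
    rw [inner_eq_integral]
    refine integral_congr_ae ?_
    filter_upwards [hq.coeFn_toLp] with x hx
    rw [hx, mul_assoc]
  have hn : ‖hq.toLp _‖ ≤ ‖q‖ * ‖f‖ := by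
    refine Lp.norm_le_mul_norm_of_ae_le_mul ?_
    filter_upwards [hq.coeFn_toLp] with x hx
    rw [hx, norm_mul, RCLike.norm_ofReal]
    exact mul_le_mul_of_nonneg_right (q.norm_coe_le_norm x) (norm_nonneg _)
  rw [e]
  refine (norm_inner_le_norm _ _).trans ?_
  nlinarith [norm_nonneg g]

variable {N : ℕ}

lemma hasWeakDeriv_edgeDeriv (j : Fin N) (V : formDomain 𝕜 N) :
    HasWeakDeriv ((V : L2Graph 𝕜 N) j) (edgeDeriv j V) :=
  (V.2.1 j).choose_spec

lemma edgeDeriv_eq {j : Fin N} {V : formDomain 𝕜 N} {g : L2Half 𝕜}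
    (h : HasWeakDeriv ((V : L2Graph 𝕜 N) j) g) : edgeDeriv j V = g :=
  (hasWeakDeriv_edgeDeriv j V).unique h

lemma hasBoundaryValue_vertexValue [NeZero N] (j : Fin N) (V : formDomain 𝕜 N) :
    HasBoundaryValue ((V : L2Graph 𝕜 N) j) (vertexValue V) :=
  V.2.2.choose_spec j

lemma vertexValue_eq [NeZero N] {j : Fin N} {V : formDomain 𝕜 N} {c : 𝕜}
    (h : HasBoundaryValue ((V : L2Graph 𝕜 N) j) c) : vertexValue V = c :=
  (hasBoundaryValue_vertexValue j V).unique h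

/-- The weak derivative of a function of the form domain, as an element of `L²` of the graph. -/
def graphDeriv : formDomain 𝕜 N →ₗ[𝕜] L2Graph 𝕜 N where
  toFun V := WithLp.toLp 2 fun j => edgeDeriv j V
  map_add' V W := by ext1 j; simp
  map_smul' c V := by ext1 j; simp

@[simp] lemma graphDeriv_apply (V : formDomain 𝕜 N) (j : Fin N) :
    graphDeriv V j = edgeDeriv j V := rfl

lemma integrable_mul_mul_star (q : ℝ →ᵇ ℝ) (f g : L2Half 𝕜) :
    Integrable (fun x => (q x : 𝕜) * (f x * star (g x))) halfLine := by
  refine (integrable_mul_star f g).bdd_mul (c := ‖q‖) ?_ ?_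
  · exact (RCLike.continuous_ofReal.comp q.continuous).aestronglyMeasurable
  · refine Eventually.of_forall fun x => ?_
    rw [RCLike.norm_ofReal]
    exact q.norm_coe_le_norm x

lemma form_eq [NeZero N] (α : ℝ) (q : Fin N → ℝ →ᵇ ℝ) (F G : formDomain 𝕜 N) :
    form α q F G = inner 𝕜 (graphDeriv G) (graphDeriv F)
      + (∑ j, ∫ x in Ioi (0 : ℝ),
        (q j x : 𝕜) * ((F : L2Graph 𝕜 N) j x * star ((G : L2Graph 𝕜 N) j x)))
      + (α : 𝕜) * (vertexValue F * star (vertexValue G)) := by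
  unfold form
  congr 1
  rw [PiLp.inner_apply, ← Finset.sum_add_distrib]
  refine Finset.sum_congr rfl fun j _ => ?_
  rw [integral_add (integrable_mul_star _ _) (integrable_mul_mul_star _ _ _), graphDeriv_apply,
    graphDeriv_apply, inner_eq_integral]

lemma form_star [NeZero N] (α : ℝ) (q : Fin N → ℝ →ᵇ ℝ) (F G : formDomain 𝕜 N) :
    star (form α q F G) = form α q G F := by
  rw [form_eq, form_eq, star_add, star_add]
  congr 1
  · congr 1
    · exact inner_conj_symm _ _
    · rw [star_sum]
      refine Finset.sum_congr rfl fun j _ => ?_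
      rw [RCLike.star_def, ← integral_conj]
      refine integral_congr_ae (Eventually.of_forall fun x => ?_)
      simp only [map_mul, RCLike.conj_ofReal, RCLike.conj_conj]
      ring
  · simp only [star_mul', RCLike.star_def, RCLike.conj_ofReal, RCLike.conj_conj]
    ring

lemma form_add_right [NeZero N] (α : ℝ) (q : Fin N → ℝ →ᵇ ℝ) (F G G' : formDomain 𝕜 N) :
    form α q F (G + G') = form α q F G + form α q F G' := by
  rw [← form_star, form_add_left, star_add, form_star, form_star]

lemma form_smul_right [NeZero N] (α : ℝ) (q : Fin N → ℝ →ᵇ ℝ) (c : 𝕜) (F G : formDomain 𝕜 N) :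
    form α q F (c • G) = star c * form α q F G := by
  rw [← form_star, form_smul_left, star_mul', form_star]

lemma integrable_mul_norm_sq (q : ℝ →ᵇ ℝ) (f : L2Half 𝕜) :
    Integrable (fun x => q x * ‖f x‖ ^ 2) halfLine := by
  have h : Integrable (fun x => ‖f x‖ ^ 2) halfLine := by
    exact (memLp_two_iff_integrable_sq_norm (Lp.aestronglyMeasurable f)).1 (Lp.memLp f)
  exact h.bdd_mul (c := ‖q‖) q.continuous.aestronglyMeasurable
    (Eventually.of_forall fun x => q.norm_coe_le_norm x)

lemma norm_sq_eq_integral (f : L2Half 𝕜) : ‖f‖ ^ 2 = ∫ x in Ioi (0 : ℝ), ‖f x‖ ^ 2 := by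
  have h : ((‖f‖ ^ 2 : ℝ) : 𝕜) = ((∫ x in Ioi (0 : ℝ), ‖f x‖ ^ 2 : ℝ) : 𝕜) := by
    rw [RCLike.ofReal_pow, ← inner_self_eq_norm_sq_to_K, inner_eq_integral, ← integral_ofReal]
    refine integral_congr_ae (Eventually.of_forall fun x => ?_)
    simp only [RCLike.star_def, RCLike.mul_conj, RCLike.ofReal_pow]
  exact_mod_cast h

/-- The quadratic form associated with `form α q`. -/
lemma form_self [NeZero N] (α : ℝ) (q : Fin N → ℝ →ᵇ ℝ) (F : formDomain 𝕜 N) :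
    form α q F F = ((‖graphDeriv F‖ ^ 2
      + (∑ j, ∫ x in Ioi (0 : ℝ), q j x * ‖(F : L2Graph 𝕜 N) j x‖ ^ 2)
      + α * ‖vertexValue F‖ ^ 2 : ℝ) : 𝕜) := by
  rw [form_eq, inner_self_eq_norm_sq_to_K]
  push_cast
  congr 1
  · congr 1
    refine Finset.sum_congr rfl fun j _ => ?_
    refine Eq.trans ?_ (integral_ofReal (𝕜 := 𝕜))
    refine integral_congr_ae (Eventually.of_forall fun x => ?_)
    simp only [RCLike.star_def, RCLike.mul_conj, RCLike.ofReal_pow, RCLike.ofReal_mul]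
  · rw [RCLike.star_def, RCLike.mul_conj]

lemma norm_sq_vertexValue_le [NeZero N] (V : formDomain 𝕜 N) :
    ‖vertexValue V‖ ^ 2 ≤ 2 * (‖(V : L2Graph 𝕜 N)‖ * ‖graphDeriv V‖) := by
  refine (norm_sq_boundaryValue_le (hasWeakDeriv_edgeDeriv 0 V)
    (hasBoundaryValue_vertexValue 0 V)).trans ?_
  have h1 := PiLp.norm_apply_le (V : L2Graph 𝕜 N) 0
  have h2 := PiLp.norm_apply_le (graphDeriv V) 0
  rw [graphDeriv_apply] at h2
  gcongr

/-- The potential costs at most `∑ ‖q j‖` times `‖F‖²`. By the trace inequality the vertex term is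
at most `2 |α| ‖F‖ ‖F'‖ ≤ ‖F'‖² / 2 + 2 α² ‖F‖²`, so half of the derivative term remains. -/
lemma form_self_lower_bound [NeZero N] (α : ℝ) (q : Fin N → ℝ →ᵇ ℝ) :
    ∃ M : ℝ, ∀ F : formDomain 𝕜 N,
      ‖graphDeriv F‖ ^ 2 / 2 - M * ‖(F : L2Graph 𝕜 N)‖ ^ 2 ≤ RCLike.re (form α q F F) := by
  refine ⟨(∑ j, ‖q j‖) + 2 * α ^ 2, fun F => ?_⟩
  rw [form_self, RCLike.ofReal_re]
  have h1 : -((∑ j, ‖q j‖) * ‖(F : L2Graph 𝕜 N)‖ ^ 2)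
      ≤ ∑ j, ∫ x in Ioi (0 : ℝ), q j x * ‖(F : L2Graph 𝕜 N) j x‖ ^ 2 := by
    rw [Finset.sum_mul, ← Finset.sum_neg_distrib]
    refine Finset.sum_le_sum fun j _ => ?_
    have e : -(‖q j‖ * ‖(F : L2Graph 𝕜 N) j‖ ^ 2)
        ≤ ∫ x in Ioi (0 : ℝ), q j x * ‖(F : L2Graph 𝕜 N) j x‖ ^ 2 := by
      rw [norm_sq_eq_integral, ← integral_const_mul, ← integral_neg]
      have hi : Integrable (fun x => ‖(F : L2Graph 𝕜 N) j x‖ ^ 2) halfLine :=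
        (memLp_two_iff_integrable_sq_norm (Lp.aestronglyMeasurable _)).1 (Lp.memLp _)
      refine integral_mono (hi.const_mul _).neg (integrable_mul_norm_sq _ _) fun x => ?_
      have := (abs_le.1 ((q j).norm_coe_le_norm x)).1
      simp only
      nlinarith [sq_nonneg ‖(F : L2Graph 𝕜 N) j x‖]
    refine le_trans ?_ e
    have h2 := PiLp.norm_apply_le (F : L2Graph 𝕜 N) j
    have : ‖(F : L2Graph 𝕜 N) j‖ ^ 2 ≤ ‖(F : L2Graph 𝕜 N)‖ ^ 2 := by gcongr
    nlinarith [norm_nonneg (q j)]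
  have h2 : -(|α| * ‖vertexValue F‖ ^ 2) ≤ α * ‖vertexValue F‖ ^ 2 := by
    nlinarith [neg_abs_le α, sq_nonneg ‖vertexValue F‖]
  have h3 := mul_le_mul_of_nonneg_left (norm_sq_vertexValue_le F) (abs_nonneg α)
  have h4 := sq_nonneg (‖graphDeriv F‖ - 2 * |α| * ‖(F : L2Graph 𝕜 N)‖)
  have h5 := sq_abs α
  nlinarith

lemma norm_form_le [NeZero N] (α : ℝ) (q : Fin N → ℝ →ᵇ ℝ) :
    ∃ C : ℝ, ∀ F G : formDomain 𝕜 N, ‖form α q F G‖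
      ≤ C * √(‖(F : L2Graph 𝕜 N)‖ ^ 2 + ‖graphDeriv F‖ ^ 2)
        * √(‖(G : L2Graph 𝕜 N)‖ ^ 2 + ‖graphDeriv G‖ ^ 2) := by
  refine ⟨1 + (∑ j, ‖q j‖) + |α|, fun F G => ?_⟩
  set a := √(‖(F : L2Graph 𝕜 N)‖ ^ 2 + ‖graphDeriv F‖ ^ 2) with ha
  set b := √(‖(G : L2Graph 𝕜 N)‖ ^ 2 + ‖graphDeriv G‖ ^ 2) with hb
  have hval : ∀ V : formDomain 𝕜 N,
      ‖(V : L2Graph 𝕜 N)‖ ≤ √(‖(V : L2Graph 𝕜 N)‖ ^ 2 + ‖graphDeriv V‖ ^ 2) := fun V =>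
    Real.le_sqrt_of_sq_le (by nlinarith [sq_nonneg ‖graphDeriv V‖])
  have hder : ∀ V : formDomain 𝕜 N,
      ‖graphDeriv V‖ ≤ √(‖(V : L2Graph 𝕜 N)‖ ^ 2 + ‖graphDeriv V‖ ^ 2) := fun V =>
    Real.le_sqrt_of_sq_le (by nlinarith [sq_nonneg ‖(V : L2Graph 𝕜 N)‖])
  have hver : ∀ V : formDomain 𝕜 N,
      ‖vertexValue V‖ ≤ √(‖(V : L2Graph 𝕜 N)‖ ^ 2 + ‖graphDeriv V‖ ^ 2) := fun V => by
    refine Real.le_sqrt_of_sq_le ((norm_sq_vertexValue_le V).trans ?_)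
    nlinarith [sq_nonneg (‖(V : L2Graph 𝕜 N)‖ - ‖graphDeriv V‖)]
  have ha0 : 0 ≤ a := Real.sqrt_nonneg _
  have hb0 : 0 ≤ b := Real.sqrt_nonneg _
  have t1 : ‖inner 𝕜 (graphDeriv G) (graphDeriv F)‖ ≤ a * b := by
    refine (norm_inner_le_norm _ _).trans ?_
    rw [mul_comm]
    exact mul_le_mul (hder F) (hder G) (norm_nonneg _) ha0
  have t2 : ‖∑ j, ∫ x in Ioi (0 : ℝ),
      (q j x : 𝕜) * ((F : L2Graph 𝕜 N) j x * star ((G : L2Graph 𝕜 N) j x))‖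
      ≤ (∑ j, ‖q j‖) * (a * b) := by
    rw [Finset.sum_mul]
    refine (norm_sum_le _ _).trans (Finset.sum_le_sum fun j _ => ?_)
    refine (norm_mul_integral_le _ _ _).trans ?_
    have h1 := (PiLp.norm_apply_le (F : L2Graph 𝕜 N) j).trans (hval F)
    have h2 := (PiLp.norm_apply_le (G : L2Graph 𝕜 N) j).trans (hval G)
    gcongr
  have t3 : ‖(α : 𝕜) * (vertexValue F * star (vertexValue G))‖ ≤ |α| * (a * b) := by
    rw [norm_mul, norm_mul, norm_star, RCLike.norm_ofReal]
    have h1 := hver F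
    have h2 := hver G
    gcongr
  rw [form_eq]
  refine (norm_add₃_le).trans ?_
  nlinarith

end StarGraph

/-! ### Lax–Milgram and self-adjointness of the form operator -/

/-- **Lax–Milgram**: a bounded coercive sesquilinear form on a space `D`, which is complete for
the norm transported from `G`, represents the functionals `w ↦ (u, i w)`, with a solution operator
depending continuously on `u`. -/
lemma exists_laxMilgram_solution {𝕜 D G H : Type*} [RCLike 𝕜] [AddCommGroup D] [Module 𝕜 D]
    [NormedAddCommGroup G] [InnerProductSpace 𝕜 G] [CompleteSpace G] [NormedAddCommGroup H]
    [InnerProductSpace 𝕜 H] [CompleteSpace H] (e : D ≃ₗ[𝕜] G) (i : D →ₗ[𝕜] H)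
    (b : D →ₗ⋆[𝕜] D →ₗ[𝕜] 𝕜) {C c : ℝ} (hc : 0 < c) (hi : ∀ v, ‖i v‖ ≤ ‖e v‖)
    (hC : ∀ v w, ‖b v w‖ ≤ C * ‖e v‖ * ‖e w‖) (hco : ∀ v, c * ‖e v‖ ^ 2 ≤ RCLike.re (b v v)) :
    ∃ R : H →L[𝕜] H, (∀ u, ∃ v, R u = i v ∧ ∀ w, b v w = inner 𝕜 u (i w)) ∧
      ∀ v u, (∀ w, b v w = inner 𝕜 u (i w)) → R u = i v := by
  let b' : G →ₗ⋆[𝕜] G →ₗ[𝕜] 𝕜 := LinearMap.mk₂'ₛₗ (starRingEnd 𝕜) (RingHom.id 𝕜)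
    (fun v w => b (e.symm v) (e.symm w))
    (fun v v' w => by rw [map_add, map_add, LinearMap.add_apply])
    (fun a v w => by rw [map_smul, LinearMap.map_smulₛₗ, LinearMap.smul_apply])
    (fun v w w' => by rw [map_add, map_add])
    (fun a v w => by rw [map_smul, map_smul, RingHom.id_apply])
  let B : G →L⋆[𝕜] G →L[𝕜] 𝕜 := LinearMap.mkContinuous₂ b' C fun v w => by
    have := hC (e.symm v) (e.symm w)
    rwa [e.apply_symm_apply, e.apply_symm_apply] at this
  let I : G →L[𝕜] H := LinearMap.mkContinuous (i ∘ₗ e.symm.toLinearMap) 1 fun v => by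
    have := hi (e.symm v)
    rw [e.apply_symm_apply] at this
    rwa [one_mul]
  have hI : ∀ v, I (e v) = i v := fun v => congrArg i (e.symm_apply_apply v)
  let T : G →L[𝕜] G := InnerProductSpace.continuousLinearMapOfBilin B
  have hT : ∀ v w, inner 𝕜 (T (e v)) (e w) = b v w := fun v w => by
    refine (InnerProductSpace.continuousLinearMapOfBilin_apply B (e v) (e w)).trans ?_
    change b (e.symm (e v)) (e.symm (e w)) = b v w
    rw [e.symm_apply_apply, e.symm_apply_apply]
  obtain ⟨T', hT'⟩ : IsUnit T := by
    refine ContinuousLinearMap.isUnit_of_forall_le_norm_inner_map T (c := ⟨c, hc.le⟩) hc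
      fun v => ?_
    obtain ⟨v, rfl⟩ := e.surjective v
    rw [hT, mul_comm]
    exact (hco v).trans (RCLike.re_le_norm _)
  -- With `b v w = (T (e v), e w)`, the equation to solve reads `T (e v) = I* u`; hence the solution
  -- operator is `I T⁻¹ I*`.
  refine ⟨I ∘L (↑T'⁻¹ : G →L[𝕜] G) ∘L ContinuousLinearMap.adjoint I, fun u => ?_, fun v u h => ?_⟩
  · obtain ⟨v, hv⟩ := e.surjective ((↑T'⁻¹ : G →L[𝕜] G) (ContinuousLinearMap.adjoint I u))
    refine ⟨v, ?_, fun w => ?_⟩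
    · rw [ContinuousLinearMap.comp_apply, ContinuousLinearMap.comp_apply, ← hv, hI]
    · rw [← hT, hv, ← hT', ← mul_apply_eq_comp, Units.mul_inv, one_apply_eq_self,
        ContinuousLinearMap.adjoint_inner_left, hI]
  · have h1 : ContinuousLinearMap.adjoint I u = T (e v) := ext_inner_right 𝕜 fun w => by
      obtain ⟨w, rfl⟩ := e.surjective w
      rw [ContinuousLinearMap.adjoint_inner_left, hT, h, hI]
    rw [ContinuousLinearMap.comp_apply, ContinuousLinearMap.comp_apply, h1, ← hT',
      ← mul_apply_eq_comp, Units.inv_mul, one_apply_eq_self, hI]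

/-- An injective map with closed range transports a complete inner product to `D` without a second
norm on a space that already carries one. It is applied to the graph `V ↦ (V, V')`. -/
lemma exists_laxMilgram_solution_of_isClosed_range {𝕜 D K H : Type*} [RCLike 𝕜] [AddCommGroup D]
    [Module 𝕜 D] [NormedAddCommGroup K] [InnerProductSpace 𝕜 K] [CompleteSpace K]
    [NormedAddCommGroup H] [InnerProductSpace 𝕜 H] [CompleteSpace H] (g : D →ₗ[𝕜] K)
    (hg : Function.Injective g) (hcl : IsClosed (LinearMap.range g : Set K)) (i : D →ₗ[𝕜] H)
    (b : D →ₗ⋆[𝕜] D →ₗ[𝕜] 𝕜) {C c : ℝ} (hc : 0 < c) (hi : ∀ v, ‖i v‖ ≤ ‖g v‖)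
    (hC : ∀ v w, ‖b v w‖ ≤ C * ‖g v‖ * ‖g w‖) (hco : ∀ v, c * ‖g v‖ ^ 2 ≤ RCLike.re (b v v)) :
    ∃ R : H →L[𝕜] H, (∀ u, ∃ v, R u = i v ∧ ∀ w, b v w = inner 𝕜 u (i w)) ∧
      ∀ v u, (∀ w, b v w = inner 𝕜 u (i w)) → R u = i v := by
  have : CompleteSpace (LinearMap.range g) := hcl.completeSpace_coe
  exact exists_laxMilgram_solution (LinearEquiv.ofInjective g hg) i b hc hi hC hco

namespace StarGraph

variable {𝕜 : Type*} [RCLike 𝕜] {N : ℕ}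

lemma continuous_integral_test {ψ : ℝ → ℝ} (hc : Continuous ψ) (hs : HasCompactSupport ψ) :
    Continuous fun f : L2Half 𝕜 => ∫ x in Ioi (0 : ℝ), ψ x • f x := by
  have hm := IsTest.memLp (𝕜 := 𝕜) hc hs
  have e : (fun f : L2Half 𝕜 => ∫ x in Ioi (0 : ℝ), ψ x • f x)
      = fun f => inner 𝕜 (hm.toLp _) f := by
    funext f
    rw [inner_eq_integral]
    refine integral_congr_ae ?_
    filter_upwards [hm.coeFn_toLp] with x hx
    rw [hx, RCLike.star_def, RCLike.conj_ofReal, RCLike.real_smul_eq_coe_mul, mul_comm]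
  rw [e]
  fun_prop

lemma hasWeakDeriv_of_tendsto {f g : ℕ → L2Half 𝕜} {f₀ g₀ : L2Half 𝕜}
    (h : ∀ n, HasWeakDeriv (f n) (g n)) (hf : Tendsto f atTop (𝓝 f₀))
    (hg : Tendsto g atTop (𝓝 g₀)) : HasWeakDeriv f₀ g₀ := fun ψ hψ => by
  have h1 := ((continuous_integral_test (𝕜 := 𝕜) hψ.continuous_deriv hψ.2.1.deriv).tendsto
    f₀).comp hf
  have h2 := (((continuous_integral_test (𝕜 := 𝕜) hψ.1.continuous hψ.2.1).tendsto
    g₀).comp hg).neg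
  refine tendsto_nhds_unique h1 (h2.congr fun n => ?_)
  exact (h n ψ hψ).symm

lemma HasWeakDeriv.sub {f g f' g' : L2Half 𝕜} (hf : HasWeakDeriv f f')
    (hg : HasWeakDeriv g g') : HasWeakDeriv (f - g) (f' - g') := by
  simpa [sub_eq_add_neg] using hf.add (hg.smul (-1))

lemma HasBoundaryValue.sub {f g : L2Half 𝕜} {c d : 𝕜} (hf : HasBoundaryValue f c)
    (hg : HasBoundaryValue g d) : HasBoundaryValue (f - g) (c - d) := by
  simpa [sub_eq_add_neg] using hf.add (hg.smul (-1))

lemma HasWeakDeriv.exists_boundaryValue {f g : L2Half 𝕜} (h : HasWeakDeriv f g) :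
    ∃ c, HasBoundaryValue f c := by
  obtain ⟨c, hc⟩ := h.exists_primitive
  exact ⟨_, hasBoundaryValue_of_isPrim (isPrim_primitive c g) hc⟩

/-- The graph `V ↦ (V, V')` of the weak derivative. -/
def graphMap (𝕜 : Type*) [RCLike 𝕜] (N : ℕ) :
    formDomain 𝕜 N →ₗ[𝕜] WithLp 2 (L2Graph 𝕜 N × L2Graph 𝕜 N) where
  toFun V := WithLp.toLp 2 ((V : L2Graph 𝕜 N), graphDeriv V)
  map_add' V W := by rw [map_add]; rfl
  map_smul' c V := by rw [map_smul]; rfl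

lemma graphMap_injective : Function.Injective (graphMap 𝕜 N) := fun _ _ h =>
  Subtype.ext (congrArg (fun x => x.fst) h)

lemma norm_graphMap (V : formDomain 𝕜 N) :
    ‖graphMap 𝕜 N V‖ = √(‖(V : L2Graph 𝕜 N)‖ ^ 2 + ‖graphDeriv V‖ ^ 2) :=
  WithLp.prod_norm_eq_of_L2 _

/-- Weak derivatives are stable under `L²` limits, and by the trace inequality convergence of
functions and derivatives implies convergence of boundary values. The limits on different edges thus
share one vertex value. -/
lemma isClosed_range_graphMap [NeZero N] :
    IsClosed ((LinearMap.range (graphMap 𝕜 N) : Submodule 𝕜 _) :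
      Set (WithLp 2 (L2Graph 𝕜 N × L2Graph 𝕜 N))) := by
  refine IsSeqClosed.isClosed fun x y hx hy => ?_
  choose V hV using hx
  have t1 : Tendsto (fun n => (V n : L2Graph 𝕜 N)) atTop (𝓝 y.fst) := by
    have h := ((WithLp.prod_continuous_ofLp 2 _ _).tendsto y).comp hy
    have := (continuous_fst.tendsto _).comp h
    refine this.congr fun n => ?_
    simp only [Function.comp_apply, ← hV]
    rfl
  have t2 : Tendsto (fun n => graphDeriv (V n)) atTop (𝓝 y.snd) := by
    have h := ((WithLp.prod_continuous_ofLp 2 _ _).tendsto y).comp hy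
    have := (continuous_snd.tendsto _).comp h
    refine this.congr fun n => ?_
    simp only [Function.comp_apply, ← hV]
    rfl
  have s1 : ∀ j, Tendsto (fun n => (V n : L2Graph 𝕜 N) j) atTop (𝓝 (y.fst j)) := fun j =>
    ((PiLp.continuous_apply 2 _ j).tendsto _).comp t1
  have s2 : ∀ j, Tendsto (fun n => edgeDeriv j (V n)) atTop (𝓝 (y.snd j)) := fun j =>
    ((PiLp.continuous_apply 2 _ j).tendsto _).comp t2
  have hw : ∀ j, HasWeakDeriv (y.fst j) (y.snd j) := fun j =>
    hasWeakDeriv_of_tendsto (fun n => hasWeakDeriv_edgeDeriv j (V n)) (s1 j) (s2 j)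
  choose c hc using fun j => (hw j).exists_boundaryValue
  have hlim : ∀ j, Tendsto (fun n => vertexValue (V n)) atTop (𝓝 (c j)) := by
    intro j
    have hb : ∀ n, ‖vertexValue (V n) - c j‖ ^ 2
        ≤ 2 * (‖(V n : L2Graph 𝕜 N) j - y.fst j‖ * ‖edgeDeriv j (V n) - y.snd j‖) := fun n =>
      norm_sq_boundaryValue_le ((hasWeakDeriv_edgeDeriv j (V n)).sub (hw j))
        ((hasBoundaryValue_vertexValue j (V n)).sub (hc j))
    have z1 := (tendsto_iff_norm_sub_tendsto_zero.1 (s1 j))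
    have z2 := (tendsto_iff_norm_sub_tendsto_zero.1 (s2 j))
    have z3 := (z1.mul z2).const_mul 2
    rw [mul_zero, mul_zero] at z3
    have z4 := squeeze_zero (fun n => sq_nonneg _) hb z3
    rw [tendsto_iff_norm_sub_tendsto_zero]
    have z5 := z4.sqrt
    simpa using z5
  have hcc : ∀ j, c j = c 0 := fun j => tendsto_nhds_unique (hlim j) (hlim 0)
  let W : formDomain 𝕜 N := ⟨y.fst, fun j => ⟨_, hw j⟩, c 0, fun j => hcc j ▸ hc j⟩
  refine ⟨W, ?_⟩
  have hd : graphDeriv W = y.snd := by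
    ext1 j
    exact edgeDeriv_eq (V := W) (hw j)
  change WithLp.toLp 2 (y.fst, graphDeriv W) = y
  rw [hd]
  rfl

lemma exists_formOperator_eq [NeZero N] {α : ℝ} {q : Fin N → ℝ →ᵇ ℝ} {V : formDomain 𝕜 N}
    {W : L2Graph 𝕜 N} (h : Represents α q V W) :
    ∃ hV : (V : L2Graph 𝕜 N) ∈ (formOperator 𝕜 α q).domain, formOperator 𝕜 α q ⟨V, hV⟩ = W :=
  ⟨⟨V, rfl, W, h⟩, (formOperator_represents α q _ V rfl).unique h⟩

lemma exists_formDomain_of_domain [NeZero N] {α : ℝ} {q : Fin N → ℝ →ᵇ ℝ}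
    (v : (formOperator 𝕜 α q).domain) : ∃ V : formDomain 𝕜 N, (V : L2Graph 𝕜 N) = v ∧
      Represents α q V (formOperator 𝕜 α q v) := by
  obtain ⟨V, hV, -⟩ := v.2
  exact ⟨V, hV, formOperator_represents α q v V hV⟩

lemma isSymm_formOperator [NeZero N] (α : ℝ) (q : Fin N → ℝ →ᵇ ℝ) :
    UnboundedOp.IsSymm (formOperator 𝕜 α q) := fun v w => by
  obtain ⟨V, hV, hV'⟩ := exists_formDomain_of_domain v
  obtain ⟨W, hW, hW'⟩ := exists_formDomain_of_domain w
  rw [← hV, ← hW, ← inner_conj_symm, ← hV' W, ← hW' V, ← form_star α q V W]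
  rfl

/-- The sesquilinear map `(v, w) ↦ form w v + M (v, w)`, conjugate-linear in `v`. -/
def shiftedForm [NeZero N] (α : ℝ) (q : Fin N → ℝ →ᵇ ℝ) (M : ℝ) :
    formDomain 𝕜 N →ₗ⋆[𝕜] formDomain 𝕜 N →ₗ[𝕜] 𝕜 :=
  LinearMap.mk₂'ₛₗ (starRingEnd 𝕜) (RingHom.id 𝕜)
    (fun v w => form α q w v + (M : 𝕜) * inner 𝕜 (v : L2Graph 𝕜 N) (w : L2Graph 𝕜 N))
    (fun v v' w => by
      rw [form_add_right, Submodule.coe_add, inner_add_left]; ring)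
    (fun c v w => by
      rw [form_smul_right, Submodule.coe_smul, inner_smul_left, RCLike.star_def, smul_eq_mul]
      ring)
    (fun v w w' => by
      rw [form_add_left, Submodule.coe_add, inner_add_right]; ring)
    (fun c v w => by
      rw [form_smul_left, Submodule.coe_smul, inner_smul_right, RingHom.id_apply, smul_eq_mul]
      ring)

lemma shiftedForm_apply [NeZero N] (α : ℝ) (q : Fin N → ℝ →ᵇ ℝ) (M : ℝ) (v w : formDomain 𝕜 N) :
    shiftedForm α q M v w
      = form α q w v + (M : 𝕜) * inner 𝕜 (v : L2Graph 𝕜 N) (w : L2Graph 𝕜 N) := rfl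

/-- The form operator is bounded below and self-adjoint: some real number belongs to its
resolvent set (Lax–Milgram). -/
lemma exists_mem_resolventSet_formOperator [NeZero N] (α : ℝ) (q : Fin N → ℝ →ᵇ ℝ) :
    ∃ m : ℝ, (m : 𝕜) ∈ UnboundedOp.resolventSet (formOperator 𝕜 α q) := by
  obtain ⟨M₀, hM₀⟩ := form_self_lower_bound (𝕜 := 𝕜) α q
  obtain ⟨C, hC⟩ := norm_form_le (𝕜 := 𝕜) α q
  -- The extra `1 / 2` balances the `‖V'‖² / 2` of the lower bound, so the shifted form is coercive
  -- with constant `1 / 2` in the graph norm. The resolvent point is then `-M`.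
  set M : ℝ := M₀ + 1 / 2 with hM
  have hen : ∀ V : formDomain 𝕜 N, ‖graphMap 𝕜 N V‖
      = √(‖(V : L2Graph 𝕜 N)‖ ^ 2 + ‖graphDeriv V‖ ^ 2) := norm_graphMap
  have hn : ∀ V : formDomain 𝕜 N, ‖(V : L2Graph 𝕜 N)‖ ≤ ‖graphMap 𝕜 N V‖ := fun V => by
    rw [hen]; exact Real.le_sqrt_of_sq_le (by nlinarith [sq_nonneg ‖graphDeriv V‖])
  have hbd : ∀ V W : formDomain 𝕜 N, ‖shiftedForm α q M V W‖
      ≤ (C + |M|) * ‖graphMap 𝕜 N V‖ * ‖graphMap 𝕜 N W‖ := by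
    intro V W
    have h1 := hC W V
    rw [← hen, ← hen] at h1
    have h2 : ‖(M : 𝕜) * inner 𝕜 (V : L2Graph 𝕜 N) (W : L2Graph 𝕜 N)‖
        ≤ |M| * (‖graphMap 𝕜 N V‖ * ‖graphMap 𝕜 N W‖) := by
      rw [norm_mul, RCLike.norm_ofReal]
      have h3 := hn V
      have h4 := hn W
      refine mul_le_mul_of_nonneg_left ((norm_inner_le_norm _ _).trans ?_) (abs_nonneg _)
      gcongr
    rw [shiftedForm_apply]
    refine (norm_add_le _ _).trans ((add_le_add h1 h2).trans_eq ?_)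
    ring
  have hco : ∀ V : formDomain 𝕜 N, 1 / 2 * ‖graphMap 𝕜 N V‖ ^ 2 ≤ RCLike.re (shiftedForm α q M V V) := by
    intro V
    rw [shiftedForm_apply, map_add, inner_self_eq_norm_sq_to_K, ← RCLike.ofReal_pow,
      ← RCLike.ofReal_mul, RCLike.ofReal_re, hen, Real.sq_sqrt (by positivity), hM]
    linarith [hM₀ V]
  obtain ⟨R, hR1, hR2⟩ := exists_laxMilgram_solution_of_isClosed_range (graphMap 𝕜 N)
    graphMap_injective isClosed_range_graphMap (formDomain 𝕜 N).subtype (shiftedForm α q M)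
    (C := C + |M|) (c := 1 / 2) (by norm_num) hn hbd hco
  refine ⟨-M, R, fun u => ?_, fun v => ?_⟩
  · obtain ⟨V, hV, hb⟩ := hR1 u
    have hrep : Represents α q V (u - (M : 𝕜) • (V : L2Graph 𝕜 N)) := by
      intro Z
      have h2 := congrArg star (hb Z)
      rw [shiftedForm_apply, star_add, form_star, star_mul', RCLike.star_def, inner_conj_symm,
        inner_conj_symm, RCLike.conj_ofReal, Submodule.subtype_apply] at h2
      rw [inner_sub_right, inner_smul_right, ← h2]
      ring
    obtain ⟨hd, he⟩ := exists_formOperator_eq hrep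
    rw [hV, Submodule.subtype_apply]
    refine ⟨hd, ?_⟩
    rw [he, RCLike.ofReal_neg, neg_smul]
    abel
  · obtain ⟨V, hV, hrep⟩ := exists_formDomain_of_domain v
    rw [hR2 V _ fun W => ?_, Submodule.subtype_apply, hV]
    rw [shiftedForm_apply, Submodule.subtype_apply, inner_sub_left, inner_smul_left,
      RCLike.conj_ofReal, RCLike.ofReal_neg, ← hV, ← inner_conj_symm (formOperator 𝕜 α q v),
      ← hrep W, ← form_star α q V W, RCLike.star_def]
    ring

/-! ### Below the limit of the potential the spectrum is discrete -/

lemma norm_primitive_sub_le (c : 𝕜) (g : L2Half 𝕜) {a b : ℝ} (ha : 0 ≤ a) (hab : a ≤ b) :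
    ‖primitive c g b - primitive c g a‖ ≤ √(b - a) * ‖g‖ := by
  rw [(isPrim_primitive c g).sub_eq ha (ha.trans hab)]
  exact norm_integral_le_sqrt g ha hab

/-- The value at `x` is compared with the value at the nearest node of mesh `R / n` to the left. The
Hölder bound controls the increment by `R / n * ‖g‖²`, small for fine meshes, and the node value is
one term of the sum. -/
lemma norm_sq_primitive_le (c : 𝕜) (g : L2Half 𝕜) {R : ℝ} (hR : 0 < R) {n : ℕ} (hn : 0 < n)
    {x : ℝ} (hx : 0 ≤ x) (hxR : x ≤ R) :
    ‖primitive c g x‖ ^ 2 ≤ 2 * (∑ i : Fin (n + 1), ‖primitive c g (R / n * (i : ℕ))‖ ^ 2)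
      + 2 * (R / n * ‖g‖ ^ 2) := by
  have hn' : (0 : ℝ) < n := Nat.cast_pos.2 hn
  set δ := R / n with hδ
  have hδ0 : 0 < δ := by positivity
  obtain ⟨m, h1, h2⟩ : ∃ m : ℕ, (m : ℝ) ≤ x / δ ∧ x / δ < m + 1 :=
    ⟨⌊x / δ⌋₊, Nat.floor_le (by positivity), Nat.lt_floor_add_one _⟩
  rw [le_div_iff₀ hδ0] at h1
  rw [div_lt_iff₀ hδ0] at h2
  have hmn : m < n + 1 := by
    have : (m : ℝ) * δ ≤ n * δ := h1.trans (hxR.trans_eq (by rw [hδ]; field_simp))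
    have := le_of_mul_le_mul_right this hδ0
    exact Nat.lt_succ_of_le (by exact_mod_cast this)
  obtain ⟨i, rfl⟩ : ∃ i : Fin (n + 1), (i : ℕ) = m := ⟨⟨m, hmn⟩, rfl⟩
  have h3 := Finset.single_le_sum (f := fun i : Fin (n + 1) => ‖primitive c g (δ * (i : ℕ))‖ ^ 2)
    (fun i _ => sq_nonneg _) (Finset.mem_univ i)
  have h4 := norm_primitive_sub_le c g (a := δ * (i : ℕ)) (b := x) (by positivity) (by linarith)
  have h5 : ‖primitive c g x - primitive c g (δ * (i : ℕ))‖ ^ 2 ≤ δ * ‖g‖ ^ 2 :=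
    calc ‖primitive c g x - primitive c g (δ * (i : ℕ))‖ ^ 2 ≤ (√(x - δ * (i : ℕ)) * ‖g‖) ^ 2 :=
          pow_le_pow_left₀ (norm_nonneg _) h4 2
      _ = (x - δ * (i : ℕ)) * ‖g‖ ^ 2 := by rw [mul_pow, Real.sq_sqrt (by linarith)]
      _ ≤ δ * ‖g‖ ^ 2 := mul_le_mul_of_nonneg_right (by linarith) (sq_nonneg _)
  have h6 : ‖primitive c g x‖
      ≤ ‖primitive c g (δ * (i : ℕ))‖ + ‖primitive c g x - primitive c g (δ * (i : ℕ))‖ :=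
    norm_le_norm_add_norm_sub' _ _
  have h7 := (pow_le_pow_left₀ (norm_nonneg _) h6 2).trans add_sq_le
  linarith

lemma integrable_norm_sq (f : L2Half 𝕜) : Integrable (fun x => ‖f x‖ ^ 2) halfLine :=
  (memLp_two_iff_integrable_sq_norm (Lp.aestronglyMeasurable f)).1 (Lp.memLp f)

lemma setIntegral_norm_sq_le {f g : L2Half 𝕜} {c : 𝕜} (h : HasWeakDeriv f g)
    (hc : HasBoundaryValue f c) {R : ℝ} (hR : 0 < R) {n : ℕ} (hn : 0 < n) :
    ∫ x in Ioc 0 R, ‖f x‖ ^ 2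
      ≤ R * (2 * (∑ i : Fin (n + 1), ‖primitive c g (R / n * (i : ℕ))‖ ^ 2)
        + 2 * (R / n * ‖g‖ ^ 2)) := by
  have hi : IntegrableOn (fun x => ‖f x‖ ^ 2) (Ioc 0 R) :=
    IntegrableOn.mono_set (integrable_norm_sq f) Ioc_subset_Ioi_self
  have hae := (ae_restrict_iff' measurableSet_Ioi).1 (h.ae_eq_primitive hc)
  have hk : ∫ x in Ioc 0 R, ‖f x‖ ^ 2 ≤ ∫ _x in Ioc 0 R,
      (2 * (∑ i : Fin (n + 1), ‖primitive c g (R / n * (i : ℕ))‖ ^ 2)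
        + 2 * (R / n * ‖g‖ ^ 2)) := by
    refine setIntegral_mono_on_ae hi (by simp) measurableSet_Ioc ?_
    filter_upwards [hae] with x hx hx'
    rw [hx hx'.1]
    exact norm_sq_primitive_le c g hR hn hx'.1.le hx'.2
  refine hk.trans_eq ?_
  rw [setIntegral_const, smul_eq_mul, measureReal_def, Real.volume_Ioc,
    ENNReal.toReal_ofReal (by linarith), sub_zero]

/-- Beyond `R` the potential exceeds `l + η`; before `R` it is at least `-‖q‖ ≥ l + η - K`, and the
deficit is charged to the integral over `(0, R]`. -/
lemma integral_potential_lower_bound (q : ℝ →ᵇ ℝ) {l η K R : ℝ}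
    (hq : ∀ x, R ≤ x → l + η ≤ q x) (hK : ‖q‖ + |l| + |η| ≤ K) (f : L2Half 𝕜) :
    (l + η) * ‖f‖ ^ 2 - K * ∫ x in Ioc 0 R, ‖f x‖ ^ 2
      ≤ ∫ x in Ioi (0 : ℝ), q x * ‖f x‖ ^ 2 := by
  have hi := integrable_norm_sq f
  have hK0 : 0 ≤ K := le_trans (by positivity) hK
  have e1 : ∫ x in Ioc 0 R, ‖f x‖ ^ 2
      = ∫ x in Ioi (0 : ℝ), (Ioc 0 R).indicator (fun x => ‖f x‖ ^ 2) x := by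
    rw [integral_indicator measurableSet_Ioc,
      Measure.restrict_restrict_of_subset Ioc_subset_Ioi_self]
  rw [norm_sq_eq_integral, e1, ← integral_const_mul, ← integral_const_mul, ← integral_sub
    (hi.const_mul _) ((hi.indicator measurableSet_Ioc).const_mul _)]
  refine setIntegral_mono_on ((hi.const_mul _).sub ((hi.indicator measurableSet_Ioc).const_mul _))
    (integrable_mul_norm_sq q f) measurableSet_Ioi fun x hx => ?_
  have hf := sq_nonneg ‖f x‖
  rcases le_or_gt R x with h | h
  · have h1 := hq x h
    have h2 : 0 ≤ K * (Ioc 0 R).indicator (fun x => ‖f x‖ ^ 2) x :=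
      mul_nonneg hK0 (indicator_nonneg (fun _ _ => sq_nonneg _) _)
    nlinarith
  · rw [indicator_of_mem (show x ∈ Ioc 0 R from ⟨hx, h.le⟩)]
    have h1 := (abs_le.1 (q.norm_coe_le_norm x)).1
    have h2 := le_abs_self l
    have h3 := le_abs_self η
    rw [← sub_mul]
    exact mul_le_mul_of_nonneg_right (by linarith) hf

/-- The value of a function of the form domain at the point `x ≥ 0` of the `j`-th edge. -/
def pointValue [NeZero N] (j : Fin N) {x : ℝ} (hx : 0 ≤ x) : formDomain 𝕜 N →ₗ[𝕜] 𝕜 where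
  toFun V := primitive (vertexValue V) (edgeDeriv j V) x
  map_add' V W := by
    have e : ∫ t in (0 : ℝ)..x, edgeDeriv j (V + W) t
        = ∫ t in (0 : ℝ)..x, (edgeDeriv j V t + edgeDeriv j W t) := by
      refine intervalIntegral.integral_congr_ae ?_
      rw [uIoc_of_le hx, map_add]
      filter_upwards [(ae_restrict_iff' measurableSet_Ioi).1
        (Lp.coeFn_add (edgeDeriv j V) (edgeDeriv j W))] with t ht ht'
      exact ht ht'.1
    rw [primitive, e, intervalIntegral.integral_add (intervalIntegrable_L2 _ hx)
      (intervalIntegrable_L2 _ hx), map_add, primitive, primitive]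
    ring
  map_smul' c V := by
    have e : ∫ t in (0 : ℝ)..x, edgeDeriv j (c • V) t
        = ∫ t in (0 : ℝ)..x, c • edgeDeriv j V t := by
      refine intervalIntegral.integral_congr_ae ?_
      rw [uIoc_of_le hx, map_smul]
      filter_upwards [(ae_restrict_iff' measurableSet_Ioi).1
        (Lp.coeFn_smul c (edgeDeriv j V))] with t ht ht'
      exact ht ht'.1
    rw [primitive, e, intervalIntegral.integral_smul, map_smul, primitive, RingHom.id_apply,
      smul_add]

lemma pointValue_apply [NeZero N] (j : Fin N) {x : ℝ} (hx : 0 ≤ x) (V : formDomain 𝕜 N) :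
    pointValue j hx V = primitive (vertexValue V) (edgeDeriv j V) x := rfl

lemma norm_pointValue_le [NeZero N] (j : Fin N) {x : ℝ} (hx : 0 ≤ x) (V : formDomain 𝕜 N) :
    ‖pointValue j hx V‖ ≤ ‖(V : L2Graph 𝕜 N)‖ + (1 + √x) * ‖graphDeriv V‖ := by
  have h1 := norm_primitive_sub_le (vertexValue V) (edgeDeriv j V) le_rfl hx
  rw [primitive_zero, sub_zero] at h1
  have h2 : ‖vertexValue V‖ ≤ ‖(V : L2Graph 𝕜 N)‖ + ‖graphDeriv V‖ := by
    refine abs_le_of_sq_le_sq' ?_ (by positivity) |>.2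
    have := norm_sq_vertexValue_le V
    nlinarith [sq_nonneg ‖(V : L2Graph 𝕜 N)‖, sq_nonneg ‖graphDeriv V‖]
  have h3 := PiLp.norm_apply_le (graphDeriv V) j
  rw [graphDeriv_apply] at h3
  have h4 := norm_le_norm_add_norm_sub' (primitive (vertexValue V) (edgeDeriv j V) x)
    (vertexValue V)
  have h5 : √x * ‖edgeDeriv j V‖ ≤ √x * ‖graphDeriv V‖ := by gcongr
  rw [pointValue_apply]
  linarith

/-- The inclusion of the operator domain in the form domain. -/
def domainInclusion [NeZero N] (α : ℝ) (q : Fin N → ℝ →ᵇ ℝ) :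
    (formOperator 𝕜 α q).domain →ₗ[𝕜] formDomain 𝕜 N :=
  Submodule.inclusion (p := opDomain 𝕜 α q) (by
    rintro _ ⟨V, rfl, -⟩
    exact V.2)

lemma coe_domainInclusion [NeZero N] {α : ℝ} {q : Fin N → ℝ →ᵇ ℝ}
    (v : (formOperator 𝕜 α q).domain) :
    (domainInclusion α q v : L2Graph 𝕜 N) = v := rfl

lemma re_form_le [NeZero N] {α : ℝ} {q : Fin N → ℝ →ᵇ ℝ} {V : formDomain 𝕜 N}
    {W : L2Graph 𝕜 N} (h : Represents α q V W) (l : ℝ) :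
    RCLike.re (form α q V V) ≤ l * ‖(V : L2Graph 𝕜 N)‖ ^ 2
      + ‖(V : L2Graph 𝕜 N)‖ * ‖W - (l : 𝕜) • (V : L2Graph 𝕜 N)‖ := by
  have h1 := (RCLike.re_le_norm _).trans (norm_inner_le_norm (𝕜 := 𝕜) (V : L2Graph 𝕜 N)
    (W - (l : 𝕜) • (V : L2Graph 𝕜 N)))
  rw [inner_sub_right, inner_smul_right, inner_self_eq_norm_sq_to_K, ← RCLike.ofReal_pow,
    ← RCLike.ofReal_mul, map_sub, RCLike.ofReal_re, ← h V] at h1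
  linarith

/-- Young's inequality absorbs half of the left side: `2 η a b ≤ (η a)² + b²`. What remains bounds
`a²` by a sum of squares. -/
lemma le_mul_add_of_sq_le {η D a b e : ℝ} (hη : 0 < η) (hD : 0 ≤ D) (hb : 0 ≤ b)
    (he : 0 ≤ e) (h : η * a ^ 2 ≤ a * b + D * e ^ 2) :
    a ≤ (1 / η + √(2 * D / η)) * (b + e) := by
  have h1 : a ^ 2 ≤ (b / η) ^ 2 + 2 * D / η * e ^ 2 := by
    have h2 : 2 * η * (a * b) ≤ (η * a) ^ 2 + b ^ 2 := by nlinarith [sq_nonneg (η * a - b)]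
    have h3 : η ^ 2 * a ^ 2 ≤ b ^ 2 + 2 * D * η * e ^ 2 := by nlinarith
    have h4 : η ^ 2 * ((b / η) ^ 2 + 2 * D / η * e ^ 2) = b ^ 2 + 2 * D * η * e ^ 2 := by
      field_simp
    exact le_of_mul_le_mul_left (h3.trans_eq h4.symm) (by positivity)
  have hs : √(2 * D / η) ^ 2 = 2 * D / η := Real.sq_sqrt (by positivity)
  have hb' : 0 ≤ b / η := by positivity
  have hs' : 0 ≤ √(2 * D / η) * e := by positivity
  have h5 : a ≤ b / η + √(2 * D / η) * e := by
    refine abs_le_of_sq_le_sq' ?_ (by positivity) |>.2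
    nlinarith
  have h6 : 0 ≤ 1 / η * e := by positivity
  have h7 : 0 ≤ √(2 * D / η) * b := by positivity
  calc a ≤ b / η + √(2 * D / η) * e := h5
    _ ≤ (1 / η + √(2 * D / η)) * (b + e) := by
      have : b / η = 1 / η * b := by ring
      nlinarith

/-- Away from finitely many point evaluations, the form is bounded below by any number smaller
than the limit of the potential. -/
lemma exists_peetre_estimate [NeZero N] (α : ℝ) {q : Fin N → ℝ →ᵇ ℝ} {ω l : ℝ}
    (hq : ∀ j, Tendsto (q j) atTop (𝓝 ω)) (hl : l < ω) :
    ∃ (n : ℕ) (ell : formDomain 𝕜 N →ₗ[𝕜] (Fin N × Fin (n + 1) → 𝕜)) (C : ℝ),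
      (∀ V W, Represents α q V W →
        ‖(V : L2Graph 𝕜 N)‖ ≤ C * (‖W - (l : 𝕜) • (V : L2Graph 𝕜 N)‖ + ‖ell V‖)) ∧
      ∀ V W, Represents α q V W → ‖ell V‖ ≤ C * (‖(V : L2Graph 𝕜 N)‖ + ‖W‖) := by
  -- Half of the distance to `ω` is kept as a margin: the potential is above `l + η` beyond some
  -- `R`.
  set η := (ω - l) / 2 with hη
  have hη0 : 0 < η := by rw [hη]; linarith
  obtain ⟨R, hR, hqR⟩ : ∃ R : ℝ, 0 < R ∧ ∀ j x, R ≤ x → l + η ≤ q j x := by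
    have h1 : ∀ᶠ x in atTop, ∀ j, l + η ≤ q j x :=
      eventually_all.2 fun j => (hq j).eventually_const_le (by rw [hη]; linarith)
    obtain ⟨R, hR⟩ := eventually_atTop.1 h1
    exact ⟨max R 1, by positivity, fun j x hx => hR x ((le_max_left _ _).trans hx) j⟩
  set K := (∑ j, ‖q j‖) + |l| + |η| with hK
  have hK0 : 0 ≤ K := by positivity
  -- The sampling error on `(0, R]` is `2 K R² / n * ‖V'‖²`; this `n` makes it absorbable by the
  -- term `‖V'‖²` of the form.
  obtain ⟨n, hn⟩ := exists_nat_gt (2 * K * R ^ 2)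
  have hn0 : 0 < n := Nat.cast_pos.1 (lt_of_le_of_lt (by positivity) hn)
  have hn' : (0 : ℝ) < n := Nat.cast_pos.2 hn0
  have hpt : ∀ i : Fin (n + 1), 0 ≤ R / n * (i : ℕ) := fun i => by positivity
  set ell : formDomain 𝕜 N →ₗ[𝕜] (Fin N × Fin (n + 1) → 𝕜) :=
    LinearMap.pi fun p => pointValue p.1 (hpt p.2) with hell
  have hellv : ∀ V p, ell V p
      = primitive (vertexValue V) (edgeDeriv p.1 V) (R / n * ((p.2 : Fin (n + 1)) : ℕ)) :=
    fun V p => rfl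
  set D := 2 * R * K * (N * (n + 1)) + |α| with hD
  have hD0 : 0 ≤ D := by positivity
  obtain ⟨M, hM⟩ := form_self_lower_bound (𝕜 := 𝕜) α q
  set C₁ := 1 / η + √(2 * D / η) with hC1
  set C₂ := 1 + (1 + √R) * √(2 * (1 + |M|)) with hC2
  have hC10 : 0 ≤ C₁ := by positivity
  have hC20 : 0 ≤ C₂ := by positivity
  refine ⟨n, ell, C₁ + C₂, fun V W h => ?_, fun V W h => ?_⟩
  · have e1 : ‖(V : L2Graph 𝕜 N)‖
        ≤ C₁ * (‖W - (l : 𝕜) • (V : L2Graph 𝕜 N)‖ + ‖ell V‖) := by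
      refine le_mul_add_of_sq_le hη0 hD0 (norm_nonneg _) (norm_nonneg _) ?_
      have f1 := re_form_le h l
      rw [form_self, RCLike.ofReal_re] at f1
      have hS : ∀ j, ∑ i : Fin (n + 1),
          ‖primitive (vertexValue V) (edgeDeriv j V) (R / n * (i : ℕ))‖ ^ 2
          ≤ (n + 1) * ‖ell V‖ ^ 2 := by
        intro j
        have : ∀ i ∈ (Finset.univ : Finset (Fin (n + 1))),
            ‖primitive (vertexValue V) (edgeDeriv j V) (R / n * (i : ℕ))‖ ^ 2
            ≤ ‖ell V‖ ^ 2 := fun i _ => by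
          rw [← hellv V (j, i)]
          exact pow_le_pow_left₀ (norm_nonneg _) (norm_le_pi_norm (ell V) (j, i)) 2
        refine (Finset.sum_le_card_nsmul _ _ _ this).trans_eq ?_
        simp
      have f2 : ∀ j, (l + η) * ‖(V : L2Graph 𝕜 N) j‖ ^ 2
          - K * (R * (2 * ((n + 1) * ‖ell V‖ ^ 2) + 2 * (R / n * ‖edgeDeriv j V‖ ^ 2)))
          ≤ ∫ x in Ioi (0 : ℝ), q j x * ‖(V : L2Graph 𝕜 N) j x‖ ^ 2 := by
        intro j
        have g1 := integral_potential_lower_bound (q j) (K := K) (hqR j) (by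
          rw [hK]
          have := Finset.single_le_sum (f := fun j => ‖q j‖) (fun i _ => norm_nonneg (q i))
            (Finset.mem_univ j)
          linarith) ((V : L2Graph 𝕜 N) j)
        have g2 := setIntegral_norm_sq_le (hasWeakDeriv_edgeDeriv j V)
          (hasBoundaryValue_vertexValue j V) hR hn0
        have g3 := mul_le_mul_of_nonneg_left (g2.trans (mul_le_mul_of_nonneg_left
          (add_le_add_left (mul_le_mul_of_nonneg_left (hS j) zero_le_two)
            (2 * (R / n * ‖edgeDeriv j V‖ ^ 2))) hR.le)) hK0
        linarith
      have f3 := Finset.sum_le_sum fun j (_ : j ∈ (Finset.univ : Finset (Fin N))) => f2 j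
      have hV : ‖(V : L2Graph 𝕜 N)‖ ^ 2 = ∑ j, ‖(V : L2Graph 𝕜 N) j‖ ^ 2 :=
        PiLp.norm_sq_eq_of_L2 _ _
      have hdV : ‖graphDeriv V‖ ^ 2 = ∑ j, ‖edgeDeriv j V‖ ^ 2 := PiLp.norm_sq_eq_of_L2 _ _
      have f4 : ∑ j, ((l + η) * ‖(V : L2Graph 𝕜 N) j‖ ^ 2
          - K * (R * (2 * ((n + 1) * ‖ell V‖ ^ 2) + 2 * (R / n * ‖edgeDeriv j V‖ ^ 2))))
          = (l + η) * ‖(V : L2Graph 𝕜 N)‖ ^ 2 - 2 * R * K * (N * (n + 1)) * ‖ell V‖ ^ 2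
            - 2 * K * R ^ 2 / n * ‖graphDeriv V‖ ^ 2 := by
        rw [hV, hdV, Finset.sum_sub_distrib, ← Finset.mul_sum, ← Finset.mul_sum,
          ← Finset.mul_sum, Finset.sum_add_distrib, Finset.sum_const, ← Finset.mul_sum,
          ← Finset.mul_sum, Finset.card_univ, Fintype.card_fin, nsmul_eq_mul]
        ring
      rw [f4] at f3
      have f5 : 2 * K * R ^ 2 / n * ‖graphDeriv V‖ ^ 2 ≤ 1 * ‖graphDeriv V‖ ^ 2 := by
        gcongr
        rw [div_le_one hn']
        exact hn.le
      -- The node with index `0` is the vertex, so `ell` also controls the term with `α`.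
      have f6 : ‖vertexValue V‖ ^ 2 ≤ ‖ell V‖ ^ 2 := by
        have g1 := norm_le_pi_norm (ell V) (0, 0)
        rw [hellv] at g1
        simp only [Fin.val_zero, Nat.cast_zero, mul_zero, primitive_zero] at g1
        exact pow_le_pow_left₀ (norm_nonneg _) g1 2
      have f7 : -(|α| * ‖ell V‖ ^ 2) ≤ α * ‖vertexValue V‖ ^ 2 := by
        have g1 := mul_le_mul_of_nonneg_left f6 (abs_nonneg α)
        nlinarith [neg_abs_le α, sq_nonneg ‖vertexValue V‖]
      rw [hD]
      linarith
    refine e1.trans ?_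
    gcongr
    linarith
  · set s := ‖(V : L2Graph 𝕜 N)‖ + ‖W‖ with hs
    have hs0 : 0 ≤ s := by positivity
    have hVs : ‖(V : L2Graph 𝕜 N)‖ ≤ s := by rw [hs]; linarith [norm_nonneg W]
    -- The boundedness of `ell` in the graph norm comes from a bound on `V'`, obtained from the
    -- semiboundedness of the form and `B(V, V) = (W, V)`.
    have f1 := re_form_le h 0
    rw [zero_mul, zero_add, RCLike.ofReal_zero, zero_smul, sub_zero] at f1
    have f2 := hM V
    have f3 : ‖graphDeriv V‖ ^ 2 ≤ 2 * (1 + |M|) * s ^ 2 := by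
      have g1 : ‖(V : L2Graph 𝕜 N)‖ * ‖W‖ ≤ s ^ 2 := by
        rw [sq]
        have : ‖W‖ ≤ s := by rw [hs]; linarith [norm_nonneg (V : L2Graph 𝕜 N)]
        gcongr
      have g2 : M * ‖(V : L2Graph 𝕜 N)‖ ^ 2 ≤ |M| * s ^ 2 := by
        have := le_abs_self M
        gcongr
      linarith
    have f4 : ‖graphDeriv V‖ ≤ √(2 * (1 + |M|)) * s := by
      refine abs_le_of_sq_le_sq' ?_ (by positivity) |>.2
      rw [mul_pow, Real.sq_sqrt (by positivity)]
      exact f3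
    have f5 : ‖ell V‖ ≤ C₂ * s := by
      refine (pi_norm_le_iff_of_nonneg (by positivity)).2 fun p => ?_
      refine (norm_pointValue_le p.1 (hpt p.2) V).trans ?_
      have hpR : R / n * ((p.2 : Fin (n + 1)) : ℕ) ≤ R := by
        have : (((p.2 : Fin (n + 1)) : ℕ) : ℝ) ≤ n := by
          exact_mod_cast Nat.lt_succ_iff.1 p.2.2
        calc R / n * ((p.2 : Fin (n + 1)) : ℕ) ≤ R / n * n := by gcongr
          _ = R := by field_simp
      have g1 : (1 + √(R / n * ((p.2 : Fin (n + 1)) : ℕ))) * ‖graphDeriv V‖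
          ≤ (1 + √R) * (√(2 * (1 + |M|)) * s) := by gcongr
      rw [hC2]
      linarith
    refine f5.trans ?_
    gcongr
    linarith

/-- Below the limit of the potential, spectral points are isolated and belong to the discrete
spectrum. -/
lemma isolated_and_discrete_of_lt [NeZero N] (α : ℝ) {q : Fin N → ℝ →ᵇ ℝ} {ω l : ℝ}
    (hq : ∀ j, Tendsto (q j) atTop (𝓝 ω)) (hl : l < ω) :
    (∃ ε > 0, ∀ z ∈ UnboundedOp.spectrum (formOperator 𝕜 α q), dist z (l : 𝕜) < ε → z = l) ∧
      ((l : 𝕜) ∈ UnboundedOp.spectrum (formOperator 𝕜 α q) →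
        (l : 𝕜) ∈ UnboundedOp.discreteSpectrum (formOperator 𝕜 α q)) := by
  obtain ⟨m, hm⟩ := exists_mem_resolventSet_formOperator (𝕜 := 𝕜) α q
  obtain ⟨n, ell, C, h1, h2⟩ := exists_peetre_estimate (𝕜 := 𝕜) α hq hl
  have hrep : ∀ v : (formOperator 𝕜 α q).domain,
      Represents α q (domainInclusion α q v) (formOperator 𝕜 α q v) := fun v =>
    formOperator_represents α q v _ (coe_domainInclusion v)
  exact (isSymm_formOperator α q).isolated_and_discrete hm (ell ∘ₗ domainInclusion α q) (C := C)
    (fun v => by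
      have := h1 _ _ (hrep v)
      rwa [coe_domainInclusion] at this)
    (fun v => by
      have := h2 _ _ (hrep v)
      rwa [coe_domainInclusion] at this)

/-! ### Weyl sequences and the essential spectrum -/

/-- The test function `ψ` as an element of `L²(0, ∞)`. -/
def IsTest.toL2 (𝕜 : Type*) [RCLike 𝕜] {ψ : ℝ → ℝ} (h : IsTest ψ) : L2Half 𝕜 :=
  (IsTest.memLp (𝕜 := 𝕜) h.1.continuous h.2.1).toLp _

lemma IsTest.coeFn_toL2 {ψ : ℝ → ℝ} (h : IsTest ψ) :
    h.toL2 𝕜 =ᵐ[halfLine] fun x => (ψ x : 𝕜) := MemLp.coeFn_toLp _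

lemma IsTest.isPrim {ψ : ℝ → ℝ} (h : IsTest ψ) :
    IsPrim (fun x => (ψ x : 𝕜)) (fun x => ((_root_.deriv ψ x : ℝ) : 𝕜)) :=
  IsPrim.of_hasDerivAt (fun x => hasDerivAt_ofReal_comp (h.hasDerivAt x))
    (RCLike.continuous_ofReal.comp h.continuous_deriv)

lemma IsTest.hasWeakDeriv_toL2 {ψ : ℝ → ℝ} (h : IsTest ψ) :
    HasWeakDeriv (h.toL2 𝕜) (h.deriv.toL2 𝕜) :=
  hasWeakDeriv_of_isPrim (h.isPrim.congr_right h.deriv.coeFn_toL2.symm) h.coeFn_toL2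

/-- A test function on the `j`-th edge, as an element of the form domain. -/
def IsTest.toFormDomain (𝕜 : Type*) [RCLike 𝕜] {ψ : ℝ → ℝ} (h : IsTest ψ) (j : Fin N) :
    formDomain 𝕜 N := by
  refine ⟨PiLp.single 2 j (h.toL2 𝕜), fun i => ?_, 0, fun i => ?_⟩
  · by_cases hi : i = j
    · subst hi
      simpa using isTest_mem_H1 h h.coeFn_toL2
    · simp [hi]
  · by_cases hi : i = j
    · subst hi
      simpa using isTest_hasBoundaryValue h h.coeFn_toL2
    · simpa [hi] using hasBoundaryValue_zero

lemma IsTest.coe_toFormDomain {ψ : ℝ → ℝ} (h : IsTest ψ) (j : Fin N) :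
    (h.toFormDomain 𝕜 j : L2Graph 𝕜 N) = PiLp.single 2 j (h.toL2 𝕜) := rfl

lemma IsTest.vertexValue_toFormDomain [NeZero N] {ψ : ℝ → ℝ} (h : IsTest ψ) (j : Fin N) :
    vertexValue (h.toFormDomain 𝕜 j) = 0 :=
  vertexValue_eq (j := j) (by
    rw [h.coe_toFormDomain]
    simpa using isTest_hasBoundaryValue h h.coeFn_toL2)

lemma IsTest.graphDeriv_toFormDomain {ψ : ℝ → ℝ} (h : IsTest ψ) (j : Fin N) :
    graphDeriv (h.toFormDomain 𝕜 j) = PiLp.single 2 j (h.deriv.toL2 𝕜) := by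
  ext1 i
  refine edgeDeriv_eq ?_
  rw [h.coe_toFormDomain]
  by_cases hi : i = j
  · subst hi
    simpa using h.hasWeakDeriv_toL2
  · simpa [hi] using hasWeakDeriv_zero

lemma inner_single_right (Z : L2Graph 𝕜 N) (j : Fin N) (f : L2Half 𝕜) :
    inner 𝕜 Z (PiLp.single 2 j f : L2Graph 𝕜 N) = inner 𝕜 (Z j) f := by
  rw [PiLp.inner_apply, Finset.sum_eq_single j (fun i _ hi => by simp [hi]) (by simp)]
  simp

/-- The operator associated with the form acts on test functions as a Schrödinger operator. -/
lemma represents_test [NeZero N] (α : ℝ) (q : Fin N → ℝ →ᵇ ℝ) {ψ : ℝ → ℝ} (h : IsTest ψ)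
    (j : Fin N) {w : L2Half 𝕜}
    (hw : w =ᵐ[halfLine] fun x => ((- deriv (deriv ψ) x + q j x * ψ x : ℝ) : 𝕜)) :
    Represents α q (h.toFormDomain 𝕜 j) (PiLp.single 2 j w) := by
  intro Z
  rw [form_eq, h.vertexValue_toFormDomain, h.graphDeriv_toFormDomain, zero_mul, mul_zero, add_zero,
    inner_single_right, inner_single_right, graphDeriv_apply]
  set z := (Z : L2Graph 𝕜 N) j with hz
  have hsum : ∑ i, ∫ x in Ioi (0 : ℝ),
      (q i x : 𝕜) * ((h.toFormDomain 𝕜 j : L2Graph 𝕜 N) i x * star ((Z : L2Graph 𝕜 N) i x))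
      = ∫ x in Ioi (0 : ℝ), (q j x : 𝕜) * (h.toL2 𝕜 x * star (z x)) := by
    rw [Finset.sum_eq_single j]
    · rw [h.coe_toFormDomain]
      simp [hz]
    · intro i _ hi
      rw [h.coe_toFormDomain]
      rw [integral_congr_ae (g := fun _ => (0 : 𝕜)), integral_zero]
      have e : (PiLp.single 2 j (h.toL2 𝕜) : L2Graph 𝕜 N) i = 0 := by simp [hi]
      rw [e]
      filter_upwards [Lp.coeFn_zero 𝕜 2 halfLine] with x hx
      rw [hx, Pi.zero_apply, zero_mul, mul_zero]
    · simp
  -- The weak derivative of `z` is tested with `ψ'`, which moves the second derivative onto `ψ`.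
  have hwd := hasWeakDeriv_edgeDeriv j Z _ h.deriv
  have e1 : inner 𝕜 (edgeDeriv j Z) (h.deriv.toL2 𝕜)
      = - ∫ x in Ioi (0 : ℝ), ((deriv (deriv ψ) x : ℝ) : 𝕜) * star (z x) := by
    have e2 := congrArg (starRingEnd 𝕜) hwd
    rw [map_neg, ← integral_conj, ← integral_conj] at e2
    rw [inner_eq_integral, eq_neg_iff_add_eq_zero, add_comm, ← eq_neg_iff_add_eq_zero]
    convert e2 using 1
    · refine integral_congr_ae (Eventually.of_forall fun x => ?_)
      simp only [RCLike.real_smul_eq_coe_mul, map_mul, RCLike.conj_ofReal]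
      rfl
    · congr 1
      refine integral_congr_ae ?_
      filter_upwards [h.deriv.coeFn_toL2 (𝕜 := 𝕜)] with x hx
      simp only [RCLike.real_smul_eq_coe_mul, map_mul, RCLike.conj_ofReal, hx]
      rfl
  have i1 : Integrable (fun x => ((deriv (deriv ψ) x : ℝ) : 𝕜) * star (z x)) halfLine := by
    refine (integrable_mul_star (h.deriv.deriv.toL2 𝕜) z).congr ?_
    filter_upwards [h.deriv.deriv.coeFn_toL2 (𝕜 := 𝕜)] with x hx
    rw [hx]
  have i2 := integrable_mul_mul_star (q j) (h.toL2 𝕜) z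
  rw [hsum, e1, inner_eq_integral, ← integral_neg,
    ← integral_add (f := fun x => -(((deriv (deriv ψ) x : ℝ) : 𝕜) * star (z x))) i1.neg i2]
  refine integral_congr_ae ?_
  filter_upwards [hw, h.coeFn_toL2 (𝕜 := 𝕜)] with x h1 h2
  rw [h1, h2]
  push_cast
  ring

/-- At a resolvent point, the image of a test function `ψ` controls `ψ`. -/
lemma exists_test_bound [NeZero N] {α : ℝ} {q : Fin N → ℝ →ᵇ ℝ} {r : ℝ}
    (hr : (r : 𝕜) ∈ UnboundedOp.resolventSet (formOperator 𝕜 α q)) :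
    ∃ C : ℝ, 0 ≤ C ∧ ∀ ψ : ℝ → ℝ, IsTest ψ → ∫ x in Ioi (0 : ℝ), ψ x ^ 2
      ≤ C * ∫ x in Ioi (0 : ℝ), (- deriv (deriv ψ) x + (q 0 x - r) * ψ x) ^ 2 := by
  obtain ⟨R, -, h2⟩ := hr
  refine ⟨‖R‖ ^ 2, sq_nonneg _, fun ψ hψ => ?_⟩
  have hc : Continuous (fun x => - deriv (deriv ψ) x + q 0 x * ψ x) :=
    hψ.deriv.continuous_deriv.neg.add ((q 0).continuous.mul hψ.1.continuous)
  have hs : HasCompactSupport (fun x => - deriv (deriv ψ) x + q 0 x * ψ x) :=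
    hψ.2.1.deriv.deriv.neg.add hψ.2.1.mul_left
  set w : L2Half 𝕜 := (IsTest.memLp (𝕜 := 𝕜) hc hs).toLp _ with hw
  have hwe : w =ᵐ[halfLine] fun x => ((- deriv (deriv ψ) x + q 0 x * ψ x : ℝ) : 𝕜) :=
    MemLp.coeFn_toLp _
  obtain ⟨hd, he⟩ := exists_formOperator_eq (represents_test (𝕜 := 𝕜) α q hψ 0 hwe)
  have h3 := h2 ⟨_, hd⟩
  rw [he] at h3
  simp only [hψ.coe_toFormDomain] at h3
  have e1 : (PiLp.single 2 0 w : L2Graph 𝕜 N) - (r : 𝕜) • PiLp.single 2 0 (hψ.toL2 𝕜)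
      = PiLp.single 2 0 (w - (r : 𝕜) • hψ.toL2 𝕜) := by
    ext1 i
    by_cases hi : i = 0
    · subst hi; simp
    · simp [hi]
  rw [e1] at h3
  have h4 := R.le_opNorm (PiLp.single 2 0 (w - (r : 𝕜) • hψ.toL2 𝕜))
  rw [h3, PiLp.norm_single, PiLp.norm_single] at h4
  have h5 := pow_le_pow_left₀ (norm_nonneg _) h4 2
  have e2 : ∫ x in Ioi (0 : ℝ), ψ x ^ 2 = ‖hψ.toL2 𝕜‖ ^ 2 := by
    rw [norm_sq_eq_integral]
    refine integral_congr_ae ?_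
    filter_upwards [hψ.coeFn_toL2 (𝕜 := 𝕜)] with x hx
    rw [hx, RCLike.norm_ofReal, sq_abs]
  have e3 : ∫ x in Ioi (0 : ℝ), (- deriv (deriv ψ) x + (q 0 x - r) * ψ x) ^ 2
      = ‖w - (r : 𝕜) • hψ.toL2 𝕜‖ ^ 2 := by
    rw [norm_sq_eq_integral]
    refine integral_congr_ae ?_
    filter_upwards [hψ.coeFn_toL2 (𝕜 := 𝕜), hwe, Lp.coeFn_sub w ((r : 𝕜) • hψ.toL2 𝕜),
      Lp.coeFn_smul (r : 𝕜) (hψ.toL2 𝕜)] with x h1 h2 h3 h4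
    rw [h3, Pi.sub_apply, h4, Pi.smul_apply, h1, h2, smul_eq_mul, ← RCLike.ofReal_mul,
      ← RCLike.ofReal_sub, RCLike.norm_ofReal, sq_abs]
    ring
  rw [e2, e3, ← mul_pow]
  exact h5

/-- Smooth cut-off functions at infinity with small derivatives. -/
lemma exists_cutoff : ∃ D : ℝ, 0 ≤ D ∧ ∀ n : ℕ, 0 < n → ∃ χ : ℝ → ℝ, IsTest χ ∧
    (∀ x ∈ Icc (2 * n : ℝ) (4 * n), χ x = 1) ∧
    (∀ x, x ∉ Icc (n : ℝ) (5 * n) → χ x = 0 ∧ deriv χ x = 0 ∧ deriv (deriv χ) x = 0) ∧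
    ∀ x, |χ x| ≤ 1 ∧ |deriv χ x| ≤ D / n ∧ |deriv (deriv χ) x| ≤ D / n := by
  -- The bump equals one on `[-1, 1]` and is supported in `[-2, 2]`; centred at `3n` and stretched
  -- by `n`, these intervals become `[2n, 4n]` and `[n, 5n]`.
  let b : ContDiffBump (0 : ℝ) := ⟨1, 2, one_pos, one_lt_two⟩
  have hb : ContDiff ℝ (⊤ : ℕ∞) b := b.contDiff
  have hb1 : ContDiff ℝ (⊤ : ℕ∞) (deriv b) := (contDiff_infty_iff_deriv.1 hb).2
  have hb2 : ContDiff ℝ (⊤ : ℕ∞) (deriv (deriv b)) := (contDiff_infty_iff_deriv.1 hb1).2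
  have hs : HasCompactSupport b := b.hasCompactSupport
  obtain ⟨D1, hD1⟩ := hb1.continuous.bounded_above_of_compact_support hs.deriv
  obtain ⟨D2, hD2⟩ := hb2.continuous.bounded_above_of_compact_support hs.deriv.deriv
  refine ⟨|D1| + |D2|, by positivity, fun n hn => ?_⟩
  have hn' : (0 : ℝ) < n := Nat.cast_pos.2 hn
  have hn1 : (1 : ℝ) ≤ n := by exact_mod_cast hn
  have hd0 : ∀ x, HasDerivAt (fun x : ℝ => (x - 3 * n) / n) (1 / n) x := fun x =>
    ((hasDerivAt_id x).sub_const _).div_const _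
  have hd1 : ∀ x, HasDerivAt (fun x => b ((x - 3 * n) / n)) (deriv b ((x - 3 * n) / n) * (1 / n)) x :=
    fun x => ((hb.differentiable (by simp) _).hasDerivAt).comp x (hd0 x)
  have hd2 : ∀ x, HasDerivAt (fun x => deriv b ((x - 3 * n) / n) * (1 / n))
      (deriv (deriv b) ((x - 3 * n) / n) * (1 / n) * (1 / n)) x :=
    fun x => (((hb1.differentiable (by simp) _).hasDerivAt).comp x (hd0 x)).mul_const _
  have e1 : deriv (fun x => b ((x - 3 * n) / n)) = fun x => deriv b ((x - 3 * n) / n) * (1 / n) :=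
    funext fun x => (hd1 x).deriv
  have e2 : deriv (deriv (fun x => b ((x - 3 * n) / n)))
      = fun x => deriv (deriv b) ((x - 3 * n) / n) * (1 / n) * (1 / n) := by
    rw [e1]; exact funext fun x => (hd2 x).deriv
  have hts : tsupport b = Metric.closedBall 0 2 := b.tsupport_eq
  have hz : ∀ x, x ∉ Icc (n : ℝ) (5 * n) → (x - 3 * n) / n ∉ tsupport b := by
    intro x hx h
    rw [hts, Real.closedBall_eq_Icc] at h
    have h1 := h.1
    have h2 := h.2
    rw [le_div_iff₀ hn'] at h1
    rw [div_le_iff₀ hn'] at h2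
    exact hx ⟨by linarith, by linarith⟩
  have hzero : ∀ x, x ∉ Icc (n : ℝ) (5 * n) → b ((x - 3 * n) / n) = 0 := fun x hx =>
    image_eq_zero_of_notMem_tsupport (hz x hx)
  refine ⟨fun x => b ((x - 3 * n) / n), ⟨?_, ?_, ?_⟩, fun x hx => ?_, fun x hx => ⟨hzero x hx, ?_, ?_⟩,
    fun x => ⟨?_, ?_, ?_⟩⟩
  · exact hb.comp ((contDiff_id.sub contDiff_const).div_const _)
  · exact HasCompactSupport.intro' isCompact_Icc isClosed_Icc hzero
  · refine (closure_minimal (fun x hx => ?_) isClosed_Icc : _ ⊆ Icc (n : ℝ) (5 * n)).trans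
      fun x hx => hn'.trans_le hx.1
    by_contra h
    exact hx (hzero x h)
  · refine b.one_of_mem_closedBall ?_
    rw [Real.closedBall_eq_Icc]
    refine ⟨?_, ?_⟩
    · rw [le_div_iff₀ hn']; change (0 - 1) * (n : ℝ) ≤ _; linarith [hx.1]
    · rw [div_le_iff₀ hn']; change _ ≤ (0 + 1) * (n : ℝ); linarith [hx.2]
  · rw [e1]
    simp only
    rw [image_eq_zero_of_notMem_tsupport fun h => hz x hx (tsupport_deriv_subset h), zero_mul]
  · rw [e2]
    simp only
    rw [image_eq_zero_of_notMem_tsupport fun h => hz x hx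
      (tsupport_deriv_subset (tsupport_deriv_subset h)), zero_mul, zero_mul]
  · rw [abs_of_nonneg b.nonneg]; exact b.le_one
  · rw [e1]
    simp only
    rw [abs_mul, abs_of_pos (by positivity : 0 < 1 / (n : ℝ)), mul_one_div]
    have := (hD1 ((x - 3 * n) / n)).trans (le_abs_self D1)
    gcongr
    rw [Real.norm_eq_abs] at this
    linarith [abs_nonneg D2]
  · rw [e2]
    simp only
    rw [abs_mul, abs_mul, abs_of_pos (by positivity : 0 < 1 / (n : ℝ)), mul_one_div]
    have := (hD2 ((x - 3 * n) / n)).trans (le_abs_self D2)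
    rw [Real.norm_eq_abs] at this
    -- The second derivative is of order `1 / n²`; since `n ≥ 1`, the weaker common bound `D / n`
    -- holds.
    have h1 : 1 / (n : ℝ) ≤ 1 := by rw [div_le_one hn']; exact hn1
    calc |deriv (deriv b) ((x - 3 * n) / n)| * (1 / n) / n
        ≤ (|D1| + |D2|) * 1 / n := by
          gcongr
          linarith [abs_nonneg D1]
      _ = _ := by rw [mul_one]

lemma IsTest.mul_smooth {χ u : ℝ → ℝ} (h : IsTest χ) (hu : ContDiff ℝ (⊤ : ℕ∞) u) :
    IsTest (fun x => χ x * u x) :=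
  ⟨h.1.mul hu, h.2.1.mul_right, tsupport_mul_subset_left.trans h.2.2⟩

/-- Action of `-d²/dx² + (Q - r)` on modulated cut-off functions. -/
lemma neg_deriv_deriv_mul {χ u v : ℝ → ℝ} {κ Q r x : ℝ} (h : IsTest χ)
    (hu : ∀ x, HasDerivAt u (κ * v x) x) (hv : ∀ x, HasDerivAt v (-(κ * u x)) x) :
    - deriv (deriv fun x => χ x * u x) x + (Q - r) * (χ x * u x)
      = (- deriv (deriv χ) x + (Q - (r - κ ^ 2)) * χ x) * u x - 2 * κ * deriv χ x * v x := by
  have h1 : deriv (fun x => χ x * u x) = fun x => deriv χ x * u x + χ x * (κ * v x) :=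
    funext fun x => ((h.hasDerivAt x).mul (hu x)).deriv
  have h2 := ((h.deriv.hasDerivAt x).mul (hu x)).add ((h.hasDerivAt x).mul ((hv x).const_mul κ))
  have h3 : deriv (fun x => deriv χ x * u x + χ x * (κ * v x)) x = _ := h2.deriv
  rw [h1, h3]
  ring

/-- Weyl's criterion: everything above the limit of the potential is in the spectrum. -/
lemma mem_spectrum_of_le [NeZero N] (α : ℝ) {q : Fin N → ℝ →ᵇ ℝ} {ω r : ℝ}
    (hq : Tendsto (q 0) atTop (𝓝 ω)) (hr : ω ≤ r) :
    (r : 𝕜) ∈ UnboundedOp.spectrum (formOperator 𝕜 α q) := by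
  intro hres
  obtain ⟨C, hC0, hC⟩ := exists_test_bound hres
  obtain ⟨D, hD0, hcut⟩ := exists_cutoff
  set κ := √(r - ω) with hκ
  have hκ2 : κ ^ 2 = r - ω := Real.sq_sqrt (by linarith)
  -- The contradiction needs `C * (4n * 2δ²) < 2n`; this choice makes the left side `n C / (C + 1)`,
  -- at most `n`.
  set δ := √(1 / (8 * (C + 1))) with hδ
  have hδ0 : 0 < δ := Real.sqrt_pos.2 (by positivity)
  have hδ2 : δ ^ 2 = 1 / (8 * (C + 1)) := Real.sq_sqrt (by positivity)
  obtain ⟨X, hX⟩ : ∃ X : ℝ, ∀ x ≥ X, |q 0 x - ω| ≤ δ / 2 := by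
    obtain ⟨X, hX⟩ := Metric.tendsto_atTop.1 hq (δ / 2) (by positivity)
    exact ⟨X, fun x hx => (hX x hx).le⟩
  obtain ⟨n, hn⟩ := exists_nat_gt (max (max X 1) (max (2 * D / δ) (2 * κ * D / δ)))
  have hnX : X ≤ n := ((le_max_left _ _).trans (le_max_left _ _)).trans hn.le
  have hn1 : (1 : ℝ) ≤ n := ((le_max_right _ _).trans (le_max_left _ _)).trans hn.le
  have hn' : (0 : ℝ) < n := by linarith
  have hnD : D / n ≤ δ / 2 := by
    have := ((le_max_left _ _).trans (le_max_right _ _)).trans hn.le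
    rw [div_le_iff₀ hδ0] at this
    rw [div_le_iff₀ hn']
    linarith
  have hnκ : 2 * κ * (D / n) ≤ δ := by
    have := ((le_max_right _ _).trans (le_max_right _ _)).trans hn.le
    rw [div_le_iff₀ hδ0] at this
    rw [← mul_div_assoc, div_le_iff₀ hn']
    linarith
  have hκ0 : 0 ≤ κ := Real.sqrt_nonneg _
  obtain ⟨χ, hχ, hone, hzero, hbd⟩ := hcut n (Nat.cast_pos.1 hn')
  have dκ : ∀ x, HasDerivAt (fun x => κ * x) κ x := fun x => by
    simpa using (hasDerivAt_id x).const_mul κ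
  have dcos : ∀ x, HasDerivAt (fun x => Real.cos (κ * x)) (κ * -Real.sin (κ * x)) x := fun x =>
    ((Real.hasDerivAt_cos (κ * x)).comp x (dκ x)).congr_deriv (mul_comm _ _)
  have dsin : ∀ x, HasDerivAt (fun x => Real.sin (κ * x)) (κ * Real.cos (κ * x)) x := fun x =>
    ((Real.hasDerivAt_sin (κ * x)).comp x (dκ x)).congr_deriv (mul_comm _ _)
  have dcos' : ∀ x, HasDerivAt (fun x => Real.cos (κ * x)) (-(κ * Real.sin (κ * x))) x :=
    fun x => by simpa using dcos x
  have dsin' : ∀ x, HasDerivAt (fun x => -Real.sin (κ * x)) (-(κ * Real.cos (κ * x))) x :=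
    fun x => (dsin x).neg
  have t1 : IsTest (fun x => χ x * Real.cos (κ * x)) :=
    hχ.mul_smooth (Real.contDiff_cos.comp (contDiff_const.mul contDiff_id))
  have t2 : IsTest (fun x => χ x * Real.sin (κ * x)) :=
    hχ.mul_smooth (Real.contDiff_sin.comp (contDiff_const.mul contDiff_id))
  -- Adding the squares for the real modulations `cos` and `sin` removes the oscillation through
  -- `cos² + sin² = 1`. What is left depends on the cut-off only, and real test functions suffice
  -- over either field.
  set E : ℝ → ℝ := fun x => (- deriv (deriv χ) x + (q 0 x - ω) * χ x) ^ 2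
    + (2 * κ * deriv χ x) ^ 2 with hE
  have isq : ∀ {ψ : ℝ → ℝ}, IsTest ψ → Integrable (fun x => ψ x ^ 2) halfLine := fun {ψ} h => by
    have hc : HasCompactSupport (fun x => ψ x ^ 2) := by
      simp only [sq]
      exact h.2.1.mul_left
    exact ((h.1.continuous.pow 2).integrable_of_hasCompactSupport hc).restrict
  have iex : ∀ {ψ : ℝ → ℝ}, IsTest ψ →
      Integrable (fun x => (- deriv (deriv ψ) x + (q 0 x - r) * ψ x) ^ 2) halfLine :=
    fun {ψ} h => by
      have hc : Continuous (fun x => - deriv (deriv ψ) x + (q 0 x - r) * ψ x) :=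
        h.deriv.continuous_deriv.neg.add (((q 0).continuous.sub continuous_const).mul h.1.continuous)
      have hs : HasCompactSupport (fun x => - deriv (deriv ψ) x + (q 0 x - r) * ψ x) :=
        h.2.1.deriv.deriv.neg.add h.2.1.mul_left
      have hs2 : HasCompactSupport (fun x => (- deriv (deriv ψ) x + (q 0 x - r) * ψ x) ^ 2) := by
        simp only [sq]
        exact hs.mul_left
      exact ((hc.pow 2).integrable_of_hasCompactSupport hs2).restrict
  have hsum : ∫ x in Ioi (0 : ℝ), χ x ^ 2 ≤ C * ∫ x in Ioi (0 : ℝ), E x := by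
    have b1 := hC _ t1
    have b2 := hC _ t2
    have l1 : ∫ x in Ioi (0 : ℝ), χ x ^ 2 = (∫ x in Ioi (0 : ℝ), (χ x * Real.cos (κ * x)) ^ 2)
        + ∫ x in Ioi (0 : ℝ), (χ x * Real.sin (κ * x)) ^ 2 := by
      rw [← integral_add (isq t1) (isq t2)]
      refine integral_congr_ae (Eventually.of_forall fun x => ?_)
      simp only
      rw [mul_pow, mul_pow, ← mul_add, Real.cos_sq_add_sin_sq, mul_one]
    have l2 : ∫ x in Ioi (0 : ℝ), E x
        = (∫ x in Ioi (0 : ℝ), (- deriv (deriv fun x => χ x * Real.cos (κ * x)) x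
            + (q 0 x - r) * (χ x * Real.cos (κ * x))) ^ 2)
          + ∫ x in Ioi (0 : ℝ), (- deriv (deriv fun x => χ x * Real.sin (κ * x)) x
            + (q 0 x - r) * (χ x * Real.sin (κ * x))) ^ 2 := by
      rw [← integral_add (iex t1) (iex t2)]
      refine integral_congr_ae (Eventually.of_forall fun x => ?_)
      simp only [hE]
      rw [neg_deriv_deriv_mul hχ dcos dsin', neg_deriv_deriv_mul hχ dsin dcos', hκ2, sub_sub_cancel]
      have := Real.cos_sq_add_sin_sq (κ * x)
      linear_combination (-((- deriv (deriv χ) x + (q 0 x - ω) * χ x) ^ 2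
        + (2 * κ * deriv χ x) ^ 2)) * this
    rw [l1, l2, mul_add]
    exact add_le_add b1 b2
  have lower : 2 * (n : ℝ) ≤ ∫ x in Ioi (0 : ℝ), χ x ^ 2 := by
    have hsub : Icc (2 * n : ℝ) (4 * n) ⊆ Ioi 0 := fun x hx =>
      lt_of_lt_of_le (by positivity : (0 : ℝ) < 2 * n) hx.1
    have h1 := setIntegral_le_integral (s := Icc (2 * n : ℝ) (4 * n)) (isq hχ)
      (Eventually.of_forall fun x => sq_nonneg (χ x))
    refine le_trans (le_of_eq ?_) h1
    have h2 : EqOn (fun x => χ x ^ 2) (fun _ => (1 : ℝ)) (Icc (2 * n : ℝ) (4 * n)) := by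
      intro x hx
      change χ x ^ 2 = 1
      rw [hone x hx, one_pow]
    rw [Measure.restrict_restrict_of_subset hsub, setIntegral_congr_fun measurableSet_Icc h2,
      setIntegral_const, measureReal_def,
      Real.volume_Icc, ENNReal.toReal_ofReal (by linarith), smul_eq_mul]
    ring
  have hEle : ∀ x, E x ≤ (Icc (n : ℝ) (5 * n)).indicator (fun _ => 2 * δ ^ 2) x := by
    intro x
    by_cases hx : x ∈ Icc (n : ℝ) (5 * n)
    · rw [indicator_of_mem hx]
      obtain ⟨g0, g1, g2⟩ := hbd x
      have g3 := hX x (hnX.trans hx.1)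
      have g4 : |- deriv (deriv χ) x + (q 0 x - ω) * χ x| ≤ δ := by
        refine (abs_add_le _ _).trans ?_
        rw [abs_neg, abs_mul]
        have : |q 0 x - ω| * |χ x| ≤ δ / 2 * 1 := by gcongr
        linarith
      have g5 : |2 * κ * deriv χ x| ≤ δ := by
        rw [abs_mul, abs_of_nonneg (by positivity : 0 ≤ 2 * κ)]
        exact (mul_le_mul_of_nonneg_left g1 (by positivity)).trans hnκ
      have g6 := pow_le_pow_left₀ (abs_nonneg _) g4 2
      have g7 := pow_le_pow_left₀ (abs_nonneg _) g5 2
      rw [sq_abs] at g6 g7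
      simp only [hE]
      linarith
    · rw [indicator_of_notMem hx]
      obtain ⟨g0, g1, g2⟩ := hzero x hx
      simp [hE, g0, g1, g2]
  have upper : ∫ x in Ioi (0 : ℝ), E x ≤ 4 * n * (2 * δ ^ 2) := by
    have h0 : ∀ x, 0 ≤ E x := fun x => by simp only [hE]; positivity
    have hi : IntegrableOn (fun _ : ℝ => 2 * δ ^ 2) (Icc (n : ℝ) (5 * n)) :=
      continuous_const.integrableOn_Icc
    have h1 := integral_mono_of_nonneg (μ := halfLine) (Eventually.of_forall h0)
      ((integrable_indicator_iff measurableSet_Icc).2 hi).restrict (Eventually.of_forall hEle)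
    have hsub : Icc (n : ℝ) (5 * n) ⊆ Ioi 0 := fun x hx => lt_of_lt_of_le hn' hx.1
    rw [integral_indicator measurableSet_Icc, Measure.restrict_restrict_of_subset hsub,
      setIntegral_const, measureReal_def, Real.volume_Icc, ENNReal.toReal_ofReal (by linarith),
      smul_eq_mul] at h1
    refine h1.trans_eq ?_
    ring
  have fin := lower.trans (hsum.trans (mul_le_mul_of_nonneg_left upper hC0))
  rw [hδ2] at fin
  have h8 : C * (4 * n * (2 * (1 / (8 * (C + 1))))) = n * (C / (C + 1)) := by
    field_simp
    ring
  have h9 : C / (C + 1) ≤ 1 := by rw [div_le_one (by positivity)]; linarith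
  rw [h8] at fin
  nlinarith

/-- The essential spectrum of the form operator, for potentials with limit `ω` at infinity. -/
theorem essentialSpectrum_formOperator [NeZero N] (α : ℝ) {q : Fin N → ℝ →ᵇ ℝ} {ω : ℝ}
    (hq : ∀ j, Tendsto (q j) atTop (𝓝 ω)) :
    UnboundedOp.essentialSpectrum (formOperator 𝕜 α q) = (fun l : ℝ => (l : 𝕜)) '' Ici ω := by
  ext z
  constructor
  · rintro ⟨hz, hd⟩
    obtain ⟨m, hm⟩ := exists_mem_resolventSet_formOperator (𝕜 := 𝕜) α q
    have him : RCLike.im z = 0 := by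
      by_contra h
      exact hz ((isSymm_formOperator α q).mem_resolventSet_of_im_ne_zero hm h)
    have hre : ((RCLike.re z : ℝ) : 𝕜) = z := by
      rw [← RCLike.re_add_im z, him]; simp
    refine ⟨RCLike.re z, ?_, hre⟩
    by_contra hlt
    have := (isolated_and_discrete_of_lt (𝕜 := 𝕜) α hq (not_le.1 hlt)).2
    rw [hre] at this
    exact hd (this hz)
  · rintro ⟨r, hr, rfl⟩
    have hr' : ω ≤ r := hr
    refine ⟨mem_spectrum_of_le α (hq 0) hr', fun hd => ?_⟩
    -- The point `r + ε / 2` is also in the spectrum, so `r` is not isolated.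
    obtain ⟨-, ⟨ε, hε, hiso⟩, -⟩ := hd
    have h1 := hiso ((r + ε / 2 : ℝ) : 𝕜) (mem_spectrum_of_le α (hq 0) (by linarith)) (by
      rw [dist_eq_norm, ← RCLike.ofReal_sub, RCLike.norm_ofReal, add_sub_cancel_left,
        abs_of_pos (by positivity)]
      linarith)
    have h2 := RCLike.ofReal_injective h1
    linarith

/-- The positive part of the spectrum of the form operator is bounded away from zero. -/
lemma exists_spectral_gap [NeZero N] (α : ℝ) {q : Fin N → ℝ →ᵇ ℝ} {ω : ℝ} (hω : 0 < ω)
    (hq : ∀ j, Tendsto (q j) atTop (𝓝 ω)) : ∃ δ : ℝ, 0 < δ ∧ ∀ l : ℝ, 0 < l →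
      (l : 𝕜) ∈ UnboundedOp.spectrum (formOperator 𝕜 α q) → δ ≤ l := by
  -- Zero lies below `ω`, so a punctured neighbourhood of it is free of spectrum, whether or not
  -- zero is itself spectral.
  obtain ⟨⟨ε, hε, hiso⟩, -⟩ := isolated_and_discrete_of_lt (𝕜 := 𝕜) α hq hω
  refine ⟨ε, hε, fun l hl hs => ?_⟩
  by_contra h
  have h1 := hiso _ hs (by
    rw [dist_eq_norm, ← RCLike.ofReal_sub, RCLike.norm_ofReal, sub_zero, abs_of_pos hl]
    exact not_le.1 h)
  exact hl.ne' (RCLike.ofReal_injective h1)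

/-! ### The profile: differential equations and decay -/

/-- The argument of the hyperbolic functions in the profile on the `j`-th edge. -/
def phase (k : ℕ) (p α ω : ℝ) (j : Fin N) (x : ℝ) : ℝ :=
  (p - 1) * √ω / 2 * x + if (j : ℕ) < k then - shift N k α ω else shift N k α ω

/-- The logarithmic derivative of the profile. -/
def slope (k : ℕ) (p α ω : ℝ) (j : Fin N) (x : ℝ) : ℝ :=
  -(√ω * Real.tanh (phase k p α ω j x))

lemma one_div_cosh_sq (y : ℝ) : (1 / Real.cosh y) ^ 2 = 1 - Real.tanh y ^ 2 := by
  have h := (Real.cosh_pos y).ne'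
  rw [Real.tanh_eq_sinh_div_cosh]
  field_simp
  linarith [Real.cosh_sq y]

lemma hasDerivAt_phase (k : ℕ) (p α ω : ℝ) (j : Fin N) (x : ℝ) :
    HasDerivAt (phase k p α ω j) ((p - 1) * √ω / 2) x := by
  unfold phase
  simpa using ((hasDerivAt_id x).const_mul ((p - 1) * √ω / 2)).add_const
    (if (j : ℕ) < k then - shift N k α ω else shift N k α ω)

lemma hasDerivAt_tanh (y : ℝ) : HasDerivAt Real.tanh (1 - Real.tanh y ^ 2) y := by
  have h := (Real.cosh_pos y).ne'
  have := (Real.hasDerivAt_sinh y).div (Real.hasDerivAt_cosh y) h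
  have e : Real.tanh = Real.sinh / Real.cosh := by
    ext z; rw [Real.tanh_eq_sinh_div_cosh]; rfl
  rw [e]
  refine this.congr_deriv ?_
  simp only [Pi.div_apply]
  field_simp

lemma profile_pos {k : ℕ} {p ω : ℝ} (hp : 1 < p) (hω : 0 < ω) (α : ℝ) (j : Fin N) (x : ℝ) :
    0 < profile k p α ω j x := by
  have h0 : 0 < (p + 1) * ω / 2 := by nlinarith
  have := Real.cosh_pos ((p - 1) * √ω / 2 * x
        + if (j : ℕ) < k then - shift N k α ω else shift N k α ω)
  unfold profile
  positivity

lemma profile_rpow' {k : ℕ} {p ω : ℝ} (hp : 1 < p) (hω : 0 < ω) (α : ℝ) (j : Fin N) (x : ℝ) :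
    profile k p α ω j x ^ (p - 1)
      = (p + 1) * ω / 2 * (1 - Real.tanh (phase k p α ω j x) ^ 2) := by
  rw [profile_rpow hp hω, ← one_div_cosh_sq]
  rfl

lemma profile_eq_rpow {k : ℕ} {p ω : ℝ} (α : ℝ) (j : Fin N) (x : ℝ) :
    profile k p α ω j x
      = ((p + 1) * ω / 2 * (1 - Real.tanh (phase k p α ω j x) ^ 2)) ^ (1 / (p - 1)) := by
  rw [← one_div_cosh_sq]
  rfl

/-- The Riccati form of `φ'' = (ω - φ^(p-1)) φ`, from `tanh' = 1 - tanh²` and `φ^(p-1) = (p+1) ω / 2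
* (1 - tanh²)`. -/
lemma hasDerivAt_slope {k : ℕ} {p ω : ℝ} (hp : 1 < p) (hω : 0 < ω) (α : ℝ) (j : Fin N) (x : ℝ) :
    HasDerivAt (slope k p α ω j)
      (ω - profile k p α ω j x ^ (p - 1) - slope k p α ω j x ^ 2) x := by
  have h := (((hasDerivAt_tanh _).comp x (hasDerivAt_phase k p α ω j x)).const_mul √ω).neg
  refine h.congr_deriv ?_
  rw [profile_rpow' hp hω, slope, neg_sq, mul_pow, Real.sq_sqrt hω.le]
  have := Real.mul_self_sqrt hω.le
  linear_combination (-(1 - Real.tanh (phase k p α ω j x) ^ 2) * (p - 1) / 2) * this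

lemma hasDerivAt_profile {k : ℕ} {p ω : ℝ} (hp : 1 < p) (hω : 0 < ω) (α : ℝ) (j : Fin N)
    (x : ℝ) :
    HasDerivAt (profile k p α ω j) (slope k p α ω j x * profile k p α ω j x) x := by
  have hA : 0 < (p + 1) * ω / 2 := by nlinarith
  set y := phase k p α ω j x with hy
  have hT : 0 < 1 - Real.tanh y ^ 2 := by
    rw [← one_div_cosh_sq]
    have := Real.cosh_pos y
    positivity
  have h1 : HasDerivAt (fun x => (p + 1) * ω / 2 * (1 - Real.tanh (phase k p α ω j x) ^ 2))
      ((p + 1) * ω / 2 * (-(2 * Real.tanh y * ((1 - Real.tanh y ^ 2) * ((p - 1) * √ω / 2))))) x := by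
    have := ((((hasDerivAt_tanh _).comp x (hasDerivAt_phase k p α ω j x)).pow 2).const_sub 1
      ).const_mul ((p + 1) * ω / 2)
    refine this.congr_deriv ?_
    simp [hy]
  have h2 := h1.rpow_const (p := 1 / (p - 1)) (Or.inl (mul_pos hA hT).ne')
  have e : profile k p α ω j = fun x =>
      ((p + 1) * ω / 2 * (1 - Real.tanh (phase k p α ω j x) ^ 2)) ^ (1 / (p - 1)) :=
    funext fun x => profile_eq_rpow α j x
  rw [e]
  refine h2.congr_deriv ?_
  simp only [← hy]
  rw [Real.rpow_sub (mul_pos hA hT), Real.rpow_one, slope, ← hy]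
  have hp' : p - 1 ≠ 0 := by linarith
  field_simp

lemma hasDerivAt_profile_rpow {k : ℕ} {p ω : ℝ} (hp : 1 < p) (hω : 0 < ω) (α : ℝ) (j : Fin N)
    (x : ℝ) :
    HasDerivAt (fun x => profile k p α ω j x ^ (p - 1))
      ((p - 1) * slope k p α ω j x * profile k p α ω j x ^ (p - 1)) x := by
  have hφ := profile_pos (k := k) hp hω α j x
  refine ((hasDerivAt_profile hp hω α j x).rpow_const (p := p - 1) (Or.inl hφ.ne')).congr_deriv ?_
  rw [Real.rpow_sub hφ, Real.rpow_one]
  field_simp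

lemma continuous_profile {k : ℕ} {p ω : ℝ} (hp : 1 < p) (hω : 0 < ω) (α : ℝ) (j : Fin N) :
    Continuous (profile k p α ω j) :=
  continuous_iff_continuousAt.2 fun x => (hasDerivAt_profile hp hω α j x).continuousAt

lemma continuous_slope {k : ℕ} {p ω : ℝ} (hp : 1 < p) (hω : 0 < ω) (α : ℝ) (j : Fin N) :
    Continuous (slope k p α ω j) :=
  continuous_iff_continuousAt.2 fun x => (hasDerivAt_slope hp hω α j x).continuousAt

lemma abs_slope_le (k : ℕ) (p α ω : ℝ) (j : Fin N) (x : ℝ) : |slope k p α ω j x| ≤ √ω := by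
  rw [slope, abs_neg, abs_mul, abs_of_nonneg (Real.sqrt_nonneg _)]
  have : |Real.tanh (phase k p α ω j x)| ≤ 1 := (Real.abs_tanh_lt_one _).le
  nlinarith [Real.sqrt_nonneg ω]

/-- From `sech y ≤ 2 exp (-y)`: the square, taken at slope `(p - 1) √ω / 2`, decays at the rate `(p
- 1) √ω`. -/
lemma exists_profile_rpow_le {k : ℕ} {p ω : ℝ} (hp : 1 < p) (hω : 0 < ω) (α : ℝ) (j : Fin N) :
    ∃ C, 0 < C ∧ ∀ x,
      profile k p α ω j x ^ (p - 1) ≤ C * Real.exp (-√ω * x) ^ (p - 1) := by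
  have hA : 0 < (p + 1) * ω / 2 := by nlinarith
  set s := if (j : ℕ) < k then - shift N k α ω else shift N k α ω with hs
  refine ⟨(p + 1) * ω / 2 * (2 * Real.exp (-s)) ^ 2, by positivity, fun x => ?_⟩
  rw [profile_rpow hp hω, ← hs, mul_assoc]
  refine mul_le_mul_of_nonneg_left ?_ hA.le
  set y := (p - 1) * √ω / 2 * x + s with hy
  have h1 : 1 / Real.cosh y ≤ 2 * Real.exp (-y) := by
    rw [div_le_iff₀ (Real.cosh_pos y), Real.cosh_eq]
    have := Real.exp_pos (-y)
    have e : Real.exp (-y) * Real.exp y = 1 := by rw [← Real.exp_add]; simp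
    nlinarith
  have h2 : 0 ≤ 1 / Real.cosh y := by have := Real.cosh_pos y; positivity
  refine (pow_le_pow_left₀ h2 h1 2).trans_eq ?_
  rw [mul_pow, mul_pow, mul_assoc, ← Real.exp_mul, ← Real.exp_nat_mul, ← Real.exp_nat_mul,
    ← Real.exp_add]
  congr 2
  rw [hy]; push_cast; ring

lemma exists_profile_le {k : ℕ} {p ω : ℝ} (hp : 1 < p) (hω : 0 < ω) (α : ℝ) (j : Fin N) :
    ∃ C, 0 < C ∧ ∀ x, profile k p α ω j x ≤ C * Real.exp (-√ω * x) := by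
  obtain ⟨C, hC, h⟩ := exists_profile_rpow_le (k := k) hp hω α j
  have hp' : p - 1 ≠ 0 := by linarith
  refine ⟨C ^ (1 / (p - 1)), by positivity, fun x => ?_⟩
  have h1 := Real.rpow_le_rpow (Real.rpow_nonneg (profile_pos hp hω α j x).le _) (h x)
    (z := 1 / (p - 1)) (by have : 0 < p - 1 := by linarith
                           positivity)
  rw [Real.mul_rpow hC.le (by positivity), ← Real.rpow_mul (profile_pos hp hω α j x).le,
    ← Real.rpow_mul (Real.exp_pos _).le, mul_one_div_cancel hp', Real.rpow_one, Real.rpow_one] at h1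
  exact h1

lemma memLp_profile {k : ℕ} {p ω : ℝ} (hp : 1 < p) (hω : 0 < ω) (α : ℝ) (j : Fin N) :
    MemLp (profile k p α ω j) 2 halfLine := by
  obtain ⟨C, hC, h⟩ := exists_profile_le (k := k) hp hω α j
  have h1 : MemLp (fun x => C * Real.exp (-√ω * x)) 2 halfLine := by
    rw [memLp_two_iff_integrable_sq (by fun_prop)]
    have := (exp_neg_integrableOn_Ioi 0 (b := 2 * √ω) (by positivity)).const_mul (C ^ 2)
    refine this.congr (Eventually.of_forall fun x => ?_)
    simp only
    rw [mul_pow, ← Real.exp_nat_mul]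
    congr 2; push_cast; ring
  refine h1.of_le (continuous_profile hp hω α j).aestronglyMeasurable
    (Eventually.of_forall fun x => ?_)
  rw [Real.norm_of_nonneg (profile_pos hp hω α j x).le, Real.norm_of_nonneg (by positivity)]
  exact h x

lemma tendsto_potential {k : ℕ} {p ω : ℝ} (hp : 1 < p) (hω : 0 < ω) (α c : ℝ) (j : Fin N) :
    Tendsto (potential k hp hω α c j) atTop (𝓝 ω) := by
  obtain ⟨C, hC, h⟩ := exists_profile_rpow_le (k := k) hp hω α j
  have h1 : Tendsto (fun x => C * Real.exp (-√ω * x) ^ (p - 1)) atTop (𝓝 0) := by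
    have h2 : Tendsto (fun x : ℝ => Real.exp (-((p - 1) * √ω * x))) atTop (𝓝 0) := by
      refine Real.tendsto_exp_neg_atTop_nhds_zero.comp (tendsto_id.const_mul_atTop ?_)
      have : 0 < p - 1 := by linarith
      positivity
    have h3 := h2.const_mul C
    rw [mul_zero] at h3
    refine h3.congr fun x => ?_
    rw [← Real.exp_mul]
    congr 2; ring
  have h4 := squeeze_zero (fun x => Real.rpow_nonneg (profile_pos (k := k) hp hω α j x).le _) h h1
  have h5 := (h4.const_mul c).const_sub ω
  rw [mul_zero, sub_zero] at h5
  exact h5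

/-! ### Ground state representation, Wronskians and uniqueness on the edges -/

lemma mem_kernel_formOperator [NeZero N] {α : ℝ} {q : Fin N → ℝ →ᵇ ℝ} {V : L2Graph 𝕜 N} :
    V ∈ UnboundedOp.kernel (formOperator 𝕜 α q) ↔
      ∃ V' : formDomain 𝕜 N, (V' : L2Graph 𝕜 N) = V ∧ Represents α q V' 0 := by
  rw [UnboundedOp.kernel, UnboundedOp.mem_eigenspace]
  constructor
  · rintro ⟨h, hV⟩
    obtain ⟨V', h1, h2⟩ := exists_formDomain_of_domain ⟨V, h⟩
    rw [hV, zero_smul] at h2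
    exact ⟨V', h1, h2⟩
  · rintro ⟨V', rfl, h⟩
    obtain ⟨hV, e⟩ := exists_formOperator_eq h
    exact ⟨hV, by rw [e, zero_smul]⟩

lemma memLp_mul (q : ℝ →ᵇ ℝ) (f : L2Half 𝕜) : MemLp (fun x => (q x : 𝕜) * f x) 2 halfLine := by
  refine (Lp.memLp f).of_le_mul (c := ‖q‖) ?_ (Eventually.of_forall fun x => ?_)
  · exact (RCLike.continuous_ofReal.comp q.continuous).aestronglyMeasurable.mul
      (Lp.aestronglyMeasurable f)
  · rw [norm_mul, RCLike.norm_ofReal]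
    exact mul_le_mul_of_nonneg_right (q.norm_coe_le_norm x) (norm_nonneg _)

/-- Ground state representation: the form of a potential `h' + h²` is a sum of squares. -/
lemma form_eq_of_riccati [NeZero N] {α : ℝ} {q h : Fin N → ℝ →ᵇ ℝ}
    (hh : ∀ j x, HasDerivAt (h j) (q j x - h j x ^ 2) x) (hs : ∑ j, h j 0 = α)
    (V Z : formDomain 𝕜 N) :
    form α q V Z = ∑ j, ∫ x in Ioi (0 : ℝ),
      (edgeDeriv j V x - (h j x : 𝕜) * (V : L2Graph 𝕜 N) j x)
        * star (edgeDeriv j Z x - (h j x : 𝕜) * (Z : L2Graph 𝕜 N) j x) := by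
  have key : ∀ j, ∫ x in Ioi (0 : ℝ),
      (edgeDeriv j V x - (h j x : 𝕜) * (V : L2Graph 𝕜 N) j x)
        * star (edgeDeriv j Z x - (h j x : 𝕜) * (Z : L2Graph 𝕜 N) j x)
      = (∫ x in Ioi (0 : ℝ), (edgeDeriv j V x * star (edgeDeriv j Z x)
        + (q j x : 𝕜) * ((V : L2Graph 𝕜 N) j x * star ((Z : L2Graph 𝕜 N) j x))))
        + (h j 0 : 𝕜) * (vertexValue V * star (vertexValue Z)) := by
    intro j
    -- With weight `h j`, whose derivative is `q j - (h j)²`: the cross term `-h (v z̄)'` becomes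
    -- `(q - h²) v z̄` plus the boundary term `h(0) v(0) z̄(0)`.
    have hb := integral_by_parts (hasWeakDeriv_edgeDeriv j V) (hasBoundaryValue_vertexValue j V)
      (hasWeakDeriv_edgeDeriv j Z) (hasBoundaryValue_vertexValue j Z) (hh j)
      (((q j).continuous).sub ((h j).continuous.pow 2)) (C := max ‖h j‖ ‖q j - h j * h j‖)
      (fun x => ((h j).norm_coe_le_norm x).trans (le_max_left _ _))
      (fun x => by
        refine le_trans ?_ (le_max_right _ _)
        have := (q j - h j * h j).norm_coe_le_norm x
        rwa [BoundedContinuousFunction.sub_apply, BoundedContinuousFunction.mul_apply, ← sq] at this)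
    rw [← neg_neg ((h j 0 : 𝕜) * _), ← hb, ← sub_eq_add_neg, ← integral_sub]
    · refine integral_congr_ae (Eventually.of_forall fun x => ?_)
      simp only [RCLike.star_def, map_sub, map_mul, RCLike.conj_ofReal]
      push_cast
      ring
    · exact integrable_form_term _ _ _ _ _
    · have i := (integrable_mul_mul_star (q j - h j * h j) ((V : L2Graph 𝕜 N) j)
        ((Z : L2Graph 𝕜 N) j)).add ((integrable_mul_mul_star (h j) (edgeDeriv j V)
        ((Z : L2Graph 𝕜 N) j)).add (integrable_mul_mul_star (h j) ((V : L2Graph 𝕜 N) j)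
        (edgeDeriv j Z)))
      refine i.congr (Eventually.of_forall fun x => ?_)
      simp only [Pi.add_apply, BoundedContinuousFunction.sub_apply,
        BoundedContinuousFunction.mul_apply]
      push_cast
      ring
  rw [Finset.sum_congr rfl fun j _ => key j, Finset.sum_add_distrib, ← Finset.sum_mul,
    ← RCLike.ofReal_sum, hs]
  rfl

/-- The quadratic form version of the ground state representation. -/
lemma form_self_eq_of_riccati [NeZero N] {α : ℝ} {q h : Fin N → ℝ →ᵇ ℝ}
    (hh : ∀ j x, HasDerivAt (h j) (q j x - h j x ^ 2) x) (hs : ∑ j, h j 0 = α)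
    (V : formDomain 𝕜 N) :
    form α q V V = ((∑ j, ‖edgeDeriv j V - (memLp_mul (h j) ((V : L2Graph 𝕜 N) j)).toLp _‖ ^ 2
      : ℝ) : 𝕜) := by
  rw [form_eq_of_riccati hh hs, RCLike.ofReal_sum]
  refine Finset.sum_congr rfl fun j _ => ?_
  rw [RCLike.ofReal_pow, ← inner_self_eq_norm_sq_to_K, inner_eq_integral]
  refine integral_congr_ae ?_
  filter_upwards [Lp.coeFn_sub (edgeDeriv j V) ((memLp_mul (h j) ((V : L2Graph 𝕜 N) j)).toLp _),
    (memLp_mul (h j) ((V : L2Graph 𝕜 N) j)).coeFn_toLp] with x h1 h2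
  rw [h1, Pi.sub_apply, h2]

lemma nonneg_of_riccati [NeZero N] {α : ℝ} {q h : Fin N → ℝ →ᵇ ℝ}
    (hh : ∀ j x, HasDerivAt (h j) (q j x - h j x ^ 2) x) (hs : ∑ j, h j 0 = α) :
    UnboundedOp.Nonneg (formOperator 𝕜 α q) := fun v => by
  obtain ⟨V, hV, hR⟩ := exists_formDomain_of_domain v
  rw [← hV, ← hR V, form_self_eq_of_riccati hh hs, RCLike.ofReal_re]
  exact Finset.sum_nonneg fun j _ => sq_nonneg _

lemma edgeDeriv_ae_eq_of_represents_zero [NeZero N] {α : ℝ} {q h : Fin N → ℝ →ᵇ ℝ}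
    (hh : ∀ j x, HasDerivAt (h j) (q j x - h j x ^ 2) x) (hs : ∑ j, h j 0 = α)
    {V : formDomain 𝕜 N} (hV : Represents α q V 0) (j : Fin N) :
    edgeDeriv j V =ᵐ[halfLine] fun x => (h j x : 𝕜) * (V : L2Graph 𝕜 N) j x := by
  have h0 := hV V
  rw [form_self_eq_of_riccati hh hs, inner_zero_right, RCLike.ofReal_eq_zero,
    Finset.sum_eq_zero_iff_of_nonneg fun j _ => sq_nonneg _] at h0
  have h1 := h0 j (Finset.mem_univ _)
  rw [sq_eq_zero_iff, norm_eq_zero, sub_eq_zero] at h1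
  rw [h1]
  exact (memLp_mul (h j) ((V : L2Graph 𝕜 N) j)).coeFn_toLp

lemma represents_zero_of_edgeDeriv [NeZero N] {α : ℝ} {q h : Fin N → ℝ →ᵇ ℝ}
    (hh : ∀ j x, HasDerivAt (h j) (q j x - h j x ^ 2) x) (hs : ∑ j, h j 0 = α)
    {V : formDomain 𝕜 N} (hV : ∀ j, edgeDeriv j V =ᵐ[halfLine]
      fun x => (h j x : 𝕜) * (V : L2Graph 𝕜 N) j x) : Represents α q V 0 := fun Z => by
  rw [form_eq_of_riccati hh hs, inner_zero_right]
  refine Finset.sum_eq_zero fun j _ => ?_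
  rw [integral_congr_ae (g := fun _ => (0 : 𝕜)), integral_zero]
  filter_upwards [hV j] with x hx
  rw [hx, sub_self, zero_mul]

lemma IsPrim.eq_of_ae_eq_zero {P p : ℝ → 𝕜} (h : IsPrim P p) (hp : p =ᵐ[halfLine] 0) {x : ℝ}
    (hx : 0 ≤ x) : P x = P 0 := by
  have h0 := ((h.congr_right hp) x hx).2
  simpa using h0

/-- On the half-line, the solutions of `v' = (u'/u) v` are the multiples of `u`. -/
lemma ae_eq_of_weakDeriv_eq {f g : L2Half 𝕜} {c : 𝕜} (hf : HasWeakDeriv f g)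
    (bf : HasBoundaryValue f c) {u h : ℝ → ℝ} (hu : ∀ x, HasDerivAt u (h x * u x) x)
    (hh : Continuous h) (u0 : ∀ x, u x ≠ 0)
    (hg : g =ᵐ[halfLine] fun x => (h x : 𝕜) * f x) :
    f =ᵐ[halfLine] fun x => (c / (u 0 : 𝕜)) * (u x : 𝕜) := by
  have ef := hf.ae_eq_primitive bf
  have hu' (x : ℝ) : (u x : 𝕜) ≠ 0 := by exact_mod_cast u0 x
  have huc : Continuous u := continuous_iff_continuousAt.2 fun x => (hu x).continuousAt
  have pr : IsPrim (fun x => ((u x)⁻¹ : 𝕜)) (fun x => -(h x : 𝕜) * (u x : 𝕜)⁻¹) := by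
    refine IsPrim.of_hasDerivAt (fun x => ?_) ?_
    · have := hasDerivAt_ofReal_comp (𝕜 := 𝕜) ((hu x).inv (u0 x))
      refine (this.congr_deriv ?_).congr_of_eventuallyEq (Eventually.of_forall fun y => ?_)
      · have := hu' x
        push_cast
        field_simp
      · simp
    · exact (RCLike.continuous_ofReal.comp hh).neg.mul
        ((RCLike.continuous_ofReal.comp huc).inv₀ hu')
  -- The quotient of `f` by `u` has derivative zero almost everywhere.
  have key := (isPrim_primitive c g).mul pr
  have hz : (fun x => g x * (u x : 𝕜)⁻¹ + primitive c g x * (-(h x : 𝕜) * (u x : 𝕜)⁻¹))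
      =ᵐ[halfLine] 0 := by
    filter_upwards [ef, hg] with x h1 h2
    rw [h2, ← h1, Pi.zero_apply]
    ring
  filter_upwards [ef, ae_restrict_mem measurableSet_Ioi] with x h1 hx
  have h2 := key.eq_of_ae_eq_zero hz (le_of_lt hx)
  rw [primitive_zero] at h2
  rw [h1, div_eq_mul_inv, ← h2, inv_mul_cancel_right₀ (hu' x)]

/-- Test functions supported inside an edge do not see the vertex, so the form yields `v'' = q v` in
the weak sense. In particular `v'` is in `H¹` and has a boundary value. -/
lemma hasWeakDeriv_edgeDeriv_of_represents_zero [NeZero N] {α : ℝ} {q : Fin N → ℝ →ᵇ ℝ}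
    {V : formDomain 𝕜 N} (hV : Represents α q V 0) (j : Fin N) :
    HasWeakDeriv (edgeDeriv j V) ((memLp_mul (q j) ((V : L2Graph 𝕜 N) j)).toLp _) := by
  intro ψ h
  set v := (V : L2Graph 𝕜 N) j with hv
  have hcont : Continuous (fun x => - deriv (deriv ψ) x + q j x * ψ x) :=
    h.deriv.deriv.1.continuous.neg.add ((q j).continuous.mul h.1.continuous)
  have hm : MemLp (fun x => ((- deriv (deriv ψ) x + q j x * ψ x : ℝ) : 𝕜)) 2 halfLine :=
    IsTest.memLp hcont (h.deriv.deriv.2.1.neg.add h.2.1.mul_left)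
  have h1 := represents_test α q h j hm.coeFn_toLp V
  rw [← form_star, hV, inner_zero_right, star_zero, inner_single_right, inner_eq_integral] at h1
  have h2 := congrArg (starRingEnd 𝕜) h1
  rw [map_zero, ← integral_conj] at h2
  have e1 : ∫ x in Ioi (0 : ℝ), (ψ x • (q j x : 𝕜) * v x - deriv (deriv ψ) x • v x) = 0 := by
    rw [h2]
    refine integral_congr_ae ?_
    filter_upwards [hm.coeFn_toLp] with x hx
    rw [hx]
    simp only [RCLike.star_def, map_mul, RCLike.conj_ofReal, RCLike.conj_conj,
      RCLike.real_smul_eq_coe_mul]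
    push_cast
    ring
  have e2 : ∫ x in Ioi (0 : ℝ), ψ x • (memLp_mul (q j) v).toLp _ x
      = ∫ x in Ioi (0 : ℝ), ψ x • (q j x : 𝕜) * v x := by
    refine integral_congr_ae ?_
    filter_upwards [(memLp_mul (q j) v).coeFn_toLp] with x hx
    rw [hx, smul_mul_assoc]
  have i1 : Integrable (fun x => ψ x • (q j x : 𝕜) * v x) halfLine := by
    refine (integrable_test_smul h.1.continuous h.2.1 ((memLp_mul (q j) v).toLp _)).congr ?_
    filter_upwards [(memLp_mul (q j) v).coeFn_toLp] with x hx
    rw [hx, smul_mul_assoc]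
  have i2 := integrable_test_smul h.deriv.deriv.1.continuous h.deriv.deriv.2.1 v
  rw [integral_sub i1 i2, sub_eq_zero] at e1
  rw [e2, e1, hasWeakDeriv_edgeDeriv j V _ h.deriv, neg_neg]

/-- The vertex condition satisfied by the kernel of the operator associated with the form. -/
lemma sum_boundaryValue_mul_star [NeZero N] {α : ℝ} {q : Fin N → ℝ →ᵇ ℝ}
    {V : formDomain 𝕜 N} (hV : Represents α q V 0) {d : Fin N → 𝕜}
    (hd : ∀ j, HasBoundaryValue (edgeDeriv j V) (d j)) :
    (∑ j, d j) * star (vertexValue V) = α * (vertexValue V * star (vertexValue V)) := by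
  have key : ∀ j, ∫ x in Ioi (0 : ℝ), (edgeDeriv j V x * star (edgeDeriv j V x)
        + (q j x : 𝕜) * ((V : L2Graph 𝕜 N) j x * star ((V : L2Graph 𝕜 N) j x)))
      = -(d j * star (vertexValue V)) := by
    intro j
    have := integral_by_parts (hasWeakDeriv_edgeDeriv_of_represents_zero hV j) (hd j)
      (hasWeakDeriv_edgeDeriv j V) (hasBoundaryValue_vertexValue j V) (u := fun _ => 1)
      (u' := fun _ => 0) (C := 1) (fun x => hasDerivAt_const x 1) continuous_const (by simp)
      (by simp)
    rw [RCLike.ofReal_one, one_mul] at this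
    rw [← this]
    refine integral_congr_ae ?_
    filter_upwards [(memLp_mul (q j) ((V : L2Graph 𝕜 N) j)).coeFn_toLp] with x hx
    rw [hx, RCLike.ofReal_zero]
    ring
  -- Testing with `V` itself gives the vertex condition multiplied by the conjugate of the vertex
  -- value, which loses nothing where that value is nonzero.
  have h0 := hV V
  rw [inner_zero_right, form, Finset.sum_congr rfl fun j _ => key j, Finset.sum_neg_distrib,
    ← Finset.sum_mul] at h0
  linear_combination -h0

lemma integral_by_parts_one {f g f' g' : L2Half 𝕜} {c d : 𝕜} (hf : HasWeakDeriv f f')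
    (bf : HasBoundaryValue f c) (hg : HasWeakDeriv g g') (bg : HasBoundaryValue g d) :
    ∫ x in Ioi (0 : ℝ), (f' x * star (g x) + f x * star (g' x)) = -(c * star d) := by
  have := integral_by_parts hf bf hg bg (u := fun _ => 1) (u' := fun _ => 0) (C := 1)
    (fun x => hasDerivAt_const x 1) continuous_const (by simp) (by simp)
  simpa using this

/-- The boundary values of two square-integrable solutions of `u'' = q u` are proportional. -/
lemma boundaryValue_wronskian {f g w X Y Z : L2Half 𝕜} {a b c d : 𝕜} {q : ℝ → ℝ}
    (hf : HasWeakDeriv f g) (bf : HasBoundaryValue f c) (hg : HasWeakDeriv g w)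
    (bg : HasBoundaryValue g d) (hw : w =ᵐ[halfLine] fun x => (q x : 𝕜) * f x)
    (hX : HasWeakDeriv X Y) (bX : HasBoundaryValue X a) (hY : HasWeakDeriv Y Z)
    (bY : HasBoundaryValue Y b) (hZ : Z =ᵐ[halfLine] fun x => (q x : 𝕜) * X x) :
    d * star a = c * star b := by
  have h1 := integral_by_parts_one hg bg hX bX
  have h2 := integral_by_parts_one hf bf hY bY
  -- Since `q` is real, `w X̄ = q f X̄ = f Z̄`; the two integrations by parts therefore have equal
  -- left sides.
  have e : ∫ x in Ioi (0 : ℝ), (w x * star (X x) + g x * star (Y x))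
      = ∫ x in Ioi (0 : ℝ), (g x * star (Y x) + f x * star (Z x)) := by
    refine integral_congr_ae ?_
    filter_upwards [hw, hZ] with x h3 h4
    rw [h3, h4]
    simp only [RCLike.star_def, map_mul, RCLike.conj_ofReal]
    ring
  rw [h1, h2, neg_inj] at e
  exact e

lemma IsPrim.hasDerivWithinAt {P p : ℝ → 𝕜} (h : IsPrim P p) (hp : ContinuousOn p (Ici 0))
    {x : ℝ} (hx : 0 ≤ x) : HasDerivWithinAt P (p x) (Ici x) x := by
  have hm : StronglyMeasurableAtFilter p (𝓝[Ioi x] x) :=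
    ⟨Ioi x, self_mem_nhdsWithin,
      (hp.mono fun y hy => hx.trans (le_of_lt hy)).aestronglyMeasurable measurableSet_Ioi⟩
  have hc : ContinuousWithinAt p (Ioi x) x :=
    (hp x hx).mono fun y hy => hx.trans (le_of_lt hy)
  have := (intervalIntegral.integral_hasDerivWithinAt_right (h x hx).1 (s := Ici x) hm hc
    ).const_add (P 0)
  refine this.congr (fun y hy => (h y (hx.trans hy)).2) (h x hx).2

/-- Uniqueness for `u'' = q u` with vanishing initial data. -/
lemma eq_zero_of_boundaryValue_zero {f g w : L2Half 𝕜} {q : ℝ →ᵇ ℝ}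
    (hf : HasWeakDeriv f g) (bf : HasBoundaryValue f 0) (hg : HasWeakDeriv g w)
    (bg : HasBoundaryValue g 0) (hw : w =ᵐ[halfLine] fun x => (q x : 𝕜) * f x) : f = 0 := by
  have ef := hf.ae_eq_primitive bf
  have eg := hg.ae_eq_primitive bg
  set F := primitive 0 g with hF
  set G := primitive 0 w with hG
  have pF : IsPrim F G := (isPrim_primitive 0 g).congr_right eg
  have pG : IsPrim G (fun x => (q x : 𝕜) * F x) := (isPrim_primitive 0 w).congr_right (by
    filter_upwards [hw, ef] with x h1 h2
    rw [h1, h2])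
  have cF := pF.continuousOn
  have cG := pG.continuousOn
  have cq : ContinuousOn (fun x => (q x : 𝕜) * F x) (Ici 0) :=
    (RCLike.continuous_ofReal.comp q.continuous).continuousOn.mul cF
  have hz : ∀ x, 0 ≤ x → F x = 0 := fun x hx => by
    -- Grönwall for the first-order system `(F, G)' = (G, q F)`, with Lipschitz constant `max 1 ‖q‖`
    -- in the sup norm.
    have := eq_zero_of_abs_deriv_le_mul_abs_self_of_eq_zero_right
      (f := fun x => (F x, G x)) (f' := fun x => (G x, (q x : 𝕜) * F x)) (K := max 1 ‖q‖)
      (a := 0) (b := x) ((cF.prodMk cG).mono Icc_subset_Ici_self)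
      (fun y hy => (pF.hasDerivWithinAt cG hy.1).prodMk (pG.hasDerivWithinAt cq hy.1))
      (by simp [hF, hG])
      (fun y _ => by
        rw [Prod.norm_def, Prod.norm_def]
        refine max_le ?_ ?_
        · calc ‖G y‖ = 1 * ‖G y‖ := (one_mul _).symm
            _ ≤ _ := mul_le_mul (le_max_left _ _) (le_max_right _ _) (norm_nonneg _) (by positivity)
        · rw [norm_mul, RCLike.norm_ofReal]
          exact mul_le_mul ((q.norm_coe_le_norm y).trans (le_max_right _ _)) (le_max_left _ _)
            (norm_nonneg _) (by positivity)) x (right_mem_Icc.2 hx)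
    exact congrArg Prod.fst this
  rw [Lp.eq_zero_iff_ae_eq_zero]
  filter_upwards [ef, ae_restrict_mem measurableSet_Ioi] with x h1 hx
  rw [h1, hz x (le_of_lt hx), Pi.zero_apply]

/-! ### Vertex data of the profile and the two kernels -/

/-- The logarithmic derivative of the profile as a bounded continuous function. -/
def slopeBCF (k : ℕ) {p ω : ℝ} (hp : 1 < p) (hω : 0 < ω) (α : ℝ) (j : Fin N) : ℝ →ᵇ ℝ :=
  BoundedContinuousFunction.ofNormedAddCommGroup (slope k p α ω j) (continuous_slope hp hω α j)
    √ω (abs_slope_le k p α ω j)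

lemma slopeBCF_apply {k : ℕ} {p ω : ℝ} (hp : 1 < p) (hω : 0 < ω) (α : ℝ) (j : Fin N) (x : ℝ) :
    slopeBCF k hp hω α j x = slope k p α ω j x := rfl

lemma potential_apply {k : ℕ} {p ω : ℝ} (hp : 1 < p) (hω : 0 < ω) (α c : ℝ) (j : Fin N)
    (x : ℝ) : potential k hp hω α c j x = ω - c * profile k p α ω j x ^ (p - 1) := rfl

lemma hasDerivAt_slopeBCF {k : ℕ} {p ω : ℝ} (hp : 1 < p) (hω : 0 < ω) (α : ℝ) (j : Fin N)
    (x : ℝ) : HasDerivAt (slopeBCF k hp hω α j)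
      (potential k hp hω α 1 j x - slopeBCF k hp hω α j x ^ 2) x :=
  (hasDerivAt_slope hp hω α j x).congr_deriv (by rw [potential_apply, one_mul, slopeBCF_apply])

lemma sub_ne_zero_of_le_half {k : ℕ} [NeZero N] (hk : k ≤ (N - 1) / 2) :
    2 * (k : ℝ) - N ≠ 0 := by
  -- With truncated subtraction and division in `ℕ`, the strict inequality needs `N` to be positive.
  have : 2 * k < N := by have := NeZero.pos N; omega
  have : (2 * k : ℝ) < N := by exact_mod_cast this
  exact (sub_neg.2 this).ne

lemma tanh_shift {k : ℕ} {α ω : ℝ} (hω0 : 0 < ω)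
    (hω : α ^ 2 / ((N : ℝ) - 2 * k) ^ 2 < ω) :
    Real.tanh (shift N k α ω) = α / ((2 * (k : ℝ) - N) * √ω) ∧
      (α / ((2 * (k : ℝ) - N) * √ω)) ^ 2 < 1 := by
  have h1 : (α / ((2 * (k : ℝ) - N) * √ω)) ^ 2 < 1 := by
    rw [div_pow, mul_pow, Real.sq_sqrt hω0.le, ← div_div, div_lt_one hω0]
    rwa [← neg_sub, neg_sq] at hω
  refine ⟨Real.tanh_artanh ?_, h1⟩
  exact abs_lt.1 ((sq_lt_one_iff_abs_lt_one _).1 h1)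

lemma slope_zero {k : ℕ} {p α ω : ℝ} (h0 : 2 * (k : ℝ) - N ≠ 0) (hω0 : 0 < ω)
    (hω : α ^ 2 / ((N : ℝ) - 2 * k) ^ 2 < ω) (j : Fin N) :
    slope k p α ω j 0 = (if (j : ℕ) < k then 1 else -1) * (α / (2 * (k : ℝ) - N)) := by
  have hs : 0 < √ω := by positivity
  rw [slope, phase, mul_zero, zero_add]
  split_ifs
  · rw [Real.tanh_neg, (tanh_shift hω0 hω).1]
    field_simp
  · rw [(tanh_shift hω0 hω).1]
    field_simp

lemma tanh_phase_zero_sq {k : ℕ} {p α ω : ℝ} (hω0 : 0 < ω)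
    (hω : α ^ 2 / ((N : ℝ) - 2 * k) ^ 2 < ω) (j : Fin N) :
    Real.tanh (phase k p α ω j 0) ^ 2 = (α / ((2 * (k : ℝ) - N) * √ω)) ^ 2 := by
  rw [phase, mul_zero, zero_add, ← (tanh_shift hω0 hω).1]
  split_ifs <;> simp [Real.tanh_neg]

/-- The arguments at `0` differ only in sign and `sech²` is even, so the profile is continuous at
the vertex. -/
lemma profile_zero {k : ℕ} {p α ω : ℝ} (hω0 : 0 < ω)
    (hω : α ^ 2 / ((N : ℝ) - 2 * k) ^ 2 < ω) (i j : Fin N) :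
    profile k p α ω i 0 = profile k p α ω j 0 := by
  rw [profile_eq_rpow, profile_eq_rpow, tanh_phase_zero_sq hω0 hω,
    tanh_phase_zero_sq hω0 hω]

lemma sum_sign {k : ℕ} (hk : k ≤ N) :
    ∑ j : Fin N, (if (j : ℕ) < k then (1 : ℝ) else -1) = 2 * k - N := by
  rw [Fin.sum_univ_eq_sum_range (fun i => if i < k then (1 : ℝ) else -1) N]
  obtain ⟨r, rfl⟩ := Nat.exists_eq_add_of_le hk
  rw [Finset.sum_range_add]
  rw [Finset.sum_congr rfl (g := fun _ => (1 : ℝ)) fun i hi => if_pos (Finset.mem_range.1 hi),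
    Finset.sum_congr (s₁ := Finset.range r) rfl (g := fun _ => (-1 : ℝ))
      fun i _ => if_neg (by omega)]
  simp
  ring

/-- The slopes are `m` on `k` edges and `-m` on `N - k` edges, with `m = α / (2k - N)`. This is the
vertex condition of the profile divided by its vertex value. -/
lemma sum_slope_zero {k : ℕ} {p α ω : ℝ} (hp : 1 < p) (h0 : 2 * (k : ℝ) - N ≠ 0) (hk : k ≤ N)
    (hω0 : 0 < ω) (hω : α ^ 2 / ((N : ℝ) - 2 * k) ^ 2 < ω) :
    ∑ j : Fin N, slopeBCF k hp hω0 α j 0 = α := by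
  simp only [slopeBCF_apply, slope_zero h0 hω0 hω]
  rw [← Finset.sum_mul, sum_sign hk, mul_div_cancel₀ _ h0]

/-- The profile on the `j`-th edge, as an element of `L²(0, ∞)`. -/
def profileL2 (𝕜 : Type*) [RCLike 𝕜] (k : ℕ) {p ω : ℝ} (hp : 1 < p) (hω : 0 < ω) (α : ℝ)
    (j : Fin N) : L2Half 𝕜 :=
  (memLp_profile (k := k) hp hω α j).ofReal.toLp (fun x => (profile k p α ω j x : 𝕜))

lemma coeFn_profileL2 {k : ℕ} {p ω : ℝ} (hp : 1 < p) (hω : 0 < ω) (α : ℝ) (j : Fin N) :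
    profileL2 𝕜 k hp hω α j =ᵐ[halfLine] fun x => (profile k p α ω j x : 𝕜) :=
  MemLp.coeFn_toLp _

/-- Multiplication by a bounded continuous function on `L²(0, ∞)`. -/
def bmul (q : ℝ →ᵇ ℝ) (f : L2Half 𝕜) : L2Half 𝕜 := (memLp_mul q f).toLp _

lemma coeFn_bmul (q : ℝ →ᵇ ℝ) (f : L2Half 𝕜) :
    bmul q f =ᵐ[halfLine] fun x => (q x : 𝕜) * f x := MemLp.coeFn_toLp _

lemma hasWeakDeriv_of_hasDerivAt {u u' : ℝ → ℝ} (hu : ∀ x, HasDerivAt u (u' x) x)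
    (hu' : Continuous u') {f g : L2Half 𝕜} (hf : f =ᵐ[halfLine] fun x => (u x : 𝕜))
    (hg : g =ᵐ[halfLine] fun x => (u' x : 𝕜)) :
    HasWeakDeriv f g ∧ HasBoundaryValue f (u 0 : 𝕜) := by
  have h : IsPrim (fun x => (u x : 𝕜)) (fun x => (u' x : 𝕜)) :=
    IsPrim.of_hasDerivAt (fun x => hasDerivAt_ofReal_comp (hu x))
      (RCLike.continuous_ofReal.comp hu')
  exact ⟨hasWeakDeriv_of_isPrim (h.congr_right hg.symm) hf, hasBoundaryValue_of_isPrim h hf⟩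

lemma coeFn_bmul_profile {k : ℕ} {p ω : ℝ} (hp : 1 < p) (hω : 0 < ω) (α : ℝ) (j : Fin N)
    (q : ℝ →ᵇ ℝ) : bmul q (profileL2 𝕜 k hp hω α j) =ᵐ[halfLine]
      fun x => ((q x * profile k p α ω j x : ℝ) : 𝕜) := by
  filter_upwards [coeFn_bmul q (profileL2 𝕜 k hp hω α j), coeFn_profileL2 (𝕜 := 𝕜) hp hω α j] with x h1 h2
  rw [h1, h2, RCLike.ofReal_mul]

lemma hasWeakDeriv_profileL2 {k : ℕ} {p ω : ℝ} (hp : 1 < p) (hω : 0 < ω) (α : ℝ) (j : Fin N) :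
    HasWeakDeriv (profileL2 𝕜 k hp hω α j)
        (bmul (slopeBCF k hp hω α j) (profileL2 𝕜 k hp hω α j)) ∧
      HasBoundaryValue (profileL2 𝕜 k hp hω α j) (profile k p α ω j 0 : 𝕜) :=
  hasWeakDeriv_of_hasDerivAt (hasDerivAt_profile hp hω α j)
    ((continuous_slope hp hω α j).mul (continuous_profile hp hω α j))
    (coeFn_profileL2 hp hω α j) (coeFn_bmul_profile hp hω α j _)

lemma hasWeakDeriv_slope_mul_profile {k : ℕ} {p ω : ℝ} (hp : 1 < p) (hω : 0 < ω) (α : ℝ)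
    (j : Fin N) :
    HasWeakDeriv (bmul (slopeBCF k hp hω α j) (profileL2 𝕜 k hp hω α j))
        (bmul (potential k hp hω α 1 j) (profileL2 𝕜 k hp hω α j)) ∧
      HasBoundaryValue (bmul (slopeBCF k hp hω α j) (profileL2 𝕜 k hp hω α j))
        ((slope k p α ω j 0 * profile k p α ω j 0 : ℝ) : 𝕜) := by
  refine hasWeakDeriv_of_hasDerivAt (u := fun x => slope k p α ω j x * profile k p α ω j x)
    (u' := fun x => potential k hp hω α 1 j x * profile k p α ω j x) (fun x => ?_)
    ((BoundedContinuousFunction.continuous _).mul (continuous_profile hp hω α j))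
    (coeFn_bmul_profile hp hω α j _) (coeFn_bmul_profile hp hω α j _)
  refine ((hasDerivAt_slope hp hω α j x).mul (hasDerivAt_profile hp hω α j x)).congr_deriv ?_
  rw [potential_apply]
  ring

/-- Differentiating the profile equation once more: `(φ^(p-1))' = (p - 1) h φ^(p-1)` raises the
coefficient of `φ^(p-1)` from `1` to `p`. So `φ'` solves the equation of the first operator on each
edge, though it violates continuity at the vertex when its values there have opposite signs. -/
lemma hasWeakDeriv_potential_mul_profile {k : ℕ} {p ω : ℝ} (hp : 1 < p) (hω : 0 < ω) (α : ℝ)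
    (j : Fin N) :
    HasWeakDeriv (bmul (potential k hp hω α 1 j) (profileL2 𝕜 k hp hω α j))
        (bmul (potential k hp hω α p j)
          (bmul (slopeBCF k hp hω α j) (profileL2 𝕜 k hp hω α j))) ∧
      HasBoundaryValue (bmul (potential k hp hω α 1 j) (profileL2 𝕜 k hp hω α j))
        ((potential k hp hω α 1 j 0 * profile k p α ω j 0 : ℝ) : 𝕜) := by
  refine hasWeakDeriv_of_hasDerivAt
    (u := fun x => potential k hp hω α 1 j x * profile k p α ω j x)
    (u' := fun x => potential k hp hω α p j x * (slope k p α ω j x * profile k p α ω j x))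
    (fun x => ?_)
    ((BoundedContinuousFunction.continuous _).mul
      ((continuous_slope hp hω α j).mul (continuous_profile hp hω α j)))
    (coeFn_bmul_profile hp hω α j _) ?_
  · have h1 := ((hasDerivAt_profile_rpow (k := k) hp hω α j x).const_mul 1).const_sub ω
    refine (h1.mul (hasDerivAt_profile hp hω α j x)).congr_deriv ?_
    rw [potential_apply]
    ring
  · filter_upwards [coeFn_bmul (potential k hp hω α p j)
      (bmul (slopeBCF k hp hω α j) (profileL2 𝕜 k hp hω α j)),
      coeFn_bmul_profile (𝕜 := 𝕜) hp hω α j (slopeBCF k hp hω α j)] with x h1 h2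
    rw [h1, h2, slopeBCF_apply, RCLike.ofReal_mul (potential k hp hω α p j x)]

/-- The kernel of `L₁` is trivial. -/
theorem kernel_linOp₁ [NeZero N] {k : ℕ} {p α ω : ℝ} (hp : 1 < p) (hα : α ≠ 0)
    (h0 : 2 * (k : ℝ) - N ≠ 0) (hk : k ≤ N) (hω0 : 0 < ω)
    (hω : α ^ 2 / ((N : ℝ) - 2 * k) ^ 2 < ω) :
    UnboundedOp.kernel (linOp₁ 𝕜 N k α hp hω0) = ⊥ := by
  rw [Submodule.eq_bot_iff]
  intro U hU
  obtain ⟨V, rfl, hV⟩ := mem_kernel_formOperator.1 hU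
  have hg := hasWeakDeriv_edgeDeriv_of_represents_zero hV
  choose d hd using fun j => (hg j).exists_boundaryValue
  have hw := fun j => coeFn_bmul (potential k hp hω0 α p j) ((V : L2Graph 𝕜 N) j)
  set τ := vertexValue V with hτ
  set m := α / (2 * (k : ℝ) - N) with hm
  have hm0 : m ≠ 0 := div_ne_zero hα h0
  set κ := ω - (p + 1) * ω / 2 * (1 - m ^ 2 / ω) with hκ
  have hmω : (α / ((2 * (k : ℝ) - N) * √ω)) ^ 2 = m ^ 2 / ω := by
    rw [← div_div, div_pow, Real.sq_sqrt hω0.le]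
  have hκ' (j : Fin N) : potential k hp hω0 α 1 j 0 = κ := by
    rw [potential_apply, profile_rpow' hp hω0, tanh_phase_zero_sq hω0 hω, hmω, one_mul]
  -- The Wronskian of `v_j` and `φ_j'` at the vertex, divided by `φ_j(0)`: here `φ_j'(0) = ± m
  -- φ_j(0)` and `φ_j''(0) = κ φ_j(0)`.
  have hwr (j : Fin N) : d j * (((if (j : ℕ) < k then 1 else -1) * m : ℝ) : 𝕜) = τ * (κ : 𝕜) := by
    have h1 := boundaryValue_wronskian (hasWeakDeriv_edgeDeriv j V)
      (hasBoundaryValue_vertexValue j V) (hg j) (hd j) (hw j)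
      (hasWeakDeriv_slope_mul_profile (k := k) hp hω0 α j).1
      (hasWeakDeriv_slope_mul_profile hp hω0 α j).2
      (hasWeakDeriv_potential_mul_profile hp hω0 α j).1
      (hasWeakDeriv_potential_mul_profile hp hω0 α j).2 (coeFn_bmul _ _)
    rw [RCLike.star_def, RCLike.conj_ofReal, RCLike.conj_ofReal, slope_zero h0 hω0 hω, hκ',
      RCLike.ofReal_mul _ (profile k p α ω j 0), RCLike.ofReal_mul κ, ← mul_assoc, ← mul_assoc] at h1
    refine mul_right_cancel₀ ?_ h1
    exact_mod_cast (profile_pos hp hω0 α j 0).ne'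
  have hdj (j : Fin N) : d j * (m : 𝕜) = (((if (j : ℕ) < k then 1 else -1) : ℝ) : 𝕜) * (τ * κ) := by
    rw [← hwr j]
    split_ifs <;> push_cast <;> ring
  have hsum : (∑ j, d j) * (m : 𝕜) = ((2 * (k : ℝ) - N : ℝ) : 𝕜) * (τ * κ) := by
    rw [Finset.sum_mul, Finset.sum_congr rfl fun j _ => hdj j, ← Finset.sum_mul,
      ← RCLike.ofReal_sum, sum_sign hk]
  have hv := sum_boundaryValue_mul_star hV hd
  have hτ0 : τ = 0 := by
    by_contra hne
    rw [← hτ, ← mul_assoc] at hv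
    have h1 := mul_right_cancel₀ (star_ne_zero.2 hne) hv
    rw [h1] at hsum
    have h2 : α * m = (2 * (k : ℝ) - N) * κ := by
      have : ((α * m : ℝ) : 𝕜) * τ = (((2 * (k : ℝ) - N) * κ : ℝ) : 𝕜) * τ := by
        rw [RCLike.ofReal_mul, RCLike.ofReal_mul (2 * (k : ℝ) - N)]
        linear_combination hsum
      exact_mod_cast mul_right_cancel₀ hne this
    have hαm : α = m * (2 * (k : ℝ) - N) := (div_mul_cancel₀ _ h0).symm
    -- With `t = m² / ω < 1` this equality reads `ω (1 - t) = (p + 1) / 2 * ω (1 - t)`, impossible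
    -- for `p > 1`.
    have h3 : m ^ 2 = κ := by
      refine mul_left_cancel₀ h0 ?_
      rw [← h2]
      linear_combination (-m) * hαm
    have h4 := (tanh_shift hω0 hω).2
    rw [hmω] at h4
    have h5 : m ^ 2 = ω * (m ^ 2 / ω) := by field_simp
    rw [hκ, h5] at h3
    have h5' : ω * (m ^ 2 / ω) / ω = m ^ 2 / ω := by field_simp
    rw [h5'] at h3
    have h6 : 0 < ω * (1 - m ^ 2 / ω) := mul_pos hω0 (by linarith)
    nlinarith [mul_pos h6 (sub_pos.2 hp)]
  -- Here `α ≠ 0` enters: `m ≠ 0` means that `φ_j'` does not vanish at the vertex, so the Wronskian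
  -- relation determines `v_j'(0)`.
  have hd0 (j : Fin N) : d j = 0 := by
    have h1 := hdj j
    rw [hτ0, zero_mul, mul_zero] at h1
    exact (mul_eq_zero.1 h1).resolve_right (by exact_mod_cast hm0)
  ext1 j
  refine eq_zero_of_boundaryValue_zero (hasWeakDeriv_edgeDeriv j V) ?_ (hg j) ?_ (hw j)
  · rw [← hτ0]; exact hasBoundaryValue_vertexValue j V
  · rw [← hd0 j]; exact hd j

/-- The profile as an element of the form domain. -/
def profileForm (𝕜 : Type*) [RCLike 𝕜] {k : ℕ} {p α ω : ℝ} (hp : 1 < p)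
    (hω0 : 0 < ω)
    (hω : α ^ 2 / ((N : ℝ) - 2 * k) ^ 2 < ω) [NeZero N] : formDomain 𝕜 N :=
  ⟨WithLp.toLp 2 fun j => profileL2 𝕜 k hp hω0 α j,
    fun j => ⟨_, (hasWeakDeriv_profileL2 hp hω0 α j).1⟩, (profile k p α ω (0 : Fin N) 0 : 𝕜),
    fun j => by
      rw [profile_zero hω0 hω 0 j]
      exact (hasWeakDeriv_profileL2 hp hω0 α j).2⟩

/-- A vanishing sum of squares gives `v_j' = h_j v_j`, so `v_j` is `v(0) / φ_j(0)` times the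
profile; `φ_j(0)` does not depend on the edge, so neither does the factor. Conversely the profile
annihilates every square. -/
theorem kernel_linOp₂ [NeZero N] {k : ℕ} {p α ω : ℝ} (hp : 1 < p)
    (h0 : 2 * (k : ℝ) - N ≠ 0) (hk : k ≤ N) (hω0 : 0 < ω)
    (hω : α ^ 2 / ((N : ℝ) - 2 * k) ^ 2 < ω) :
    UnboundedOp.kernel (linOp₂ 𝕜 N k α hp hω0)
      = Submodule.span 𝕜 {(profileForm 𝕜 hp hω0 hω : L2Graph 𝕜 N)} := by
  have hs := sum_slope_zero hp h0 hk hω0 hω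
  refine le_antisymm (fun U hU => ?_) ?_
  · obtain ⟨V, rfl, hV⟩ := mem_kernel_formOperator.1 hU
    rw [Submodule.mem_span_singleton]
    refine ⟨vertexValue V / (profile k p α ω (0 : Fin N) 0 : 𝕜), ?_⟩
    ext1 j
    have h1 := ae_eq_of_weakDeriv_eq (hasWeakDeriv_edgeDeriv j V)
      (hasBoundaryValue_vertexValue j V) (hasDerivAt_profile hp hω0 α j)
      (continuous_slope hp hω0 α j) (fun x => (profile_pos hp hω0 α j x).ne')
      (edgeDeriv_ae_eq_of_represents_zero (hasDerivAt_slopeBCF hp hω0 α) hs hV j)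
    rw [PiLp.smul_apply]
    refine Lp.ext ?_
    filter_upwards [h1, coeFn_profileL2 (𝕜 := 𝕜) hp hω0 α j, Lp.coeFn_smul (vertexValue V /
      (profile k p α ω (0 : Fin N) 0 : 𝕜)) (profileL2 𝕜 k hp hω0 α j)] with x h2 h3 h4
    refine Eq.trans h4 ?_
    rw [h2, Pi.smul_apply, h3, smul_eq_mul, profile_zero hω0 hω 0 j]
  · rw [Submodule.span_singleton_le_iff_mem]
    refine mem_kernel_formOperator.2 ⟨_, rfl, represents_zero_of_edgeDeriv
      (hasDerivAt_slopeBCF hp hω0 α) hs fun j => ?_⟩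
    rw [edgeDeriv_eq (V := profileForm 𝕜 hp hω0 hω) (hasWeakDeriv_profileL2 hp hω0 α j).1]
    exact coeFn_bmul _ _

end StarGraph

end

/-! ### The theorem -/

theorem proposition3p5 {𝕜 : Type*} [RCLike 𝕜] (N : ℕ) [NeZero N] (k : ℕ)
    (hk1 : 1 ≤ k) (hk2 : k ≤ (N - 1) / 2) (p α ω : ℝ) (hp : 1 < p) (hα : α ≠ 0)
    -- implied by the last hypothesis; it is an argument of the operators
    (hω0 : 0 < ω)
    (hω : α ^ 2 / ((N : ℝ) - 2 * k) ^ 2 < ω) :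
    ((∃ Φ : StarGraph.L2Graph 𝕜 N, StarGraph.IsProfile k p α ω Φ ∧
        UnboundedOp.kernel (StarGraph.linOp₂ 𝕜 N k α hp hω0) = Submodule.span 𝕜 {Φ}) ∧
      UnboundedOp.Nonneg (StarGraph.linOp₂ 𝕜 N k α hp hω0)) ∧
    UnboundedOp.kernel (StarGraph.linOp₁ 𝕜 N k α hp hω0) = ⊥ ∧
    ((∃ δ : ℝ, 0 < δ ∧ ∀ l : ℝ, 0 < l →
        (l : 𝕜) ∈ UnboundedOp.spectrum (StarGraph.linOp₁ 𝕜 N k α hp hω0) → δ ≤ l) ∧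
      (∃ δ : ℝ, 0 < δ ∧ ∀ l : ℝ, 0 < l →
        (l : 𝕜) ∈ UnboundedOp.spectrum (StarGraph.linOp₂ 𝕜 N k α hp hω0) → δ ≤ l) ∧
      UnboundedOp.essentialSpectrum (StarGraph.linOp₁ 𝕜 N k α hp hω0) = (fun l : ℝ => (l : 𝕜)) '' Set.Ici ω ∧
      UnboundedOp.essentialSpectrum (StarGraph.linOp₂ 𝕜 N k α hp hω0) = (fun l : ℝ => (l : 𝕜)) '' Set.Ici ω) := by
  have h0 := StarGraph.sub_ne_zero_of_le_half hk2
  have hk : k ≤ N := by omega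
  refine ⟨⟨⟨StarGraph.profileForm 𝕜 hp hω0 hω, fun j => StarGraph.coeFn_profileL2 hp hω0 α j,
      StarGraph.kernel_linOp₂ hp h0 hk hω0 hω⟩,
    StarGraph.nonneg_of_riccati (StarGraph.hasDerivAt_slopeBCF hp hω0 α)
      (StarGraph.sum_slope_zero hp h0 hk hω0 hω)⟩,
    StarGraph.kernel_linOp₁ hp hα h0 hk hω0 hω,
    StarGraph.exists_spectral_gap α hω0 (StarGraph.tendsto_potential hp hω0 α p),
    StarGraph.exists_spectral_gap α hω0 (StarGraph.tendsto_potential hp hω0 α 1),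
    StarGraph.essentialSpectrum_formOperator α (StarGraph.tendsto_potential hp hω0 α p),
    StarGraph.essentialSpectrum_formOperator α (StarGraph.tendsto_potential hp hω0 α 1)⟩
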